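/- Let $A$ be a finite dimensional algebra over a field $K$. Modules are finitely generated right $A$-modules unless stated otherwise, $D=\mathrm{Hom}_K(-,K)$, and a class of modules is called representation-finite if it contains only finitely many indecomposable modules up to isomorphism; $A$ is representation-finite if the class of all its modules is. Put $${}^{\perp}A=\{M : \mathrm{Ext}^i_A(M,A)=0 \text{ for all } i\ge 1\},\qquad D(A)^{\perp}=\{M : \mathrm{Ext}^i_A(D(A),M)=0 \text{ for all } i\ge 1\}.$$ A module $M$ is Gorenstein projective if $\mathrm{Ext}^i(M,A)=0=\mathrm{Ext}^i(\mathrm{Tr}\,M,A)$ for all $i\ge 1$, where $\mathrm{Tr}$ is the transpose (a left module), and Gorenstein injective if the left module $D(M)$ is Gorenstein projective. The algebra $A$ is nearly Gorenstein if ${}^{\perp}A$ is the class of Gorenstein projective modules and $D(A)^{\perp}$ is the class of Gorenstein injective modules; it is CM-finite if the class of Gorenstein projective modules is representation-finite; it is torsionless-finite if the class $\Omega^1(\text{mod-}A)$ of first syzygy modules (including all projective modules) is representation-finite; it is Gorenstein if the left and right injective dimensions of $A$ are finite and equal. The dominant dimension of $A$ is the supremum of all $n$ such that the first $n$ terms $I_0,\dots,I_{n-1}$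 of a minimal injective resolution of $A_A$ are projective. Then: 1. If ${}^{\perp}A$ and $D(A)^{\perp}$ are representation-finite, then $A$ is nearly Gorenstein. In particular, if $A$ is representation-finite, then $A$ is nearly Gorenstein. 2. Let $A$ have dominant dimension at least $2$, let $e\in A$ be an idempotent such that $eA$ is a minimal faithful projective-injective right $A$-module (that is, $eA$ is projective, injective and faithful, and a direct summand of every faithful module), and put $P=\mathrm{Hom}_A(D(eA),A)$ and $B_2=\mathrm{End}_A(P)$. If the algebra $B_2$ is representation-finite, then $A$ is CM-finite and nearly Gorenstein. 3. If $A$ is torsionless-finite, then $A$ is nearly Gorenstein. 4. If $\mathrm{rad}^2(A)=0$, then $A$ is nearly Gorenstein. If in addition $A$ is connected (that is, $A\ne 0$ and the only central idempotents of $A$ are $0$ and $1$) and not selfinjective, then ${}^{\perp}A$ is the class of finitely generated projective modules, and hence $A$ is not Gorenstein or has finite global dimension. -/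

import Mathlib

open CategoryTheory
open scoped ModuleCat

universe u

noncomputable section

namespace NearlyGor

/-! Right `A`-modules are modules over `Aᵐᵒᵖ`, as everywhere in Mathlib.
The notions that make sense over any ring are stated for left modules over a ring `R`. -/

section GeneralRing

variable {R : Type u} [Ring R]

/-- `Ext^i_R(M, N) = 0` for all `i ≥ 1`. -/
def ExtVanishes (M N : ModuleCat.{u} R) : Prop :=
  ∀ i : ℕ, 1 ≤ i → Subsingleton (Abelian.Ext M N i)

/-- A class of modules is representation-finite if it contains, up to isomorphism, only finitely
many indecomposable modules. -/
def IsRepFiniteClass (C : ModuleCat.{u} R → Prop) : Prop :=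
  ∃ (n : ℕ) (X : Fin n → ModuleCat.{u} R),
    ∀ M : ModuleCat.{u} R, C M → Indecomposable M → ∃ i, Nonempty (M ≅ X i)

/-- The first syzygies of finitely generated modules (with respect to arbitrary, not only
minimal, finitely generated projective presentations `0 → M → P → N → 0`;
this includes all finitely generated projective modules). -/
def IsFirstSyzygy (M : ModuleCat.{u} R) : Prop :=
  ∃ (P N : ModuleCat.{u} R) (f : M →ₗ[R] P) (g : P →ₗ[R] N),
    Module.Finite R M ∧ Module.Finite R P ∧ Module.Projective R P ∧
      Function.Injective f ∧ Function.Exact f g ∧ Function.Surjective g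

/-- `j : M → I` is an injective hull: an essential embedding into an injective module. -/
structure IsInjectiveHull {M I : ModuleCat.{u} R} (j : M →ₗ[R] I) : Prop where
  injective_module : Module.Injective R I
  injective_map : Function.Injective j
  essential : ∀ N : Submodule R I, N ⊓ LinearMap.range j = ⊥ → N = ⊥

/-- In a minimal injective resolution `0 → M → I₀ → I₁ → ⋯`, the first `n` terms
`I₀, …, I_{n-1}` are projective. -/
def FirstTermsProjective : ℕ → ModuleCat.{u} R → Prop
  | 0, _ => True
  | n + 1, M => ∃ (I : ModuleCat.{u} R) (j : M →ₗ[R] I),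
      IsInjectiveHull j ∧ Module.Projective R I ∧
        FirstTermsProjective n (ModuleCat.of R (I ⧸ LinearMap.range j))

/-- The dominant dimension of a module. -/
def domdim (M : ModuleCat.{u} R) : ℕ∞ :=
  ⨆ (n : ℕ) (_ : FirstTermsProjective n M), (n : ℕ∞)

/-- `M` is a minimal faithful module: it is faithful, and it is a direct summand of every
finitely generated faithful module. -/
def IsMinimalFaithful (M : ModuleCat.{u} R) : Prop :=
  FaithfulSMul R M ∧
    ∀ N : ModuleCat.{u} R, Module.Finite R N → FaithfulSMul R N →
      ∃ (i : M →ₗ[R] N) (p : N →ₗ[R] M), p ∘ₗ i = LinearMap.id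

end GeneralRing

section Transpose

variable (R S U : Type u) [Ring R] [Ring S] [AddCommGroup U] [Module R U] [Module S U]
  [SMulCommClass R S U] [SMulCommClass S R U]

/-- `N` is a transpose of the `R`-module `M`: there is a presentation `P₁ → P₀ → M → 0` by
finitely generated projective modules such that `N` is isomorphic to the cokernel of
`Hom_R(P₀, U) → Hom_R(P₁, U)`. This is used only for `U = A` and `(R, S) = (A, Aᵐᵒᵖ)` or
`(R, S) = (Aᵐᵒᵖ, A)`; then `N` is unique up to finitely generated projective direct summands. -/
def IsTranspose (M : ModuleCat.{u} R) (N : ModuleCat.{u} S) : Prop :=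
  ∃ (P₁ P₀ : ModuleCat.{u} R) (f : P₁ →ₗ[R] P₀) (g : P₀ →ₗ[R] M),
    Module.Finite R P₁ ∧ Module.Projective R P₁ ∧ Module.Finite R P₀ ∧ Module.Projective R P₀ ∧
      Function.Exact f g ∧ Function.Surjective g ∧
      Nonempty (N ≃ₗ[S] ((P₁ →ₗ[R] U) ⧸ LinearMap.range (LinearMap.lcomp S U f)))

/-- `M` is finitely generated with `Ext^i(M, U) = 0 = Ext^i(Tr M, U)` for all `i ≥ 1`. -/
def IsGPAux (M : ModuleCat.{u} R) : Prop :=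
  Module.Finite R M ∧ ExtVanishes M (ModuleCat.of R U) ∧
    ∃ N : ModuleCat.{u} S, IsTranspose R S U M N ∧ ExtVanishes N (ModuleCat.of S U)

end Transpose

section Algebras

variable (K A : Type u) [Field K] [Ring A] [Algebra K A]

/-- The regular right module `A_A`. -/
abbrev rightReg : ModuleCat.{u} Aᵐᵒᵖ := ModuleCat.of Aᵐᵒᵖ A

/-- The regular left module `_A A`. -/
abbrev leftReg : ModuleCat.{u} A := ModuleCat.of A A

/-- The left module structure on `Hom_K(M, K)`, for `M` a right module: `(a f)(x) = f(x a)`. -/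
abbrev dualOfRightModule (M : ModuleCat.{u} Aᵐᵒᵖ) : Module A (M →ₗ[K] K) where
  smul a f := f ∘ₗ Algebra.lsmul K K M (MulOpposite.op a)
  one_smul f := by ext x; change f ((1 : Aᵐᵒᵖ) • x) = f x; rw [one_smul]
  mul_smul a b f := by
    ext x
    change f ((MulOpposite.op b * MulOpposite.op a) • x) =
      f (MulOpposite.op b • (MulOpposite.op a • x))
    rw [mul_smul]
  smul_zero _ := rfl
  smul_add _ _ _ := rfl
  add_smul a b f := by
    ext x
    change f ((MulOpposite.op a + MulOpposite.op b) • x) =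
      f (MulOpposite.op a • x) + f (MulOpposite.op b • x)
    rw [add_smul, map_add]
  zero_smul f := by ext x; change f ((0 : Aᵐᵒᵖ) • x) = 0; rw [zero_smul, map_zero]

/-- The right module structure on `Hom_K(M, K)`, for `M` a left module: `(f a)(x) = f(a x)`. -/
abbrev dualOfLeftModule (M : ModuleCat.{u} A) : Module Aᵐᵒᵖ (M →ₗ[K] K) where
  smul a f := f ∘ₗ Algebra.lsmul K K M (MulOpposite.unop a)
  one_smul f := by ext x; change f ((1 : A) • x) = f x; rw [one_smul]
  mul_smul a b f := by
    ext x
    change f ((MulOpposite.unop b * MulOpposite.unop a) • x) =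
      f (MulOpposite.unop b • (MulOpposite.unop a • x))
    rw [mul_smul]
  smul_zero _ := rfl
  smul_add _ _ _ := rfl
  add_smul a b f := by
    ext x
    change f ((MulOpposite.unop a + MulOpposite.unop b) • x) =
      f (MulOpposite.unop a • x) + f (MulOpposite.unop b • x)
    rw [add_smul, map_add]
  zero_smul f := by ext x; change f ((0 : A) • x) = 0; rw [zero_smul, map_zero]

variable {A}

/-- `D(M) = Hom_K(M, K)`, a left module, for a right module `M`. -/
def dualRL (M : ModuleCat.{u} Aᵐᵒᵖ) : ModuleCat.{u} A :=
  letI := dualOfRightModule K A M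
  ModuleCat.of A (M →ₗ[K] K)

/-- `D(M) = Hom_K(M, K)`, a right module, for a left module `M`. -/
def dualLR (M : ModuleCat.{u} A) : ModuleCat.{u} Aᵐᵒᵖ :=
  letI := dualOfLeftModule K A M
  ModuleCat.of Aᵐᵒᵖ (M →ₗ[K] K)

/-- Gorenstein projective right modules; here `Tr M` is a left module. -/
def IsGorensteinProjective (M : ModuleCat.{u} Aᵐᵒᵖ) : Prop := IsGPAux Aᵐᵒᵖ A A M

/-- Gorenstein projective left modules; here `Tr M` is a right module. -/
def IsGorensteinProjectiveLeft (M : ModuleCat.{u} A) : Prop := IsGPAux A Aᵐᵒᵖ A M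

/-- Gorenstein injective right modules: `D(M)` is a Gorenstein projective left module. -/
def IsGorensteinInjective (M : ModuleCat.{u} Aᵐᵒᵖ) : Prop :=
  Module.Finite Aᵐᵒᵖ M ∧ IsGorensteinProjectiveLeft (dualRL K M)

/-- `⊥A`: the finitely generated right modules `M` with `Ext^i(M, A) = 0` for all `i ≥ 1`. -/
def InPerpA (M : ModuleCat.{u} Aᵐᵒᵖ) : Prop :=
  Module.Finite Aᵐᵒᵖ M ∧ ExtVanishes M (rightReg A)

/-- `D(A)^⊥`: the finitely generated right modules `M` with `Ext^i(D(A), M) = 0` for all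
`i ≥ 1`. -/
def InDAPerp (M : ModuleCat.{u} Aᵐᵒᵖ) : Prop :=
  Module.Finite Aᵐᵒᵖ M ∧ ExtVanishes (dualLR K (leftReg A)) M

variable (A)

def IsLeftNearlyGorenstein : Prop :=
  ∀ M : ModuleCat.{u} Aᵐᵒᵖ, IsGorensteinProjective M ↔ InPerpA M

def IsRightNearlyGorenstein : Prop :=
  ∀ M : ModuleCat.{u} Aᵐᵒᵖ, IsGorensteinInjective K M ↔ InDAPerp K M

def IsNearlyGorenstein : Prop := IsLeftNearlyGorenstein A ∧ IsRightNearlyGorenstein K A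

/-- The category of finitely generated right modules is representation-finite. -/
def IsRepFinite : Prop :=
  IsRepFiniteClass (fun M : ModuleCat.{u} Aᵐᵒᵖ => Module.Finite Aᵐᵒᵖ M)

def IsCMFinite : Prop :=
  IsRepFiniteClass (fun M : ModuleCat.{u} Aᵐᵒᵖ => IsGorensteinProjective M)

def IsTorsionlessFinite : Prop :=
  IsRepFiniteClass (fun M : ModuleCat.{u} Aᵐᵒᵖ => IsFirstSyzygy M)

/-- `A` is nonzero and has no central idempotents except `0` and `1`. -/
def IsConnectedAlgebra : Prop :=
  Nontrivial A ∧ ∀ e ∈ Subring.center A, IsIdempotentElem e → e = 0 ∨ e = 1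

def IsSelfinjective : Prop := Module.Injective Aᵐᵒᵖ A

/-- The right and left injective dimensions of `A` are equal and finite. -/
def IsGorenstein : Prop :=
  ∃ g : ℕ, injectiveDimension (rightReg A) = g ∧ injectiveDimension (leftReg A) = g

/-- The projective dimensions of the finitely generated right modules are bounded. -/
def HasFiniteGlobalDimension : Prop :=
  ∃ n : ℕ, ∀ M : ModuleCat.{u} Aᵐᵒᵖ, Module.Finite Aᵐᵒᵖ M → HasProjectiveDimensionLE M n

variable {A}

/-- The right ideal `eA`. -/
def rightIdeal (e : A) : ModuleCat.{u} Aᵐᵒᵖ :=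
  ModuleCat.of Aᵐᵒᵖ (Submodule.span Aᵐᵒᵖ ({e} : Set A))

/-- `e` is an idempotent such that `eA` is a minimal faithful projective-injective right
module. -/
def IsMinimalFaithfulIdempotent (e : A) : Prop :=
  IsIdempotentElem e ∧ Module.Projective Aᵐᵒᵖ (rightIdeal e) ∧
    Module.Injective Aᵐᵒᵖ (rightIdeal e) ∧ IsMinimalFaithful (rightIdeal e)

/-- The right module `P = Hom_A(D(eA), A)` of left module homomorphisms, with
`(φ a)(x) = φ(x) a`. -/
def moduleP (e : A) : ModuleCat.{u} Aᵐᵒᵖ :=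
  ModuleCat.of Aᵐᵒᵖ (dualRL K (rightIdeal e) →ₗ[A] A)

/-- `B₂ = End_A(P)`. -/
abbrev algebraB₂ (e : A) : Type u := Module.End Aᵐᵒᵖ (moduleP K e)

end Algebras

end NearlyGor

end

/-!
Let `U` be the regular bimodule, and let `M` be an indecomposable nonprojective module in `⊥U`.
Maps from a syzygy `ΩX`, with `X` in `⊥U`, to a projective module extend to the projective cover,
so `Ω` is fully faithful on the stable category of `⊥U`. Hence all syzygies of `M` are stably
indecomposable and nonprojective. If they or their duals lie, from the second one on, in a
summand-closed class with finitely many indecomposable nonprojective objects, then some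
`Ω^k M` is a stable summand of `Ω^l M` with `k < l`, and undoing `Ω^k` shows that `M` is a stable
summand of a syzygy. So every module in `⊥U` is torsionless. The cokernel of a left approximation
of such a module by projectives is again in `⊥U`, so the approximations can be iterated, and the
exact sequence obtained computes `Ext^i(Tr M, U) = 0`: every module in `⊥U` is Gorenstein
projective.

For the second part, `Hom(-, eA)` is a duality between the modules copresented by `eA` and modules
over `End(eA)`, an algebra isomorphic to `B₂`; second syzygies are copresented by `eA` when the
dominant dimension is at least two.

For radical square zero, torsionless indecomposable nonprojective modules are simple. The simple
nonprojective modules in `⊥A` have a common annihilator which, modulo the radical, is generated by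
an idempotent `f`. Every such simple module is a summand of the syzygy of another one, which forces
`f` to be central. By connectedness `f = 0`, and then `A` is selfinjective, or `f = 1`, and then
there are no such modules.
-/

noncomputable section

namespace NearlyGor

section ShortExact

variable {R : Type u} [Ring R]
variable {K P X N : Type u} [AddCommGroup K] [Module R K] [AddCommGroup P] [Module R P]
  [AddCommGroup X] [Module R X] [AddCommGroup N] [Module R N]

/-- The sequence `0 → K → P → X → 0` of unbundled modules is exact. -/
structure IsShortExact (f : K →ₗ[R] P) (g : P →ₗ[R] X) : Prop where
  injective : Function.Injective f
  exact : Function.Exact f g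
  surjective : Function.Surjective g

/-- Every linear map `K → N` extends along `f : K → P`; for injective `f` this is the relative
injectivity of `N` with respect to `f`. -/
def ExtendsAlong (f : K →ₗ[R] P) (N : Type u) [AddCommGroup N] [Module R N] : Prop :=
  ∀ φ : K →ₗ[R] N, ∃ ψ : P →ₗ[R] N, ψ ∘ₗ f = φ

theorem isShortExact_ker {g : P →ₗ[R] X} (hg : Function.Surjective g) :
    IsShortExact (LinearMap.ker g).subtype g :=
  ⟨Subtype.val_injective, LinearMap.exact_subtype_ker_map g, hg⟩

theorem isShortExact_range {f : K →ₗ[R] P} (hf : Function.Injective f) :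
    IsShortExact f (LinearMap.range f).mkQ :=
  ⟨hf, LinearMap.exact_map_mkQ_range f, Submodule.mkQ_surjective _⟩

theorem exists_lift_of_exact {f : K →ₗ[R] P} {g : P →ₗ[R] X} (hf : Function.Injective f)
    (hfg : Function.Exact f g) (x : N →ₗ[R] P) (hx : g ∘ₗ x = 0) :
    ∃ y : N →ₗ[R] K, f ∘ₗ y = x := by
  have hr : ∀ n, x n ∈ LinearMap.range f := fun n => (hfg _).1 (LinearMap.congr_fun hx n)
  refine ⟨(LinearEquiv.ofInjective f hf).symm.toLinearMap ∘ₗ x.codRestrict _ hr, ?_⟩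
  ext n
  exact congrArg Subtype.val
    ((LinearEquiv.ofInjective f hf).apply_symm_apply (x.codRestrict _ hr n))

theorem exists_desc_of_exact {f : K →ₗ[R] P} {g : P →ₗ[R] X} (hfg : Function.Exact f g)
    (hg : Function.Surjective g) (x : P →ₗ[R] N) (hx : x ∘ₗ f = 0) :
    ∃ y : X →ₗ[R] N, y ∘ₗ g = x := by
  have hk : LinearMap.ker g ≤ LinearMap.ker x := by
    rw [hfg.linearMap_ker_eq]
    exact LinearMap.range_le_ker_iff.2 hx
  refine ⟨(LinearMap.ker g).liftQ x hk ∘ₗ (g.quotKerEquivOfSurjective hg).symm.toLinearMap, ?_⟩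
  ext p
  have : (g.quotKerEquivOfSurjective hg).symm (g p) = Submodule.Quotient.mk p := by
    rw [LinearEquiv.symm_apply_eq]
    rfl
  simp [this]

namespace IsShortExact

variable {f : K →ₗ[R] P} {g : P →ₗ[R] X}

theorem comp_eq_zero (h : IsShortExact f g) : g ∘ₗ f = 0 :=
  h.exact.linearMap_comp_eq_zero

theorem exists_lift (h : IsShortExact f g) (x : N →ₗ[R] P) (hx : g ∘ₗ x = 0) :
    ∃ y : N →ₗ[R] K, f ∘ₗ y = x :=
  exists_lift_of_exact h.injective h.exact x hx

theorem exists_desc (h : IsShortExact f g) (x : P →ₗ[R] N) (hx : x ∘ₗ f = 0) :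
    ∃ y : X →ₗ[R] N, y ∘ₗ g = x :=
  exists_desc_of_exact h.exact h.surjective x hx

theorem shortExact (h : IsShortExact f g) :
    (ShortComplex.mk (ModuleCat.ofHom f) (ModuleCat.ofHom g)
      (ModuleCat.hom_ext h.comp_eq_zero)).ShortExact where
  exact := (ShortComplex.ShortExact.moduleCat_exact_iff_function_exact _).2 h.exact
  mono_f := (ModuleCat.mono_iff_injective _).2 h.injective
  epi_g := (ModuleCat.epi_iff_surjective _).2 h.surjective

end IsShortExact

end ShortExact

section DirectSummand

/-- `M` is isomorphic to a direct summand of `N`. -/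
def IsDirectSummand (R M N : Type u) [Ring R] [AddCommGroup M] [Module R M] [AddCommGroup N]
    [Module R N] : Prop :=
  ∃ (i : M →ₗ[R] N) (p : N →ₗ[R] M), p ∘ₗ i = LinearMap.id

variable {R : Type u} [Ring R]

/-- The class `C` is closed under direct summands. -/
def IsSummandClosed (C : ModuleCat.{u} R → Prop) : Prop :=
  ∀ M N : ModuleCat.{u} R, IsDirectSummand R M N → C N → C M

variable {M N : Type u} [AddCommGroup M] [Module R M] [AddCommGroup N] [Module R N]

theorem IsDirectSummand.of_linearEquiv (e : M ≃ₗ[R] N) : IsDirectSummand R M N :=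
  ⟨e.toLinearMap, e.symm.toLinearMap, e.symm_comp⟩

theorem IsDirectSummand.range {e : Module.End R M} (he : IsIdempotentElem e) :
    IsDirectSummand R (LinearMap.range e) M := by
  refine ⟨(LinearMap.range e).subtype, e.rangeRestrict, ?_⟩
  ext ⟨_, x, rfl⟩
  exact LinearMap.congr_fun he x

theorem injective_of_comp_eq_id {i : M →ₗ[R] N} {p : N →ₗ[R] M} (h : p ∘ₗ i = LinearMap.id) :
    Function.Injective i :=
  Function.LeftInverse.injective (LinearMap.congr_fun h)

theorem surjective_of_comp_eq_id {i : M →ₗ[R] N} {p : N →ₗ[R] M} (h : p ∘ₗ i = LinearMap.id) :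
    Function.Surjective p :=
  Function.RightInverse.surjective (LinearMap.congr_fun h)

theorem IsDirectSummand.finite [Module.Finite R N] (h : IsDirectSummand R M N) :
    Module.Finite R M := by
  obtain ⟨_, p, h⟩ := h
  exact Module.Finite.of_surjective p (surjective_of_comp_eq_id h)

end DirectSummand

section ExtVanishing

variable {R : Type u} [Ring R]

/-- `Ext^i(M, N) = 0`, for unbundled modules. -/
abbrev ExtZero (R : Type u) [Ring R] (M N : Type u) [AddCommGroup M] [Module R M]
    [AddCommGroup N] [Module R N] (i : ℕ) : Prop :=
  Subsingleton (Abelian.Ext (ModuleCat.of R M) (ModuleCat.of R N) i)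

/-- `Ext^i(M, N) = 0` for all `i ≥ 1`, for unbundled modules. -/
abbrev ExtPerp (R : Type u) [Ring R] (M N : Type u) [AddCommGroup M] [Module R M]
    [AddCommGroup N] [Module R N] : Prop :=
  ExtVanishes (ModuleCat.of R M) (ModuleCat.of R N)

variable {K P X U I M M' : Type u} [AddCommGroup K] [Module R K] [AddCommGroup P] [Module R P]
  [AddCommGroup X] [Module R X] [AddCommGroup U] [Module R U] [AddCommGroup I] [Module R I]
  [AddCommGroup M] [Module R M] [AddCommGroup M'] [Module R M']

theorem ExtZero.of_projective [Module.Projective R P] (i : ℕ) : ExtZero R P U (i + 1) :=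
  have := (IsProjective.iff_projective (R := R) P).1 ‹_›
  Abelian.Ext.subsingleton_of_projective _ _ i

theorem ExtZero.of_injective (hI : Module.Injective R I) (i : ℕ) : ExtZero R X I (i + 1) :=
  have := (Module.injective_iff_injective_object R I).1 hI
  Abelian.Ext.subsingleton_of_injective _ _ i

theorem mk₀_comp_eq_mk₀_iff {X Y Z : ModuleCat.{u} R} {f : X ⟶ Y} {g : Y ⟶ Z} {φ : X ⟶ Z} :
    (Abelian.Ext.mk₀ f).comp (Abelian.Ext.mk₀ g) (add_zero 0) = Abelian.Ext.mk₀ φ ↔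
      g.hom ∘ₗ f.hom = φ.hom := by
  rw [Abelian.Ext.mk₀_comp_mk₀, (Abelian.Ext.mk₀_bijective _ _).1.eq_iff, ModuleCat.hom_ext_iff,
    ModuleCat.hom_comp]

namespace IsShortExact

variable {f : K →ₗ[R] P} {g : P →ₗ[R] X}

theorem extendsAlong_iff [Module.Projective R P] (h : IsShortExact f g) :
    ExtendsAlong f U ↔ ExtZero R X U 1 := by
  constructor
  · refine fun hf => subsingleton_of_forall_eq 0 fun a => ?_
    obtain ⟨y, rfl⟩ := Abelian.Ext.contravariant_sequence_exact₃ h.shortExact (ModuleCat.of R U) a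
      ((ExtZero.of_projective 0).elim _ _) (n₀ := 0) rfl
    obtain ⟨φ, rfl⟩ := (Abelian.Ext.mk₀_bijective _ _).2 y
    obtain ⟨ψ, hψ⟩ := hf φ.hom
    rw [← (mk₀_comp_eq_mk₀_iff (f := ModuleCat.ofHom f) (g := ModuleCat.ofHom ψ)).2 hψ]
    exact h.shortExact.extClass_comp_assoc _
  · intro hX φ
    obtain ⟨y, hy⟩ := Abelian.Ext.contravariant_sequence_exact₁ h.shortExact (ModuleCat.of R U)
      (Abelian.Ext.mk₀ (ModuleCat.ofHom φ)) (n₁ := 1) rfl (hX.elim _ _)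
    obtain ⟨ψ, rfl⟩ := (Abelian.Ext.mk₀_bijective _ _).2 y
    exact ⟨ψ.hom, mk₀_comp_eq_mk₀_iff.1 hy⟩

theorem extZero_one_iff_lift (h : IsShortExact f g) (hP : Module.Injective R P) :
    ExtZero R U K 1 ↔ ∀ φ : U →ₗ[R] X, ∃ ψ : U →ₗ[R] P, g ∘ₗ ψ = φ := by
  constructor
  · intro hU φ
    obtain ⟨y, hy⟩ := Abelian.Ext.covariant_sequence_exact₃ (ModuleCat.of R U) h.shortExact
      (Abelian.Ext.mk₀ (ModuleCat.ofHom φ)) (n₁ := 1) rfl (hU.elim _ _)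
    obtain ⟨ψ, rfl⟩ := (Abelian.Ext.mk₀_bijective _ _).2 y
    exact ⟨ψ.hom, mk₀_comp_eq_mk₀_iff.1 hy⟩
  · refine fun hg => subsingleton_of_forall_eq 0 fun a => ?_
    obtain ⟨y, rfl⟩ := Abelian.Ext.covariant_sequence_exact₁ (ModuleCat.of R U) h.shortExact a
      ((ExtZero.of_injective hP 0).elim _ _) (n₀ := 0) rfl
    obtain ⟨φ, rfl⟩ := (Abelian.Ext.mk₀_bijective _ _).2 y
    obtain ⟨ψ, hψ⟩ := hg φ.hom
    rw [← (mk₀_comp_eq_mk₀_iff (f := ModuleCat.ofHom ψ) (g := ModuleCat.ofHom g)).2 hψ,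
      Abelian.Ext.comp_assoc_of_second_deg_zero, h.shortExact.comp_extClass, Abelian.Ext.comp_zero]

theorem extZero_add_two_iff_left [Module.Projective R P] (h : IsShortExact f g) (i : ℕ) :
    ExtZero R X U (i + 2) ↔ ExtZero R K U (i + 1) := by
  constructor <;> refine fun h₀ => subsingleton_of_forall_eq 0 fun a => ?_
  · obtain ⟨y, rfl⟩ := Abelian.Ext.contravariant_sequence_exact₁ h.shortExact (ModuleCat.of R U)
      a (n₁ := i + 2) (by omega) (h₀.elim _ _)
    rw [(ExtZero.of_projective i).elim y 0, Abelian.Ext.comp_zero]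
  · obtain ⟨y, rfl⟩ := Abelian.Ext.contravariant_sequence_exact₃ h.shortExact (ModuleCat.of R U) a
      ((ExtZero.of_projective _).elim _ _) (n₀ := i + 1) (by omega)
    rw [h₀.elim y 0, Abelian.Ext.comp_zero]

theorem extZero_add_two_iff_right (h : IsShortExact f g) (hP : Module.Injective R P) (i : ℕ) :
    ExtZero R U K (i + 2) ↔ ExtZero R U X (i + 1) := by
  constructor <;> refine fun h₀ => subsingleton_of_forall_eq 0 fun a => ?_
  · obtain ⟨y, rfl⟩ := Abelian.Ext.covariant_sequence_exact₃ (ModuleCat.of R U) h.shortExact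
      a (n₁ := i + 2) (by omega) (h₀.elim _ _)
    rw [(ExtZero.of_injective hP i).elim y 0, Abelian.Ext.zero_comp]
  · obtain ⟨y, rfl⟩ := Abelian.Ext.covariant_sequence_exact₁ (ModuleCat.of R U) h.shortExact a
      ((ExtZero.of_injective hP _).elim _ _) (n₀ := i + 1) (by omega)
    rw [h₀.elim y 0, Abelian.Ext.zero_comp]

theorem extZero_middle (h : IsShortExact f g) {i : ℕ} (hK : ExtZero R K U i)
    (hX : ExtZero R X U i) : ExtZero R P U i := by
  refine subsingleton_of_forall_eq 0 fun a => ?_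
  obtain ⟨y, rfl⟩ := Abelian.Ext.contravariant_sequence_exact₂ h.shortExact (ModuleCat.of R U) a
    (hK.elim _ _)
  rw [hX.elim y 0, Abelian.Ext.comp_zero]

end IsShortExact

theorem extPerp_iff : ExtPerp R M U ↔ ∀ i, ExtZero R M U (i + 1) :=
  ⟨fun h i => h (i + 1) (by omega), fun h i hi => by
    obtain ⟨j, rfl⟩ := Nat.exists_eq_add_of_le' hi
    exact h j⟩

theorem ExtPerp.of_projective [Module.Projective R P] : ExtPerp R P U :=
  extPerp_iff.2 ExtZero.of_projective

theorem ExtPerp.of_isDirectSummand (hM : IsDirectSummand R M M') (h : ExtPerp R M' U) :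
    ExtPerp R M U := by
  obtain ⟨i, p, hpi⟩ := hM
  refine fun n hn => subsingleton_of_forall_eq 0 fun x => ?_
  have hid : ModuleCat.ofHom i ≫ ModuleCat.ofHom p = 𝟙 (ModuleCat.of R M) :=
    ModuleCat.hom_ext hpi
  rw [← Abelian.Ext.mk₀_id_comp x, ← hid, ← Abelian.Ext.mk₀_comp_mk₀,
    Abelian.Ext.comp_assoc_of_second_deg_zero,
    (h n hn).elim ((Abelian.Ext.mk₀ (ModuleCat.ofHom p)).comp x (zero_add n)) 0,
    Abelian.Ext.comp_zero]

theorem IsShortExact.extPerp_iff [Module.Projective R P] {f : K →ₗ[R] P} {g : P →ₗ[R] X}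
    (h : IsShortExact f g) : ExtPerp R X U ↔ ExtendsAlong f U ∧ ExtPerp R K U := by
  rw [NearlyGor.extPerp_iff, NearlyGor.extPerp_iff, h.extendsAlong_iff]
  constructor
  · exact fun hX => ⟨hX 0, fun i => (h.extZero_add_two_iff_left i).1 (hX (i + 1))⟩
  · rintro ⟨h₁, h₂⟩ (_ | i)
    · exact h₁
    · exact (h.extZero_add_two_iff_left i).2 (h₂ i)

theorem extPerp_of_coinduction (C : ModuleCat.{u} R → Prop)
    (step : ∀ N, C N → ∃ (L Q : ModuleCat.{u} R) (f : L →ₗ[R] Q) (g : Q →ₗ[R] N),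
      Module.Projective R Q ∧ IsShortExact f g ∧ ExtendsAlong f U ∧ C L)
    {N : ModuleCat.{u} R} (hN : C N) : ExtPerp R N U := by
  rw [extPerp_iff]
  intro i
  induction i generalizing N with
  | zero =>
    obtain ⟨L, Q, f, g, _, hfg, hf, -⟩ := step N hN
    exact hfg.extendsAlong_iff.1 hf
  | succ i ih =>
    obtain ⟨L, Q, f, g, _, hfg, -, hL⟩ := step N hN
    exact (hfg.extZero_add_two_iff_left i).2 (ih hL)

end ExtVanishing

section Indecomposable

/-- A nonzero module whose only idempotent endomorphisms are `0` and `1`. -/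
def IsIndecomposable (R M : Type u) [Ring R] [AddCommGroup M] [Module R M] : Prop :=
  Nontrivial M ∧ ∀ e : Module.End R M, IsIdempotentElem e → e = 0 ∨ e = 1

variable {R : Type u} [Ring R] {M : Type u} [AddCommGroup M] [Module R M]

theorem eq_zero_or_eq_one_of_indecomposable {X : ModuleCat.{u} R} (hX : Indecomposable X)
    {e : Module.End R X} (he : IsIdempotentElem e) : e = 0 ∨ e = 1 := by
  have hc := LinearMap.IsIdempotentElem.isCompl he
  let φ : X ≅ ModuleCat.of R (LinearMap.range e) ⊞ ModuleCat.of R (LinearMap.ker e) :=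
    (Submodule.prodEquivOfIsCompl _ _ hc).symm.toModuleIso ≪≫
      (ModuleCat.biprodIsoProd (ModuleCat.of R (LinearMap.range e))
        (ModuleCat.of R (LinearMap.ker e))).symm
  rcases hX.2 _ _ φ with h | h <;>
    have h := Submodule.subsingleton_iff_eq_bot.1 (ModuleCat.isZero_iff_subsingleton.1 h)
  · exact Or.inl (LinearMap.range_eq_bot.1 h)
  · refine Or.inr (LinearMap.ext fun x => LinearMap.ker_eq_bot.1 h ?_)
    exact LinearMap.congr_fun he x

theorem indecomposable_iff (X : ModuleCat.{u} R) : Indecomposable X ↔ IsIndecomposable R X := by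
  have hzero : ¬ Limits.IsZero X ↔ Nontrivial X := by
    rw [ModuleCat.isZero_iff_subsingleton, not_subsingleton_iff_nontrivial]
  refine ⟨fun h => ⟨hzero.1 h.1, fun e => eq_zero_or_eq_one_of_indecomposable h⟩, fun h =>
    ⟨hzero.2 h.1, fun Y Z φ => ?_⟩⟩
  let ε : Y ⊞ Z ⟶ Y ⊞ Z := Limits.biprod.fst ≫ Limits.biprod.inl
  have hconj : φ.inv ≫ (φ.hom ≫ ε ≫ φ.inv) ≫ φ.hom = ε := by simp
  have hidem : (φ.hom ≫ ε ≫ φ.inv) ≫ φ.hom ≫ ε ≫ φ.inv = φ.hom ≫ ε ≫ φ.inv := by simp [ε]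
  rcases h.2 (φ.hom ≫ ε ≫ φ.inv).hom (congrArg ModuleCat.Hom.hom hidem) with h₀ | h₁
  · have hε : ε = 0 := by
      rw [← hconj, ModuleCat.hom_ext (g := 0) h₀, Limits.zero_comp, Limits.comp_zero]
    left
    rw [Limits.IsZero.iff_id_eq_zero]
    simpa [ε] using Limits.biprod.inl ≫= hε =≫ Limits.biprod.fst
  · have hε : ε = 𝟙 _ := by
      rw [← hconj, ModuleCat.hom_ext (g := 𝟙 X) h₁, Category.id_comp, φ.inv_hom_id]
    right
    rw [Limits.IsZero.iff_id_eq_zero]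
    simpa [ε] using (Limits.biprod.inr ≫= hε =≫ Limits.biprod.snd).symm

theorem IsIndecomposable.isNilpotent_or_bijective [IsArtinian R M] [IsNoetherian R M]
    (h : IsIndecomposable R M) (f : Module.End R M) : IsNilpotent f ∨ Function.Bijective f := by
  obtain ⟨n, hn⟩ := Filter.eventually_atTop.1 f.eventually_isCompl_ker_pow_range_pow
  have hc := hn (n + 1) (by omega)
  rcases h.2 _ (Submodule.isIdempotentElem_projection hc) with h₀ | h₁
  · right
    have hker : LinearMap.ker (f ^ (n + 1)) = ⊥ := by
      rw [← Submodule.range_projection hc, h₀, LinearMap.range_zero]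
    have hinj : Function.Injective f := by
      rw [← LinearMap.ker_eq_bot, eq_bot_iff, ← hker, pow_succ]
      exact LinearMap.ker_le_ker_comp f (f ^ n)
    exact ⟨hinj, IsArtinian.surjective_of_injective_endomorphism f hinj⟩
  · left
    refine ⟨n + 1, LinearMap.ker_eq_top.1 ?_⟩
    rw [← Submodule.range_projection hc, h₁]
    exact LinearMap.range_id

theorem isIndecomposable_range {e : Module.End R M} (he : IsIdempotentElem e) (he0 : e ≠ 0)
    (hmin : ∀ e₁ : Module.End R M, IsIdempotentElem e₁ → e * e₁ = e₁ → e₁ * e = e₁ →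
      e₁ = 0 ∨ e₁ = e) : IsIndecomposable R (LinearMap.range e) := by
  have hfix : ∀ z : LinearMap.range e, e z = z := by
    rintro ⟨_, x, rfl⟩
    exact LinearMap.congr_fun he x
  have hrestrict : ∀ z : LinearMap.range e, e.rangeRestrict z = z := fun z => Subtype.ext (hfix z)
  refine ⟨Submodule.nontrivial_iff_ne_bot.2 (mt LinearMap.range_eq_bot.1 he0), fun f hf => ?_⟩
  let e₁ : Module.End R M := (LinearMap.range e).subtype ∘ₗ f ∘ₗ e.rangeRestrict
  have happly : ∀ z : LinearMap.range e, e₁ z = f z := fun z =>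
    congrArg (fun y => (f y : M)) (hrestrict z)
  have hidem : IsIdempotentElem e₁ := LinearMap.ext fun x =>
    (happly _).trans (congrArg Subtype.val (LinearMap.congr_fun hf _))
  have hleft : e * e₁ = e₁ := LinearMap.ext fun x => hfix _
  have hright : e₁ * e = e₁ := LinearMap.ext fun x =>
    congrArg (fun y => (f y : M)) (hrestrict (e.rangeRestrict x))
  refine (hmin e₁ hidem hleft hright).imp (fun h => ?_) (fun h => ?_) <;> ext z
  · rw [← happly, h]
    rfl
  · rw [← happly, h]
    exact hfix z

theorem exists_minimal_idempotent [IsArtinian R M] {p : Module.End R M → Prop} (h1 : p 1) :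
    ∃ e, IsIdempotentElem e ∧ p e ∧
      ∀ e₁, IsIdempotentElem e₁ → e * e₁ = e₁ → e₁ * e = e₁ → p e₁ → e₁ = e := by
  obtain ⟨e, ⟨he, hpe⟩, hmin⟩ := (InvImage.wf LinearMap.range (IsWellFounded.wf :
    WellFounded ((· < ·) : Submodule R M → Submodule R M → Prop))).has_min
      {e : Module.End R M | IsIdempotentElem e ∧ p e} ⟨1, IsIdempotentElem.one, h1⟩
  refine ⟨e, he, hpe, fun e₁ he₁ hleft hright hp => ?_⟩
  have hle : LinearMap.range e₁ ≤ LinearMap.range e :=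
    (LinearMap.IsIdempotentElem.comp_eq_right_iff he e₁).1 hleft
  have hge : LinearMap.range e ≤ LinearMap.range e₁ :=
    (hle.eq_of_not_lt (hmin e₁ ⟨he₁, hp⟩)).ge
  exact hright.symm.trans ((LinearMap.IsIdempotentElem.comp_eq_right_iff he₁ e).2 hge)

theorem exists_isIndecomposable_range [IsArtinian R M] {p : Module.End R M → Prop} (h0 : ¬ p 0)
    (h1 : p 1) (hsplit : ∀ e e₁, p e → IsIdempotentElem e₁ → p e₁ ∨ p (e - e₁)) :
    ∃ e, IsIdempotentElem e ∧ p e ∧ IsIndecomposable R (LinearMap.range e) := by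
  obtain ⟨e, he, hpe, hmin⟩ := exists_minimal_idempotent h1
  refine ⟨e, he, hpe, isIndecomposable_range he (fun h => h0 (h ▸ hpe))
    fun e₁ he₁ hleft hright => ?_⟩
  rcases hsplit e e₁ hpe he₁ with hp | hp
  · exact Or.inr (hmin e₁ he₁ hleft hright hp)
  · refine Or.inl (sub_eq_self.1 (hmin (e - e₁) ?_ ?_ ?_ hp))
    · rw [IsIdempotentElem, sub_mul, mul_sub, mul_sub, he.eq, hleft, hright, he₁.eq, sub_self,
        sub_zero]
    · rw [mul_sub, he.eq, hleft]
    · rw [sub_mul, he.eq, hright]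

end Indecomposable

section Stable

variable {R : Type u} [Ring R]
variable {M N L : Type u} [AddCommGroup M] [Module R M] [AddCommGroup N] [Module R N]
  [AddCommGroup L] [Module R L]

/-- The linear maps that factor through a finitely generated projective module; they are the
morphisms that vanish in the stable category. -/
def projectiveMaps (R M N : Type u) [Ring R] [AddCommGroup M] [Module R M] [AddCommGroup N]
    [Module R N] : AddSubgroup (M →ₗ[R] N) where
  carrier := {f | ∃ (P : ModuleCat.{u} R) (a : M →ₗ[R] P) (b : P →ₗ[R] N),
    Module.Finite R P ∧ Module.Projective R P ∧ b ∘ₗ a = f}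
  zero_mem' := ⟨ModuleCat.of R PUnit, 0, 0, inferInstance, inferInstance, LinearMap.comp_zero _⟩
  add_mem' := by
    rintro _ _ ⟨P, a, b, _, _, rfl⟩ ⟨Q, c, d, _, _, rfl⟩
    exact ⟨ModuleCat.of R (P × Q), a.prod c, b.coprod d,
      inferInstanceAs (Module.Finite R (P × Q)), inferInstanceAs (Module.Projective R (P × Q)),
      rfl⟩
  neg_mem' := by
    rintro _ ⟨P, a, b, hP, hP', rfl⟩
    exact ⟨P, a, -b, hP, hP', LinearMap.neg_comp _ _⟩

theorem comp_mem_projectiveMaps_right {f : M →ₗ[R] N} (hf : f ∈ projectiveMaps R M N)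
    (g : N →ₗ[R] L) : g ∘ₗ f ∈ projectiveMaps R M L := by
  obtain ⟨P, a, b, h1, h2, rfl⟩ := hf
  exact ⟨P, a, g ∘ₗ b, h1, h2, rfl⟩

theorem comp_mem_projectiveMaps_left {f : M →ₗ[R] N} (hf : f ∈ projectiveMaps R M N)
    (g : L →ₗ[R] M) : f ∘ₗ g ∈ projectiveMaps R L N := by
  obtain ⟨P, a, b, h1, h2, rfl⟩ := hf
  exact ⟨P, a ∘ₗ g, b, h1, h2, rfl⟩

theorem mem_projectiveMaps_of_projective [hf : Module.Finite R N] [hp : Module.Projective R N]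
    (f : M →ₗ[R] N) : f ∈ projectiveMaps R M N :=
  ⟨ModuleCat.of R N, f, LinearMap.id, hf, hp, f.id_comp⟩

theorem exists_lift_of_mem_projectiveMaps {f : M →ₗ[R] N} (hf : f ∈ projectiveMaps R M N)
    {g : L →ₗ[R] N} (hg : Function.Surjective g) : ∃ h : M →ₗ[R] L, g ∘ₗ h = f := by
  obtain ⟨P, a, b, _, _, rfl⟩ := hf
  obtain ⟨c, rfl⟩ := Module.projective_lifting_property g b hg
  exact ⟨c ∘ₗ a, rfl⟩

theorem id_mem_projectiveMaps_iff : LinearMap.id ∈ projectiveMaps R M M ↔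
    Module.Finite R M ∧ Module.Projective R M := by
  constructor
  · rintro ⟨P, a, b, _, _, h⟩
    exact ⟨IsDirectSummand.finite (N := P) ⟨a, b, h⟩, Module.Projective.of_split a b h⟩
  · rintro ⟨_, _⟩
    exact mem_projectiveMaps_of_projective _

/-- `M` is a direct summand of `N` in the stable category. -/
def IsStableSummand (R M N : Type u) [Ring R] [AddCommGroup M] [Module R M] [AddCommGroup N]
    [Module R N] : Prop :=
  ∃ (f : M →ₗ[R] N) (g : N →ₗ[R] M), g ∘ₗ f - LinearMap.id ∈ projectiveMaps R M M

theorem IsDirectSummand.isStableSummand (h : IsDirectSummand R M N) : IsStableSummand R M N := by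
  obtain ⟨i, p, h⟩ := h
  exact ⟨i, p, by simp [h]⟩

theorem IsStableSummand.trans (h₁ : IsStableSummand R M N) (h₂ : IsStableSummand R N L) :
    IsStableSummand R M L := by
  obtain ⟨f, g, h⟩ := h₁
  obtain ⟨f', g', h'⟩ := h₂
  refine ⟨f' ∘ₗ f, g ∘ₗ g', ?_⟩
  have : (g ∘ₗ g') ∘ₗ (f' ∘ₗ f) - LinearMap.id =
      g ∘ₗ (g' ∘ₗ f' - LinearMap.id) ∘ₗ f + (g ∘ₗ f - LinearMap.id) := by
    ext x
    simp
  rw [this]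
  exact add_mem (comp_mem_projectiveMaps_right (comp_mem_projectiveMaps_left h' f) g) h

theorem IsStableSummand.projective [Module.Finite R N] [Module.Projective R N]
    (h : IsStableSummand R M N) : Module.Projective R M := by
  obtain ⟨f, g, h⟩ := h
  have hgf : g ∘ₗ f ∈ projectiveMaps R M M :=
    comp_mem_projectiveMaps_right (mem_projectiveMaps_of_projective f) g
  exact (id_mem_projectiveMaps_iff.1 (by simpa using sub_mem hgf h)).2

/-- The endomorphism ring of `M` in the stable category has no idempotents but `0` and `1`. -/
def IsStablyIndecomposable (R M : Type u) [Ring R] [AddCommGroup M] [Module R M] : Prop :=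
  ∀ e : Module.End R M, e * e - e ∈ projectiveMaps R M M →
    e ∈ projectiveMaps R M M ∨ e - 1 ∈ projectiveMaps R M M

theorem IsIndecomposable.isStablyIndecomposable [IsArtinian R M] [IsNoetherian R M]
    (h : IsIndecomposable R M) : IsStablyIndecomposable R M := by
  intro e he
  rcases h.isNilpotent_or_bijective e with ⟨n, hn⟩ | hb
  · left
    have hpow : ∀ k : ℕ, e ^ (k + 1) - e ∈ projectiveMaps R M M := by
      intro k
      induction k with
      | zero => simp
      | succ k ih =>
        have : e ^ (k + 1 + 1) - e = (e ^ (k + 1) - e) * e + (e * e - e) := by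
          rw [sub_mul, ← pow_succ, sub_add_sub_cancel]
        rw [this]
        exact add_mem (comp_mem_projectiveMaps_left ih e) he
    simpa [pow_succ, hn] using hpow n
  · right
    let E := LinearEquiv.ofBijective e hb
    have : e - 1 = E.symm.toLinearMap ∘ₗ (e * e - e) := by
      ext x
      exact E.injective (by simp [E])
    rw [this]
    exact comp_mem_projectiveMaps_right he _

theorem IsStablyIndecomposable.exists_isIndecomposable_range [IsArtinian R M]
    (h : IsStablyIndecomposable R M) (hM : LinearMap.id ∉ projectiveMaps R M M) :
    ∃ e : Module.End R M, IsIdempotentElem e ∧ e - 1 ∈ projectiveMaps R M M ∧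
      IsIndecomposable R (LinearMap.range e) := by
  refine NearlyGor.exists_isIndecomposable_range (fun h0 => hM ?_) (by simp)
    fun e e₁ hp he₁ => ?_
  · have hid : (1 : Module.End R M) ∈ projectiveMaps R M M := by simpa using neg_mem h0
    exact hid
  · refine (h e₁ (by simp [he₁.eq])).symm.imp_right fun h₁ => ?_
    simpa only [sub_right_comm] using sub_mem hp h₁

/-- Only finitely many indecomposable nonprojective modules belong to the class `C`. -/
def HasFinitelyManyNonprojective (C : ModuleCat.{u} R → Prop) : Prop :=
  IsRepFiniteClass fun M => C M ∧ ¬ Module.Projective R M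

theorem IsRepFiniteClass.mono {C C' : ModuleCat.{u} R → Prop} (h : IsRepFiniteClass C)
    (hC : ∀ M, C' M → C M) : IsRepFiniteClass C' := by
  obtain ⟨n, X, hX⟩ := h
  exact ⟨n, X, fun M hM => hX M (hC M hM)⟩

theorem IsStablyIndecomposable.exists_stable_iso [IsArtinianRing R] {Y : ModuleCat.{u} R}
    [Module.Finite R Y] (h : IsStablyIndecomposable R Y) (hY : ¬ Module.Projective R Y) :
    ∃ Z : ModuleCat.{u} R, ¬ Module.Projective R Z ∧ IsIndecomposable R Z ∧
      IsDirectSummand R Z Y ∧ IsStableSummand R Y Z := by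
  obtain ⟨e, he, hstable, hind⟩ := h.exists_isIndecomposable_range
    fun hid => hY (id_mem_projectiveMaps_iff.1 hid).2
  have hsummand := IsDirectSummand.range he
  have hstab : IsStableSummand R Y (LinearMap.range e) :=
    ⟨e.rangeRestrict, (LinearMap.range e).subtype, hstable⟩
  refine ⟨ModuleCat.of R (LinearMap.range e), fun hP => hY ?_, hind, hsummand, hstab⟩
  have : Module.Projective R (LinearMap.range e) := hP
  have := hsummand.finite
  exact hstab.projective

theorem exists_lt_isStableSummand {C : ModuleCat.{u} R → Prop} (hC : IsSummandClosed C)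
    (hfin : HasFinitelyManyNonprojective C) [IsArtinianRing R] {Y : ℕ → ModuleCat.{u} R}
    (hfg : ∀ k, Module.Finite R (Y k)) (hind : ∀ k, IsStablyIndecomposable R (Y k))
    (hproj : ∀ k, ¬ Module.Projective R (Y k)) (hY : ∀ k, C (Y k)) :
    ∃ k l, k < l ∧ IsStableSummand R (Y k) (Y l) := by
  choose Z hZproj hZind hZY hYZ using fun k =>
    have := hfg k
    (hind k).exists_stable_iso (hproj k)
  obtain ⟨n, X, hX⟩ := hfin
  choose i hi using fun k => hX (Z k) ⟨hC _ _ (hZY k) (hY k), hZproj k⟩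
    ((indecomposable_iff _).2 (hZind k))
  have hsame : ∀ {k l}, i k = i l → IsStableSummand R (Y k) (Y l) := by
    intro k l hkl
    obtain ⟨a⟩ := hi k
    obtain ⟨b⟩ := hkl ▸ hi l
    have hZ := (IsDirectSummand.of_linearEquiv (a ≪≫ b.symm).toLinearEquiv).isStableSummand
    exact (hYZ k).trans (hZ.trans (hZY l).isStableSummand)
  obtain ⟨k, l, hne, hkl⟩ := Finite.exists_ne_map_eq_of_infinite i
  rcases lt_or_gt_of_ne hne with h | h
  · exact ⟨k, l, h, hsame hkl⟩
  · exact ⟨l, k, h, hsame hkl.symm⟩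

end Stable

section Syzygies

variable {R : Type u} [Ring R]
variable {K P M K' P' M' : Type u} [AddCommGroup K] [Module R K] [AddCommGroup P] [Module R P]
  [AddCommGroup K'] [Module R K'] [AddCommGroup P'] [Module R P'] [AddCommGroup M'] [Module R M']
  [AddCommGroup M] [Module R M]

/-- Every linear map from `K` to a finitely generated projective module extends along
`f : K → P`. It makes passing to cokernels functorial modulo projectives. -/
def ExtendsAlongProjectives (f : K →ₗ[R] P) : Prop :=
  ∀ (Q : Type u) [AddCommGroup Q] [Module R Q] [Module.Finite R Q] [Module.Projective R Q],
    ExtendsAlong f Q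

variable {f : K →ₗ[R] P} {g : P →ₗ[R] M} {f' : K' →ₗ[R] P'} {g' : P' →ₗ[R] M'}
  {φ : K →ₗ[R] K'} {Φ : P →ₗ[R] P'} {χ : M →ₗ[R] M'}

theorem cokernel_mem_projectiveMaps (h : IsShortExact f g) (hf : ExtendsAlongProjectives f)
    [Module.Finite R P'] [Module.Projective R P'] (hleft : f' ∘ₗ φ = Φ ∘ₗ f)
    (hright : g' ∘ₗ Φ = χ ∘ₗ g) (h' : g' ∘ₗ f' = 0) (hφ : φ ∈ projectiveMaps R K K') :
    χ ∈ projectiveMaps R M M' := by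
  obtain ⟨Q, a, b, _, _, rfl⟩ := hφ
  obtain ⟨α, rfl⟩ := hf Q a
  obtain ⟨c, hc⟩ := h.exists_desc (Φ - f' ∘ₗ b ∘ₗ α) (by
    rw [LinearMap.sub_comp, ← hleft]
    exact sub_self _)
  have hχ : g' ∘ₗ c = χ := by
    rw [← LinearMap.cancel_right h.surjective, LinearMap.comp_assoc, hc, LinearMap.comp_sub,
      ← LinearMap.comp_assoc _ f', h', LinearMap.zero_comp, sub_zero, hright]
  exact hχ ▸ comp_mem_projectiveMaps_right (mem_projectiveMaps_of_projective c) g'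

theorem syzygy_mem_projectiveMaps [Module.Finite R P] [Module.Projective R P]
    (h' : IsShortExact f' g') (hleft : f' ∘ₗ φ = Φ ∘ₗ f) (hright : g' ∘ₗ Φ = χ ∘ₗ g)
    (h : g ∘ₗ f = 0) (hχ : χ ∈ projectiveMaps R M M') : φ ∈ projectiveMaps R K K' := by
  obtain ⟨s, rfl⟩ := exists_lift_of_mem_projectiveMaps hχ h'.surjective
  obtain ⟨θ, hθ⟩ := h'.exists_lift (Φ - s ∘ₗ g) (by
    rw [LinearMap.comp_sub, hright]
    exact sub_self _)
  have hφ : θ ∘ₗ f = φ := by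
    rw [← LinearMap.cancel_left h'.injective, ← LinearMap.comp_assoc, hθ, LinearMap.sub_comp,
      LinearMap.comp_assoc, h, LinearMap.comp_zero, sub_zero, hleft]
  exact hφ ▸ comp_mem_projectiveMaps_right (mem_projectiveMaps_of_projective f) θ

theorem exists_cokernel_map (h : IsShortExact f g) (hf : ExtendsAlongProjectives f)
    (h' : g' ∘ₗ f' = 0) [Module.Finite R P'] [Module.Projective R P'] (φ : K →ₗ[R] K') :
    ∃ (Φ : P →ₗ[R] P') (χ : M →ₗ[R] M'), f' ∘ₗ φ = Φ ∘ₗ f ∧ g' ∘ₗ Φ = χ ∘ₗ g := by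
  obtain ⟨Φ, hΦ⟩ := hf P' (f' ∘ₗ φ)
  obtain ⟨χ, hχ⟩ := h.exists_desc (g' ∘ₗ Φ) (by
    rw [LinearMap.comp_assoc, hΦ, ← LinearMap.comp_assoc, h', LinearMap.zero_comp])
  exact ⟨Φ, χ, hΦ.symm, hχ.symm⟩

theorem IsStableSummand.cokernel [Module.Finite R P] [Module.Projective R P] [Module.Finite R P']
    [Module.Projective R P'] (h : IsShortExact f g) (h' : IsShortExact f' g')
    (hf : ExtendsAlongProjectives f) (hf' : ExtendsAlongProjectives f')
    (hK : IsStableSummand R K K') : IsStableSummand R M M' := by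
  obtain ⟨i, p, hpi⟩ := hK
  obtain ⟨I, ι, hI, hι⟩ := exists_cokernel_map h hf h'.comp_eq_zero i
  obtain ⟨Q, π, hQ, hπ⟩ := exists_cokernel_map h' hf' h.comp_eq_zero p
  refine ⟨ι, π, cokernel_mem_projectiveMaps (Φ := Q ∘ₗ I - LinearMap.id) h hf ?_ ?_
    h.comp_eq_zero hpi⟩
  · rw [LinearMap.comp_sub, LinearMap.sub_comp, ← LinearMap.comp_assoc, hQ, LinearMap.comp_assoc,
      hI]
    rfl
  · rw [LinearMap.comp_sub, LinearMap.sub_comp, ← LinearMap.comp_assoc, hπ, LinearMap.comp_assoc,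
      hι]
    rfl

theorem IsStableSummand.syzygy [Module.Finite R P] [Module.Projective R P]
    [Module.Projective R P'] (h : IsShortExact f g) (h' : IsShortExact f' g')
    (hM : IsStableSummand R M M') : IsStableSummand R K K' := by
  obtain ⟨ι, π, hπι⟩ := hM
  obtain ⟨I, hI⟩ := Module.projective_lifting_property g' (ι ∘ₗ g) h'.surjective
  obtain ⟨Q, hQ⟩ := Module.projective_lifting_property g (π ∘ₗ g') h.surjective
  obtain ⟨i, hi⟩ := h'.exists_lift (I ∘ₗ f) (by
    rw [← LinearMap.comp_assoc, hI, LinearMap.comp_assoc, h.comp_eq_zero, LinearMap.comp_zero])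
  obtain ⟨p, hp⟩ := h.exists_lift (Q ∘ₗ f') (by
    rw [← LinearMap.comp_assoc, hQ, LinearMap.comp_assoc, h'.comp_eq_zero, LinearMap.comp_zero])
  refine ⟨i, p, syzygy_mem_projectiveMaps (Φ := Q ∘ₗ I - LinearMap.id) h ?_ ?_ h.comp_eq_zero hπι⟩
  · rw [LinearMap.comp_sub, LinearMap.sub_comp, ← LinearMap.comp_assoc, hp, LinearMap.comp_assoc,
      hi]
    rfl
  · rw [LinearMap.comp_sub, LinearMap.sub_comp, ← LinearMap.comp_assoc, hQ, LinearMap.comp_assoc,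
      hI]
    rfl

theorem IsStablyIndecomposable.syzygy [Module.Finite R P] [Module.Projective R P]
    (h : IsShortExact f g) (hf : ExtendsAlongProjectives f) (hM : IsStablyIndecomposable R M) :
    IsStablyIndecomposable R K := by
  intro e he
  obtain ⟨E, ε, hE, hε⟩ := exists_cokernel_map h hf h.comp_eq_zero e
  have hleft : f ∘ₗ (e * e - e) = (E * E - E) ∘ₗ f := by
    rw [LinearMap.comp_sub, LinearMap.sub_comp, Module.End.mul_eq_comp, ← LinearMap.comp_assoc,
      hE, LinearMap.comp_assoc, hE]
    rfl
  have hright : g ∘ₗ (E * E - E) = (ε * ε - ε) ∘ₗ g := by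
    rw [LinearMap.comp_sub, LinearMap.sub_comp, Module.End.mul_eq_comp, ← LinearMap.comp_assoc,
      hε, LinearMap.comp_assoc, hε]
    rfl
  rcases hM ε (cokernel_mem_projectiveMaps h hf hleft hright h.comp_eq_zero he) with h₀ | h₁
  · exact Or.inl (syzygy_mem_projectiveMaps h hE hε h.comp_eq_zero h₀)
  · refine Or.inr (syzygy_mem_projectiveMaps (Φ := E - 1) h ?_ ?_ h.comp_eq_zero h₁)
    · rw [LinearMap.comp_sub, LinearMap.sub_comp, hE]
      rfl
    · rw [LinearMap.comp_sub, LinearMap.sub_comp, hε]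
      rfl

theorem projective_of_projective_syzygy [Module.Finite R P] [Module.Projective R P]
    [Module.Finite R K] [Module.Projective R K] (h : IsShortExact f g)
    (hf : ExtendsAlongProjectives f) : Module.Projective R M :=
  (id_mem_projectiveMaps_iff.1 (cokernel_mem_projectiveMaps (φ := LinearMap.id)
    (Φ := LinearMap.id) h hf rfl rfl h.comp_eq_zero (mem_projectiveMaps_of_projective _))).2

/-- `N` is a syzygy of `M` with respect to a finitely generated projective module. -/
def IsSyzygyOf (N M : ModuleCat.{u} R) : Prop :=
  ∃ (P : ModuleCat.{u} R) (f : N →ₗ[R] P) (g : P →ₗ[R] M),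
    Module.Finite R P ∧ Module.Projective R P ∧ IsShortExact f g

/-- `M` is the kernel of a map between finitely generated projective modules. -/
def IsSecondSyzygy (M : ModuleCat.{u} R) : Prop :=
  ∃ (P Q : ModuleCat.{u} R) (f : M →ₗ[R] P) (g : P →ₗ[R] Q), Module.Finite R P ∧
    Module.Projective R P ∧ Module.Finite R Q ∧ Module.Projective R Q ∧
      Function.Injective f ∧ Function.Exact f g

theorem exists_isSyzygyOf [IsNoetherianRing R] (M : ModuleCat.{u} R) [Module.Finite R M] :
    ∃ N : ModuleCat.{u} R, Module.Finite R N ∧ IsSyzygyOf N M := by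
  obtain ⟨n, g, hg⟩ := Module.Finite.exists_fin' R M
  exact ⟨ModuleCat.of R (LinearMap.ker g), inferInstanceAs (Module.Finite R (LinearMap.ker g)),
    ModuleCat.of R (Fin n → R), _, g, inferInstanceAs (Module.Finite R (Fin n → R)),
    inferInstanceAs (Module.Projective R (Fin n → R)), isShortExact_ker hg⟩

theorem exists_resolution [IsNoetherianRing R] (M : ModuleCat.{u} R) [hM : Module.Finite R M] :
    ∃ Y : ℕ → ModuleCat.{u} R, Y 0 = M ∧ (∀ k, Module.Finite R (Y k)) ∧
      ∀ k, IsSyzygyOf (Y (k + 1)) (Y k) := by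
  choose Ω hΩfin hΩ using fun M : {M : ModuleCat.{u} R // Module.Finite R M} =>
    have := M.2
    exists_isSyzygyOf M.1
  let Y : ℕ → {M : ModuleCat.{u} R // Module.Finite R M} :=
    fun n => Nat.rec ⟨M, hM⟩ (fun _ X => ⟨Ω X, hΩfin X⟩) n
  exact ⟨fun n => (Y n).1, rfl, fun n => (Y n).2, fun n => hΩ (Y n)⟩

theorem IsSyzygyOf.isSecondSyzygy {X Y Z : ModuleCat.{u} R} (h : IsSyzygyOf X Y)
    (h' : IsSyzygyOf Y Z) : IsSecondSyzygy X := by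
  obtain ⟨P, f, g, hP, hP', hfg⟩ := h
  obtain ⟨Q, f', g', hQ, hQ', hfg'⟩ := h'
  refine ⟨P, Q, f, f' ∘ₗ g, hP, hP', hQ, hQ', hfg.injective, ?_⟩
  rw [LinearMap.exact_iff, LinearMap.ker_comp_of_ker_eq_bot _
    (LinearMap.ker_eq_bot.2 hfg'.injective), hfg.exact.linearMap_ker_eq]

theorem IsSecondSyzygy.of_linearEquiv {M N : ModuleCat.{u} R} (h : IsSecondSyzygy N)
    (e : M ≃ₗ[R] N) : IsSecondSyzygy M := by
  obtain ⟨P, Q, f, g, hP, hP', hQ, hQ', hf, hfg⟩ := h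
  refine ⟨P, Q, f ∘ₗ e.toLinearMap, g, hP, hP', hQ, hQ', hf.comp e.injective, ?_⟩
  rw [LinearMap.exact_iff, LinearMap.range_comp_of_range_eq_top _ e.range, hfg.linearMap_ker_eq]

end Syzygies

section Dual

variable {R S U : Type u} [Ring R] [Ring S] [AddCommGroup U] [Module R U] [Module S U]

/-- The bimodule `U` is free of rank one on both sides with the common generator `u`, like the
regular bimodule. Working with such a `U` makes the dualities symmetric in the two sides. -/
structure IsRegularGenerator (R S : Type u) {U : Type u} [Ring R] [Ring S] [AddCommGroup U]
    [Module R U] [Module S U] (u : U) : Prop where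
  left : Function.Bijective fun r : R => r • u
  right : Function.Bijective fun s : S => s • u

variable {K P M N : Type u} [AddCommGroup K] [Module R K] [AddCommGroup P] [Module R P]
  [AddCommGroup M] [Module R M] [AddCommGroup N] [Module R N]

/-- The elements of `M` are separated by the linear maps to `U`; for a regular bimodule `U` and
finitely generated `M` this means that `M` embeds into a free module. -/
def Torsionless (R U : Type u) [Ring R] [AddCommGroup U] [Module R U] (M : Type u)
    [AddCommGroup M] [Module R M] : Prop :=
  ∀ m : M, (∀ φ : M →ₗ[R] U, φ m = 0) → m = 0

theorem Torsionless.of_injective {f : M →ₗ[R] N} (hf : Function.Injective f)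
    (h : Torsionless R U N) : Torsionless R U M := fun _ hm =>
  (map_eq_zero_iff f hf).1 (h _ fun φ => hm (φ ∘ₗ f))

theorem Torsionless.of_projective [FaithfulSMul R U] [Module.Projective R P] :
    Torsionless R U P := by
  intro p hp
  obtain ⟨s, hs⟩ := Module.projective_def'.1 (inferInstance : Module.Projective R P)
  have hsp : s p = 0 := Finsupp.ext fun x => FaithfulSMul.eq_of_smul_eq_smul fun y : U => by
    simpa using hp (LinearMap.toSpanSingleton R U y ∘ₗ Finsupp.lapply x ∘ₗ s)
  simpa [hsp] using (LinearMap.congr_fun hs p).symm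

theorem exists_dualBasis (P : Type u) [AddCommGroup P] [Module R P] [Module.Finite R P]
    [Module.Projective R P] :
    ∃ (n : ℕ) (p : Fin n → P) (φ : Fin n → P →ₗ[R] R), ∀ x, ∑ i, φ i x • p i = x := by
  obtain ⟨n, π, hπ⟩ := Module.Finite.exists_fin' R P
  obtain ⟨s, hs⟩ := Module.projective_lifting_property π LinearMap.id hπ
  refine ⟨n, fun i => π fun j => if i = j then 1 else 0, fun i => LinearMap.proj i ∘ₗ s,
    fun x => ?_⟩
  exact (LinearMap.pi_apply_eq_sum_univ π (s x)).symm.trans (LinearMap.congr_fun hs x)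

namespace IsRegularGenerator

variable {u : U} (h : IsRegularGenerator R S u)
include h

theorem symm : IsRegularGenerator S R u :=
  ⟨h.right, h.left⟩

/-- The isomorphism `R ≃ U`, `r ↦ r • u`, given by a regular generator `u`. -/
def equiv : R ≃ₗ[R] U :=
  LinearEquiv.ofBijective (LinearMap.toSpanSingleton R U u) h.left

theorem equiv_symm_smul (x : U) : h.equiv.symm x • u = x :=
  h.equiv.apply_symm_apply x

theorem extendsAlongProjectives {f : K →ₗ[R] P} (hf : ExtendsAlong f U) :
    ExtendsAlongProjectives f := by
  intro Q _ _ _ _ φ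
  obtain ⟨n, q, χ, hχ⟩ := exists_dualBasis (R := R) Q
  choose ψ hψ using fun i => hf (h.equiv.toLinearMap ∘ₗ χ i ∘ₗ φ)
  refine ⟨∑ i, (h.equiv.symm.toLinearMap ∘ₗ ψ i).smulRight (q i), LinearMap.ext fun k => ?_⟩
  have hk : ∀ i, h.equiv.symm (ψ i (f k)) = χ i (φ k) := fun i => by
    rw [LinearEquiv.symm_apply_eq]
    exact LinearMap.congr_fun (hψ i) k
  simpa [hk] using hχ (φ k)

theorem torsionless [Module.Projective R P] : Torsionless R U P :=
  have : FaithfulSMul R U := ⟨fun hrs => h.left.1 (hrs u)⟩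
  .of_projective

theorem torsionless_of_isStableSummand (hMN : IsStableSummand R M N) (hN : Torsionless R U N) :
    Torsionless R U M := by
  obtain ⟨f, g, P, a, b, _, _, hab⟩ := hMN
  intro m hm
  have hf : f m = 0 := hN _ fun φ => hm (φ ∘ₗ f)
  have ha : a m = 0 := h.torsionless _ fun φ => hm (φ ∘ₗ a)
  simpa [hf, ha] using LinearMap.congr_fun hab m

end IsRegularGenerator

variable [SMulCommClass R S U]

variable (S) in
theorem lcomp_injective_of_surjective {f : M →ₗ[R] N} (hf : Function.Surjective f) :
    Function.Injective (LinearMap.lcomp S U f) :=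
  fun _ _ => (LinearMap.cancel_right hf).1

variable (S U) in
theorem lcomp_exact {f : K →ₗ[R] P} {g : P →ₗ[R] M} (hfg : Function.Exact f g)
    (hg : Function.Surjective g) :
    Function.Exact (LinearMap.lcomp S U g) (LinearMap.lcomp S U f) := by
  refine fun ψ => ⟨exists_desc_of_exact hfg hg ψ, ?_⟩
  rintro ⟨c, rfl⟩
  change c ∘ₗ g ∘ₗ f = 0
  rw [hfg.linearMap_comp_eq_zero, LinearMap.comp_zero]

theorem lcomp_sub (f g : M →ₗ[R] N) :
    LinearMap.lcomp S U (f - g) = LinearMap.lcomp S U f - LinearMap.lcomp S U g :=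
  LinearMap.ext fun _ => LinearMap.comp_sub _ _ _

variable [SMulCommClass S R U]

variable (R S U) in
/-- The evaluation map `M → Hom_S(Hom_R(M, U), U)` into the bidual. -/
def ev (M : Type u) [AddCommGroup M] [Module R M] : M →ₗ[R] ((M →ₗ[R] U) →ₗ[S] U) where
  toFun m :=
    { toFun := fun φ => φ m
      map_add' := fun _ _ => rfl
      map_smul' := fun _ _ => rfl }
  map_add' x y := LinearMap.ext fun φ => map_add φ x y
  map_smul' r x := LinearMap.ext fun φ => map_smul φ r x

@[simp] theorem ev_apply (m : M) (φ : M →ₗ[R] U) : ev R S U M m φ = φ m := rfl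

theorem ev_injective_iff : Function.Injective (ev R S U M) ↔ Torsionless R U M := by
  rw [injective_iff_map_eq_zero]
  exact forall_congr' fun m => imp_congr_left LinearMap.ext_iff

theorem exists_eq_lcomp (hN : Function.Bijective (ev R S U N))
    (e : (N →ₗ[R] U) →ₗ[S] (M →ₗ[R] U)) : ∃ f : M →ₗ[R] N, e = LinearMap.lcomp S U f := by
  let E := LinearEquiv.ofBijective (ev R S U N) hN
  refine ⟨E.symm.toLinearMap ∘ₗ LinearMap.lcomp R U e ∘ₗ ev R S U M, ?_⟩
  ext ψ x
  exact (LinearMap.congr_fun (E.apply_symm_apply (LinearMap.lcomp R U e (ev R S U M x))) ψ).symm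

namespace IsRegularGenerator

variable {u : U} (h : IsRegularGenerator R S u)
include h

theorem exists_dualBasis_dual (P : Type u) [AddCommGroup P] [Module R P] [Module.Finite R P]
    [Module.Projective R P] :
    ∃ (n : ℕ) (p : Fin n → P) (φ : Fin n → P →ₗ[R] U),
      ∀ ψ : P →ₗ[R] U, ∑ i, h.symm.equiv.symm (ψ (p i)) • φ i = ψ := by
  obtain ⟨n, p, φ, hφ⟩ := exists_dualBasis (R := R) P
  refine ⟨n, p, fun i => h.equiv.toLinearMap ∘ₗ φ i, fun ψ => LinearMap.ext fun x => ?_⟩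
  have hterm : ∀ i, h.symm.equiv.symm (ψ (p i)) • h.equiv (φ i x) = ψ (φ i x • p i) := fun i => by
    change _ • φ i x • u = _
    rw [smul_comm, h.symm.equiv_symm_smul, map_smul]
  simpa [hterm] using congrArg ψ (hφ x)

theorem finite_dual_of_projective [Module.Finite R P] [Module.Projective R P] :
    Module.Finite S (P →ₗ[R] U) := by
  obtain ⟨n, p, φ, hφ⟩ := h.exists_dualBasis_dual P
  exact Module.Finite.of_surjective (Fintype.linearCombination S φ) fun ψ => ⟨_, hφ ψ⟩

theorem projective_dual [Module.Finite R P] [Module.Projective R P] :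
    Module.Projective S (P →ₗ[R] U) := by
  obtain ⟨n, p, φ, hφ⟩ := h.exists_dualBasis_dual P
  exact Module.Projective.of_split
    (LinearMap.pi fun i => h.symm.equiv.symm.toLinearMap ∘ₗ ev R S U P (p i))
    (Fintype.linearCombination S φ) (LinearMap.ext hφ)

theorem bijective_ev [Module.Finite R P] [Module.Projective R P] :
    Function.Bijective (ev R S U P) := by
  refine ⟨ev_injective_iff.2 h.torsionless, fun F => ?_⟩
  obtain ⟨n, p, φ, hφ⟩ := h.exists_dualBasis_dual P
  refine ⟨∑ i, h.equiv.symm (F (φ i)) • p i, LinearMap.ext fun ψ => ?_⟩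
  rw [ev_apply, map_sum]
  conv_rhs => rw [← hφ ψ, map_sum]
  refine Finset.sum_congr rfl fun i _ => ?_
  rw [map_smul, map_smul, ← h.symm.equiv_symm_smul (ψ (p i)), smul_comm, h.equiv_symm_smul,
    h.symm.equiv_symm_smul]

theorem finite_dual [IsNoetherianRing S] [Module.Finite R M] : Module.Finite S (M →ₗ[R] U) := by
  obtain ⟨n, π, hπ⟩ := Module.Finite.exists_fin' R M
  have : Module.Finite S ((Fin n → R) →ₗ[R] U) := h.finite_dual_of_projective
  exact Module.Finite.of_injective (LinearMap.lcomp S U π) (lcomp_injective_of_surjective S hπ)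

theorem lcomp_mem_projectiveMaps {f : M →ₗ[R] N} (hf : f ∈ projectiveMaps R M N) :
    LinearMap.lcomp S U f ∈ projectiveMaps S (N →ₗ[R] U) (M →ₗ[R] U) := by
  obtain ⟨P, a, b, _, _, rfl⟩ := hf
  exact ⟨ModuleCat.of S (P →ₗ[R] U), LinearMap.lcomp S U b, LinearMap.lcomp S U a,
    h.finite_dual_of_projective, h.projective_dual, rfl⟩

theorem lcomp_mem_projectiveMaps_iff (hN : Function.Bijective (ev R S U N)) {f : M →ₗ[R] N} :
    LinearMap.lcomp S U f ∈ projectiveMaps S (N →ₗ[R] U) (M →ₗ[R] U) ↔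
      f ∈ projectiveMaps R M N := by
  refine ⟨fun hf => ?_, h.lcomp_mem_projectiveMaps⟩
  let E := LinearEquiv.ofBijective (ev R S U N) hN
  have hE : E.symm.toLinearMap ∘ₗ LinearMap.lcomp R U (LinearMap.lcomp S U f) ∘ₗ ev R S U M = f :=
    LinearMap.ext fun x => E.symm_apply_apply (f x)
  exact hE ▸ comp_mem_projectiveMaps_right
    (comp_mem_projectiveMaps_left (h.symm.lcomp_mem_projectiveMaps hf) _) _

theorem isStablyIndecomposable_dual (hM : Function.Bijective (ev R S U M))
    (hI : IsStablyIndecomposable R M) : IsStablyIndecomposable S (M →ₗ[R] U) := by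
  intro e he
  obtain ⟨f, rfl⟩ := exists_eq_lcomp hM e
  have hidem : LinearMap.lcomp S U (f * f - f) ∈ projectiveMaps S (M →ₗ[R] U) (M →ₗ[R] U) := by
    rwa [lcomp_sub]
  refine (hI f ((h.lcomp_mem_projectiveMaps_iff hM).1 hidem)).imp h.lcomp_mem_projectiveMaps
    fun h₁ => ?_
  have hsub := h.lcomp_mem_projectiveMaps h₁
  rwa [lcomp_sub] at hsub

theorem isStableSummand_of_dual (hM : Function.Bijective (ev R S U M))
    (hN : Function.Bijective (ev R S U N)) (hMN : IsStableSummand S (M →ₗ[R] U) (N →ₗ[R] U)) :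
    IsStableSummand R M N := by
  obtain ⟨a, b, hab⟩ := hMN
  obtain ⟨f, rfl⟩ := exists_eq_lcomp hM a
  obtain ⟨g, rfl⟩ := exists_eq_lcomp hN b
  refine ⟨g, f, (h.lcomp_mem_projectiveMaps_iff hM).1 ?_⟩
  rwa [lcomp_sub]

theorem projective_of_projective_dual (hM : Function.Bijective (ev R S U M))
    [Module.Finite S (M →ₗ[R] U)] [Module.Projective S (M →ₗ[R] U)] : Module.Projective R M :=
  (id_mem_projectiveMaps_iff.1 ((h.lcomp_mem_projectiveMaps_iff hM).1
    (mem_projectiveMaps_of_projective _))).2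

theorem bijective_ev_of_isShortExact [Module.Finite R P] [Module.Projective R P] {f : K →ₗ[R] P}
    {g : P →ₗ[R] M} (hfg : IsShortExact f g) (hf : ExtendsAlong f U) (hM : Torsionless R U M) :
    Function.Bijective (ev R S U K) := by
  refine ⟨ev_injective_iff.2 (h.torsionless.of_injective hfg.injective), fun F => ?_⟩
  obtain ⟨p, hp⟩ := h.bijective_ev.2 (F ∘ₗ LinearMap.lcomp S U f)
  have hF : ∀ ψ : P →ₗ[R] U, ψ p = F (ψ ∘ₗ f) := LinearMap.congr_fun hp
  have hgp : g p = 0 := hM _ fun φ => by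
    rw [← LinearMap.comp_apply, hF, LinearMap.comp_assoc, hfg.comp_eq_zero, LinearMap.comp_zero,
      map_zero]
  obtain ⟨k, rfl⟩ := (hfg.exact p).1 hgp
  refine ⟨k, LinearMap.ext fun φ => ?_⟩
  obtain ⟨ψ, rfl⟩ := hf φ
  exact hF ψ

end IsRegularGenerator

end Dual

section SyzygySequences

variable {R S U : Type u} [Ring R] [Ring S] [AddCommGroup U] [Module R U] [Module S U]

theorem IsSyzygyOf.exists_isShortExact_extendsAlong {N M : ModuleCat.{u} R} (h : IsSyzygyOf N M)
    (hM : ExtPerp R M U) :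
    ∃ (P : ModuleCat.{u} R) (f : N →ₗ[R] P) (g : P →ₗ[R] M), Module.Finite R P ∧
      Module.Projective R P ∧ IsShortExact f g ∧ ExtendsAlong f U ∧ ExtPerp R N U := by
  obtain ⟨P, f, g, hP, hP', hfg⟩ := h
  exact ⟨P, f, g, hP, hP', hfg, hfg.extPerp_iff.1 hM⟩

/-- `Y (k + 1)` is a syzygy of `Y k` for all `k`, and all these modules are stably indecomposable
nonprojective modules in `⊥U`. -/
structure IsSyzygySeq (U : Type u) [AddCommGroup U] [Module R U] (Y : ℕ → ModuleCat.{u} R) :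
    Prop where
  finite : ∀ k, Module.Finite R (Y k)
  syzygy : ∀ k, IsSyzygyOf (Y (k + 1)) (Y k)
  extPerp : ∀ k, ExtPerp R (Y k) U
  isStablyIndecomposable : ∀ k, IsStablyIndecomposable R (Y k)
  not_projective : ∀ k, ¬ Module.Projective R (Y k)

theorem IsSyzygySeq.isSecondSyzygy {Y : ℕ → ModuleCat.{u} R} (hY : IsSyzygySeq U Y) (k : ℕ) :
    IsSecondSyzygy (Y (k + 2)) :=
  (hY.syzygy (k + 1)).isSecondSyzygy (hY.syzygy k)

namespace IsRegularGenerator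

variable {u : U} (h : IsRegularGenerator R S u) {Y : ℕ → ModuleCat.{u} R}
include h

theorem exists_isSyzygySeq [IsNoetherianRing R] (M : ModuleCat.{u} R) [Module.Finite R M]
    (hM : ExtPerp R M U) (hI : IsStablyIndecomposable R M) (hP : ¬ Module.Projective R M) :
    ∃ Y : ℕ → ModuleCat.{u} R, Y 0 = M ∧ IsSyzygySeq U Y := by
  obtain ⟨Y, rfl, hfin, hsyz⟩ := exists_resolution M
  have hY : ∀ k, ExtPerp R (Y k) U ∧ IsStablyIndecomposable R (Y k) ∧
      ¬ Module.Projective R (Y k) := by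
    intro k
    induction k with
    | zero => exact ⟨hM, hI, hP⟩
    | succ k ih =>
      obtain ⟨hExt, hInd, hProj⟩ := ih
      obtain ⟨P, f, g, _, _, hfg, hf, hK⟩ := (hsyz k).exists_isShortExact_extendsAlong hExt
      have := hfin (k + 1)
      exact ⟨hK, hInd.syzygy hfg (h.extendsAlongProjectives hf), fun _ =>
        hProj (projective_of_projective_syzygy hfg (h.extendsAlongProjectives hf))⟩
  exact ⟨Y, rfl, hfin, hsyz, fun k => (hY k).1, fun k => (hY k).2.1, fun k => (hY k).2.2⟩

theorem isStableSummand_of_syzygy {N M N' M' : ModuleCat.{u} R} (hN : IsSyzygyOf N M)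
    (hN' : IsSyzygyOf N' M') (hM : ExtPerp R M U) (hM' : ExtPerp R M' U)
    (hNN' : IsStableSummand R N N') : IsStableSummand R M M' := by
  obtain ⟨P, f, g, _, _, hfg, hf, -⟩ := hN.exists_isShortExact_extendsAlong hM
  obtain ⟨P', f', g', _, _, hfg', hf', -⟩ := hN'.exists_isShortExact_extendsAlong hM'
  exact hNN'.cokernel hfg hfg' (h.extendsAlongProjectives hf) (h.extendsAlongProjectives hf')

theorem isStableSummand_zero (hY : IsSyzygySeq U Y) (a c : ℕ)
    (hac : IsStableSummand R (Y a) (Y (a + c))) : IsStableSummand R (Y 0) (Y c) := by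
  induction a with
  | zero => rwa [zero_add] at hac
  | succ a ih =>
    rw [add_right_comm] at hac
    exact ih (h.isStableSummand_of_syzygy (hY.syzygy a) (hY.syzygy (a + c)) (hY.extPerp _)
      (hY.extPerp _) hac)

theorem torsionless_succ (hY : IsSyzygySeq U Y) (k : ℕ) : Torsionless R U (Y (k + 1)) := by
  obtain ⟨P, f, g, _, _, hfg⟩ := hY.syzygy k
  exact (h.torsionless (P := P)).of_injective hfg.injective

theorem exists_isStableSummand_succ (hY : IsSyzygySeq U Y) {k l : ℕ} (hkl : k < l)
    (hst : IsStableSummand R (Y k) (Y l)) : ∃ c, IsStableSummand R (Y 0) (Y (c + 1)) := by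
  obtain ⟨c, rfl⟩ := Nat.exists_eq_add_of_lt hkl
  exact ⟨c, h.isStableSummand_zero hY k (c + 1) hst⟩

end IsRegularGenerator

theorem torsionless_of_forall_isIndecomposable [IsArtinianRing R] {M : Type u} [AddCommGroup M]
    [Module R M] [Module.Finite R M]
    (hM : ∀ e : Module.End R M, IsIdempotentElem e → IsIndecomposable R (LinearMap.range e) →
      Torsionless R U (LinearMap.range e)) : Torsionless R U M := by
  intro m hm
  by_contra hne
  obtain ⟨e, he, hem, hind⟩ :=
    exists_isIndecomposable_range (p := fun e : Module.End R M => e m ≠ 0) (by simp) hne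
      fun e e₁ hem _ => by
        by_contra! hcon
        exact hem (by simpa [hcon.1] using hcon.2)
  exact hem (congrArg Subtype.val
    (hM e he hind (e.rangeRestrict m) fun φ => hm (φ ∘ₗ e.rangeRestrict)))

namespace IsRegularGenerator

variable {u : U} (h : IsRegularGenerator R S u) {M : Type u} [AddCommGroup M] [Module R M]
  [Module.Finite R M]
include h

theorem torsionless_of_recurrence [IsArtinianRing R]
    (hrec : ∀ Y : ℕ → ModuleCat.{u} R, IsSyzygySeq U Y →
      ∃ k l, k < l ∧ IsStableSummand R (Y k) (Y l))
    (hM : ExtPerp R M U) : Torsionless R U M := by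
  refine torsionless_of_forall_isIndecomposable fun e he hind => ?_
  by_cases hP : Module.Projective R (LinearMap.range e)
  · exact h.torsionless
  have := (IsDirectSummand.range he).finite
  obtain ⟨Y, hY₀, hY⟩ := h.exists_isSyzygySeq (ModuleCat.of R (LinearMap.range e))
    (hM.of_isDirectSummand (IsDirectSummand.range he)) hind.isStablyIndecomposable hP
  obtain ⟨k, l, hkl, hst⟩ := hrec Y hY
  obtain ⟨c, hc⟩ := h.exists_isStableSummand_succ hY hkl hst
  rw [hY₀] at hc
  exact h.torsionless_of_isStableSummand hc (h.torsionless_succ hY c)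

theorem torsionless_of_finite [IsArtinianRing R] {C : ModuleCat.{u} R → Prop}
    (hC : IsSummandClosed C) (hfin : HasFinitelyManyNonprojective C)
    (hsub : ∀ X : ModuleCat.{u} R, Module.Finite R X → ExtPerp R X U → IsSecondSyzygy X → C X)
    (hM : ExtPerp R M U) : Torsionless R U M := by
  refine h.torsionless_of_recurrence (fun Y hY => ?_) hM
  obtain ⟨k, l, hkl, hst⟩ := exists_lt_isStableSummand hC hfin (Y := fun k => Y (k + 2))
    (fun k => hY.finite _) (fun k => hY.isStablyIndecomposable _) (fun k => hY.not_projective _)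
    fun k => hsub _ (hY.finite _) (hY.extPerp _) (hY.isSecondSyzygy k)
  exact ⟨k + 2, l + 2, by omega, hst⟩

variable [SMulCommClass R S U]

theorem isSecondSyzygy_dual [SMulCommClass S R U] {X Y : ModuleCat.{u} R} (hYX : IsSyzygyOf Y X)
    [Module.Finite R Y] : IsSecondSyzygy (ModuleCat.of S (X →ₗ[R] U)) := by
  obtain ⟨P, f, g, _, _, hfg⟩ := hYX
  obtain ⟨n, π, hπ⟩ := Module.Finite.exists_fin' R Y
  refine ⟨ModuleCat.of S (P →ₗ[R] U), ModuleCat.of S ((Fin n → R) →ₗ[R] U),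
    LinearMap.lcomp S U g, LinearMap.lcomp S U (f ∘ₗ π), h.finite_dual_of_projective,
    h.projective_dual, h.finite_dual_of_projective, h.projective_dual,
    lcomp_injective_of_surjective S hfg.surjective, fun ψ => ?_⟩
  rw [← lcomp_exact S U hfg.exact hfg.surjective ψ]
  exact map_eq_zero_iff (x := ψ ∘ₗ f) (LinearMap.lcomp S U π) (lcomp_injective_of_surjective S hπ)

variable [SMulCommClass S R U]

theorem bijective_ev_add_two {Y : ℕ → ModuleCat.{u} R} (hY : IsSyzygySeq U Y) (k : ℕ) :
    Function.Bijective (ev R S U (Y (k + 2))) := by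
  obtain ⟨P, f, g, _, _, hfg, hf, -⟩ :=
    (hY.syzygy (k + 1)).exists_isShortExact_extendsAlong (hY.extPerp _)
  exact h.bijective_ev_of_isShortExact hfg hf (h.torsionless_succ hY k)

theorem torsionless_of_finite_dual [IsArtinianRing R] [IsArtinianRing S]
    {C : ModuleCat.{u} S → Prop} (hC : IsSummandClosed C) (hfin : HasFinitelyManyNonprojective C)
    (hsub : ∀ X : ModuleCat.{u} S, Module.Finite S X → IsSecondSyzygy X → C X)
    (hM : ExtPerp R M U) : Torsionless R U M := by
  refine h.torsionless_of_recurrence (fun Y hY => ?_) hM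
  have hev := h.bijective_ev_add_two hY
  have hdual : ∀ k, Module.Finite S (Y (k + 2) →ₗ[R] U) := fun k =>
    have := hY.finite (k + 2)
    h.finite_dual
  obtain ⟨k, l, hkl, hst⟩ := exists_lt_isStableSummand hC hfin
    (Y := fun k => ModuleCat.of S (Y (k + 2) →ₗ[R] U)) hdual
    (fun k => h.isStablyIndecomposable_dual (hev k) (hY.isStablyIndecomposable _))
    (fun k hp => hY.not_projective (k + 2) <|
      have : Module.Projective S (Y (k + 2) →ₗ[R] U) := hp
      h.projective_of_projective_dual (hev k))
    (fun k => hsub _ (hdual k) <|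
      have := hY.finite (k + 3)
      h.isSecondSyzygy_dual (hY.syzygy (k + 2)))
  exact ⟨k + 2, l + 2, by omega, h.isStableSummand_of_dual (hev k) (hev l) hst⟩

end IsRegularGenerator

end SyzygySequences

section GorensteinProjective

variable {R S U : Type u} [Ring R] [Ring S] [AddCommGroup U] [Module R U] [Module S U]
  [SMulCommClass R S U]
variable {P₁ P₀ M Q : Type u} [AddCommGroup P₁] [Module R P₁] [AddCommGroup P₀] [Module R P₀]
  [AddCommGroup M] [Module R M] [AddCommGroup Q] [Module R Q]

variable (S U) in
theorem exists_isTranspose [IsNoetherianRing R] (M : ModuleCat.{u} R) [Module.Finite R M] :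
    ∃ N : ModuleCat.{u} S, IsTranspose R S U M N := by
  obtain ⟨n, g, hg⟩ := Module.Finite.exists_fin' R M
  obtain ⟨m, π, hπ⟩ := Module.Finite.exists_fin' R (LinearMap.ker g)
  refine ⟨ModuleCat.of S (((Fin m → R) →ₗ[R] U) ⧸
    LinearMap.range (LinearMap.lcomp S U ((LinearMap.ker g).subtype ∘ₗ π))),
    ModuleCat.of R (Fin m → R), ModuleCat.of R (Fin n → R), (LinearMap.ker g).subtype ∘ₗ π, g,
    inferInstanceAs (Module.Finite R (Fin m → R)),
    inferInstanceAs (Module.Projective R (Fin m → R)),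
    inferInstanceAs (Module.Finite R (Fin n → R)),
    inferInstanceAs (Module.Projective R (Fin n → R)), ?_, hg, ⟨LinearEquiv.refl _ _⟩⟩
  rw [LinearMap.exact_iff, LinearMap.range_comp, LinearMap.range_eq_top.2 hπ, Submodule.map_top,
    Submodule.range_subtype]

theorem isShortExact_liftQ {A B : Type u} [AddCommGroup A] [Module S A] [AddCommGroup B]
    [Module S B] {F : A →ₗ[S] B} {p : Submodule S A} (hp : p = LinearMap.ker F) :
    IsShortExact (p.liftQ F hp.le) (LinearMap.range F).mkQ where
  injective := LinearMap.ker_eq_bot.1 (Submodule.ker_liftQ_eq_bot _ _ _ hp.ge)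
  exact := by rw [LinearMap.exact_iff, Submodule.ker_mkQ, Submodule.range_liftQ]
  surjective := Submodule.mkQ_surjective _

theorem IsShortExact.comp_linearEquiv {K P X X' : Type u} [AddCommGroup K] [Module S K]
    [AddCommGroup P] [Module S P] [AddCommGroup X] [Module S X] [AddCommGroup X'] [Module S X']
    {f : K →ₗ[S] P} {g : P →ₗ[S] X} (h : IsShortExact f g) (e : X ≃ₗ[S] X') :
    IsShortExact f (e.toLinearMap ∘ₗ g) where
  injective := h.injective
  exact p := by simpa using h.exact p
  surjective := e.surjective.comp h.surjective

variable {f : P₁ →ₗ[R] P₀} {g : P₀ →ₗ[R] M} {j : M →ₗ[R] Q}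

variable (S) in
theorem range_lcomp_comp_eq_ker (hfg : Function.Exact f g) (hg : Function.Surjective g)
    (hj : ExtendsAlong j U) :
    LinearMap.range (LinearMap.lcomp S U (j ∘ₗ g)) = LinearMap.ker (LinearMap.lcomp S U f) := by
  rw [(lcomp_exact S U hfg hg).linearMap_ker_eq]
  exact LinearMap.range_comp_of_range_eq_top (LinearMap.lcomp S U g)
    (LinearMap.range_eq_top.2 hj : LinearMap.range (LinearMap.lcomp S U j) = ⊤)

variable [SMulCommClass S R U]

namespace IsRegularGenerator

variable {u : U} (h : IsRegularGenerator R S u)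
include h

theorem exists_leftApprox [IsNoetherianRing S] [Module.Finite R M] (hM : Torsionless R U M) :
    ∃ (Q : ModuleCat.{u} R) (j : M →ₗ[R] Q), Module.Finite R Q ∧ Module.Projective R Q ∧
      Function.Injective j ∧ ExtendsAlong j U := by
  have := h.finite_dual (M := M)
  obtain ⟨n, b, hb⟩ := Submodule.fg_iff_exists_fin_generating_family.1
    (Module.finite_def.1 (inferInstance : Module.Finite S (M →ₗ[R] U)))
  have hext : ExtendsAlong (LinearMap.pi b) U := by
    intro φ
    obtain ⟨c, rfl⟩ := (Submodule.mem_span_range_iff_exists_fun S).1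
      (hb ▸ Submodule.mem_top : φ ∈ _)
    refine ⟨∑ i, c i • LinearMap.proj i, ?_⟩
    ext m
    simp
  have := Module.Finite.equiv h.equiv
  have := Module.Projective.of_equiv (LinearEquiv.piCongrRight fun _ : Fin n => h.equiv)
  refine ⟨ModuleCat.of R (Fin n → U), LinearMap.pi b,
    inferInstanceAs (Module.Finite R (Fin n → U)),
    inferInstanceAs (Module.Projective R (Fin n → U)),
    (injective_iff_map_eq_zero _).2 fun m hm => hM m fun φ => ?_, hext⟩
  obtain ⟨ψ, rfl⟩ := hext φ
  rw [LinearMap.comp_apply, hm, map_zero]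

theorem extendsAlong_liftQ_lcomp [Module.Finite R P₀] [Module.Projective R P₀]
    (hfg : Function.Exact f g) (hg : Function.Surjective g) (hj : ExtendsAlong j U)
    (hM : Torsionless R U M) :
    ExtendsAlong ((LinearMap.range (LinearMap.lcomp S U (j ∘ₗ g))).liftQ (LinearMap.lcomp S U f)
      (range_lcomp_comp_eq_ker S hfg hg hj).le) U := by
  intro κ
  obtain ⟨p, hp⟩ := h.bijective_ev.2 (κ ∘ₗ (LinearMap.range (LinearMap.lcomp S U (j ∘ₗ g))).mkQ)
  have hκ : ∀ ψ : P₀ →ₗ[R] U, ψ p = κ (Submodule.Quotient.mk ψ) := LinearMap.congr_fun hp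
  have hgp : g p = 0 := hM _ fun φ => by
    obtain ⟨χ, rfl⟩ := hj φ
    change (χ ∘ₗ j ∘ₗ g) p = 0
    have hχ : (Submodule.Quotient.mk (χ ∘ₗ j ∘ₗ g) : _ ⧸ LinearMap.range
        (LinearMap.lcomp S U (j ∘ₗ g))) = 0 := (Submodule.Quotient.mk_eq_zero _).2 ⟨χ, rfl⟩
    rw [hκ, hχ, map_zero]
  obtain ⟨x, rfl⟩ := (hfg p).1 hgp
  exact ⟨ev R S U P₁ x, Submodule.linearMap_qext _ (LinearMap.ext hκ)⟩

theorem exists_isTranspose_syzygy [IsNoetherianRing S] {M : ModuleCat.{u} R} {N : ModuleCat.{u} S}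
    [Module.Finite R M] (hM : ExtPerp R M U) (ht : Torsionless R U M)
    (hN : IsTranspose R S U M N) :
    ∃ (C : ModuleCat.{u} R) (L F : ModuleCat.{u} S) (f : L →ₗ[S] F) (g : F →ₗ[S] N),
      Module.Projective S F ∧ IsShortExact f g ∧ ExtendsAlong f U ∧ Module.Finite R C ∧
        ExtPerp R C U ∧ IsTranspose R S U C L := by
  obtain ⟨P₁, P₀, f, g, _, _, hP₀, hP₀', hfg, hg, ⟨ε⟩⟩ := hN
  obtain ⟨Q, j, hQ, hQ', hj, hext⟩ := h.exists_leftApprox ht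
  have hjq := isShortExact_range hj
  refine ⟨ModuleCat.of R (Q ⧸ LinearMap.range j),
    ModuleCat.of S ((P₀ →ₗ[R] U) ⧸ LinearMap.range (LinearMap.lcomp S U (j ∘ₗ g))),
    ModuleCat.of S (P₁ →ₗ[R] U), _, _, h.projective_dual,
    (isShortExact_liftQ (range_lcomp_comp_eq_ker S hfg hg hext)).comp_linearEquiv ε.symm,
    h.extendsAlong_liftQ_lcomp hfg hg hext ht,
    inferInstanceAs (Module.Finite R (Q ⧸ LinearMap.range j)), hjq.extPerp_iff.2 ⟨hext, hM⟩,
    P₀, Q, j ∘ₗ g, (LinearMap.range j).mkQ, hP₀, hP₀', hQ, hQ', ?_, hjq.surjective,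
    ⟨LinearEquiv.refl _ _⟩⟩
  rw [LinearMap.exact_iff, Submodule.ker_mkQ,
    LinearMap.range_comp_of_range_eq_top _ (LinearMap.range_eq_top.2 hg)]

theorem isGPAux_of_torsionless [IsNoetherianRing R] [IsNoetherianRing S]
    (ht : ∀ M : ModuleCat.{u} R, Module.Finite R M → ExtPerp R M U → Torsionless R U M)
    {M : ModuleCat.{u} R} (hfin : Module.Finite R M) (hM : ExtPerp R M U) : IsGPAux R S U M := by
  obtain ⟨N, hN⟩ := exists_isTranspose S U M
  refine ⟨hfin, hM, N, hN, extPerp_of_coinduction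
    (fun N => ∃ M : ModuleCat.{u} R, Module.Finite R M ∧ ExtPerp R M U ∧ IsTranspose R S U M N)
    ?_ ⟨M, hfin, hM, hN⟩⟩
  rintro N ⟨M, hfin, hM, hN⟩
  obtain ⟨C, L, F, f, g, hF, hfg, hf, hC⟩ := h.exists_isTranspose_syzygy hM (ht M hfin hM) hN
  exact ⟨L, F, f, g, hF, hfg, hf, C, hC⟩

theorem bijective_ev_of_extendsAlong [Module.Finite R P₁] [Module.Projective R P₁]
    [Module.Finite R P₀] [Module.Projective R P₀] (hfg : Function.Exact f g)
    (hg : Function.Surjective g)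
    (h₁ : ExtendsAlong (LinearMap.range (LinearMap.lcomp S U f)).subtype U)
    (h₀ : ExtendsAlong (LinearMap.lcomp S U g) U) : Function.Bijective (ev R S U M) := by
  refine ⟨ev_injective_iff.2 fun m hm => ?_, fun G => ?_⟩
  · obtain ⟨p, rfl⟩ := hg m
    have hp : ev R S U P₀ p ∘ₗ (LinearMap.lcomp S U f).ker.subtype = 0 := by
      ext ⟨ψ, hψ⟩
      obtain ⟨φ, rfl⟩ := (lcomp_exact S U hfg hg ψ).1 hψ
      exact hm φ
    obtain ⟨c, hc⟩ := exists_desc_of_exact (g := (LinearMap.lcomp S U f).rangeRestrict)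
      (fun ψ => by simp [Subtype.ext_iff]) (LinearMap.surjective_rangeRestrict _) _ hp
    obtain ⟨d, rfl⟩ := h₁ c
    obtain ⟨q, rfl⟩ := h.bijective_ev.2 d
    have hpq : p = f q := h.bijective_ev.1 hc.symm
    rw [hpq, hfg.apply_apply_eq_zero]
  · obtain ⟨H, rfl⟩ := h₀ G
    obtain ⟨p, rfl⟩ := h.bijective_ev.2 H
    exact ⟨g p, rfl⟩

theorem bijective_ev_of_isGPAux {M : ModuleCat.{u} R} (hM : IsGPAux R S U M) :
    Function.Bijective (ev R S U M) := by
  obtain ⟨-, -, N, ⟨P₁, P₀, f, g, _, _, _, _, hfg, hg, ⟨ε⟩⟩, hN⟩ := hM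
  have hproj : ∀ (P : ModuleCat.{u} R) [Module.Finite R P] [Module.Projective R P],
    Module.Projective S (P →ₗ[R] U) := fun P => h.projective_dual
  have hcoker := (isShortExact_range
    (LinearMap.range (LinearMap.lcomp S U f)).injective_subtype).comp_linearEquiv
      ((Submodule.quotEquivOfEq _ _ (Submodule.range_subtype _)).trans ε.symm)
  obtain ⟨h₁, hrange⟩ := hcoker.extPerp_iff.1 hN
  have hker : IsShortExact (LinearMap.lcomp S U g) (LinearMap.lcomp S U f).rangeRestrict :=
    ⟨lcomp_injective_of_surjective S hg, fun ψ => by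
      rw [← lcomp_exact S U hfg hg ψ, Subtype.ext_iff]
      rfl, LinearMap.surjective_rangeRestrict _⟩
  exact h.bijective_ev_of_extendsAlong hfg hg h₁ (hker.extPerp_iff.1 hrange).1

theorem isSecondSyzygy_of_isGPAux [IsNoetherianRing S] {M : ModuleCat.{u} R}
    (hM : IsGPAux R S U M) : IsSecondSyzygy M := by
  have : Module.Finite R M := hM.1
  have : Module.Finite S (ModuleCat.of S (M →ₗ[R] U)) := h.finite_dual (M := M)
  obtain ⟨N, hN, hs⟩ := exists_isSyzygyOf (ModuleCat.of S (M →ₗ[R] U))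
  exact (h.symm.isSecondSyzygy_dual hs).of_linearEquiv
    (LinearEquiv.ofBijective _ (h.bijective_ev_of_isGPAux hM))

end IsRegularGenerator

end GorensteinProjective

section Adjoint

variable {K R S M N M' N' M'' N'' : Type u} [Field K] [Ring R] [Ring S]
  [AddCommGroup M] [Module R M] [Module K M] [AddCommGroup N] [Module S N] [Module K N]
  [AddCommGroup M'] [Module R M'] [Module K M'] [AddCommGroup N'] [Module S N'] [Module K N']
  [AddCommGroup M''] [Module R M''] [Module K M''] [AddCommGroup N''] [Module S N'']
  [Module K N''] {β : M →ₗ[K] N →ₗ[K] K} {β' : M' →ₗ[K] N' →ₗ[K] K} {β'' : M'' →ₗ[K] N'' →ₗ[K] K}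

/-- The linear maps `f : M → M'` and `g : N' → N` are adjoint to each other with respect to the
pairings `β` and `β'`. -/
def AreAdjoint (β : M →ₗ[K] N →ₗ[K] K) (β' : M' →ₗ[K] N' →ₗ[K] K) (f : M →ₗ[R] M')
    (g : N' →ₗ[S] N) : Prop :=
  ∀ m n, β' (f m) n = β m (g n)

namespace AreAdjoint

variable {f : M →ₗ[R] M'} {g : N' →ₗ[S] N} {f' : M' →ₗ[R] M''} {g' : N'' →ₗ[S] N'}

theorem id : AreAdjoint β β (LinearMap.id : M →ₗ[R] M) (LinearMap.id : N →ₗ[S] N) :=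
  fun _ _ => rfl

theorem symm (h : AreAdjoint β β' f g) : AreAdjoint β'.flip β.flip g f :=
  fun n m => (h m n).symm

theorem comp (h : AreAdjoint β β' f g) (h' : AreAdjoint β' β'' f' g') :
    AreAdjoint β β'' (f' ∘ₗ f) (g ∘ₗ g') :=
  fun m n => (h' (f m) n).trans (h m (g' n))

end AreAdjoint

end Adjoint

section DualPairs

variable {K R S : Type u} [Field K] [Ring R] [Ring S] [Algebra K R] [Algebra K S]

/-- A perfect pairing over `K` between an `R`-module and an `S`-module, compatible with the
anti-isomorphism `τ` from `R` to `S`. It exhibits each of the modules as the `K`-dual of the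
other. -/
structure IsDualPair (τ : R ≃ₐ[K] Sᵐᵒᵖ) {M N : Type u} [AddCommGroup M] [Module R M] [Module K M]
    [AddCommGroup N] [Module S N] [Module K N] (β : M →ₗ[K] N →ₗ[K] K) : Prop where
  smul_left : ∀ (r : R) m n, β (r • m) n = β m ((τ r).unop • n)
  isPerfPair : β.IsPerfPair

/-- The `K`-dual of an `S`-module, as an `R`-module along an anti-isomorphism from `R` to `S`. -/
def TwistedDual (_τ : R ≃ₐ[K] Sᵐᵒᵖ) (N : Type u) [AddCommGroup N] [Module K N] : Type u :=
  Module.Dual K N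

namespace TwistedDual

variable (τ : R ≃ₐ[K] Sᵐᵒᵖ) (N : Type u) [AddCommGroup N] [Module K N]

instance : AddCommGroup (TwistedDual τ N) :=
  inferInstanceAs (AddCommGroup (Module.Dual K N))

instance : Module K (TwistedDual τ N) :=
  inferInstanceAs (Module K (Module.Dual K N))

instance [Module.Finite K N] : Module.Finite K (TwistedDual τ N) :=
  inferInstanceAs (Module.Finite K (Module.Dual K N))

variable [Module S N] [IsScalarTower K S N]

instance : Module R (TwistedDual τ N) where
  smul r φ := (show Module.Dual K N from φ) ∘ₗ Algebra.lsmul K K N (τ r).unop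
  one_smul φ := by
    change (show Module.Dual K N from φ) ∘ₗ Algebra.lsmul K K N (τ 1).unop = φ
    rw [map_one, MulOpposite.unop_one, map_one]
    rfl
  mul_smul r s φ := by
    change (show Module.Dual K N from φ) ∘ₗ Algebra.lsmul K K N (τ (r * s)).unop = _
    rw [map_mul, MulOpposite.unop_mul, map_mul]
    rfl
  smul_zero _ := rfl
  smul_add _ _ _ := rfl
  add_smul r s φ := by
    change (show Module.Dual K N from φ) ∘ₗ Algebra.lsmul K K N (τ (r + s)).unop = _
    rw [map_add, MulOpposite.unop_add, map_add, LinearMap.comp_add]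
    rfl
  zero_smul φ := by
    change (show Module.Dual K N from φ) ∘ₗ Algebra.lsmul K K N (τ 0).unop = _
    rw [map_zero, MulOpposite.unop_zero, map_zero, LinearMap.comp_zero]
    rfl

instance : IsScalarTower K R (TwistedDual τ N) where
  smul_assoc k r φ := by
    change (show Module.Dual K N from φ) ∘ₗ Algebra.lsmul K K N (τ (k • r)).unop = _
    rw [map_smul, MulOpposite.unop_smul, map_smul, LinearMap.comp_smul]
    rfl

instance [Module.Finite K N] : Module.Finite R (TwistedDual τ N) :=
  Module.Finite.of_restrictScalars_finite K R _

/-- The evaluation pairing between an `S`-module and its twisted dual. -/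
def pairing : TwistedDual τ N →ₗ[K] N →ₗ[K] K :=
  LinearMap.id (M := Module.Dual K N)

theorem isDualPair [Module.Finite K N] : IsDualPair τ (pairing τ N) where
  smul_left _ _ _ := rfl
  isPerfPair := inferInstanceAs (LinearMap.id (R := K) (M := Module.Dual K N)).IsPerfPair

end TwistedDual

variable {M N M' N' M'' N'' V W : Type u}
  [AddCommGroup M] [Module R M] [Module K M] [AddCommGroup N] [Module S N] [Module K N]
  [AddCommGroup M'] [Module R M'] [Module K M'] [AddCommGroup N'] [Module S N'] [Module K N']
  [AddCommGroup M''] [Module R M''] [Module K M''] [AddCommGroup N''] [Module S N'']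
  [Module K N''] [AddCommGroup V] [Module R V] [Module K V] [AddCommGroup W] [Module S W]
  [Module K W]
  {τ : R ≃ₐ[K] Sᵐᵒᵖ} {β : M →ₗ[K] N →ₗ[K] K} {β' : M' →ₗ[K] N' →ₗ[K] K}
  {β'' : M'' →ₗ[K] N'' →ₗ[K] K} {γ : V →ₗ[K] W →ₗ[K] K}

namespace IsDualPair

theorem symm (h : IsDualPair τ β) : IsDualPair (AlgEquiv.opComm τ).symm β.flip where
  smul_left s n m := by
    obtain ⟨r, rfl⟩ := (AlgEquiv.opComm τ).surjective s
    rw [AlgEquiv.symm_apply_apply]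
    exact (h.smul_left r.unop m n).symm
  isPerfPair := h.isPerfPair.flip

theorem ext_left (h : IsDualPair τ β) {m m' : M} (hm : ∀ n, β m n = β m' n) : m = m' :=
  h.isPerfPair.bijective_left.1 (LinearMap.ext hm)

theorem ext_right (h : IsDualPair τ β) {n n' : N} (hn : ∀ m, β m n = β m n') : n = n' :=
  h.symm.ext_left hn

theorem exists_eq_apply (h : IsDualPair τ β) (φ : M →ₗ[K] K) : ∃ n, ∀ m, β m n = φ m := by
  obtain ⟨n, rfl⟩ := h.isPerfPair.bijective_right.2 φ
  exact ⟨n, fun _ => rfl⟩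

theorem finite [IsScalarTower K R M] [IsScalarTower K S N] [Module.Finite K R] [Module.Finite R M]
    (h : IsDualPair τ β) : Module.Finite S N := by
  have : Module.Finite K M := Module.Finite.trans R M
  have : Module.Finite K N := Module.Finite.of_injective β.flip h.isPerfPair.bijective_right.1
  exact Module.Finite.of_restrictScalars_finite K S N

end IsDualPair

namespace AreAdjoint

variable {f f₁ : M →ₗ[R] M'} {g g₁ : N' →ₗ[S] N} {f' : M' →ₗ[R] M''} {g' : N'' →ₗ[S] N'}

theorem unique_left (hβ' : IsDualPair τ β') (h : AreAdjoint β β' f g)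
    (h₁ : AreAdjoint β β' f₁ g) : f = f₁ :=
  LinearMap.ext fun m => hβ'.ext_left fun n => (h m n).trans (h₁ m n).symm

theorem unique_right (hβ : IsDualPair τ β) (h : AreAdjoint β β' f g)
    (h₁ : AreAdjoint β β' f g₁) : g = g₁ :=
  h.symm.unique_left hβ.symm h₁.symm

theorem injective (hβ' : IsDualPair τ β') (h : AreAdjoint β β' f g)
    (hf : Function.Surjective f) : Function.Injective g := by
  intro x y hxy
  refine hβ'.ext_right fun m => ?_
  obtain ⟨m, rfl⟩ := hf m
  rw [h, h, hxy]

variable [IsScalarTower K R M] [IsScalarTower K R M']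

theorem surjective (hβ : IsDualPair τ β) (hβ' : IsDualPair τ β') (h : AreAdjoint β β' f g)
    (hf : Function.Injective f) : Function.Surjective g := by
  intro n
  obtain ⟨l, hl⟩ := (f.restrictScalars K).exists_leftInverse_of_injective
    (LinearMap.ker_eq_bot.2 hf)
  obtain ⟨n', hn'⟩ := hβ'.exists_eq_apply (β.flip n ∘ₗ l)
  refine ⟨n', hβ.ext_right fun m => ?_⟩
  rw [← h, hn']
  exact congrArg (β · n) (LinearMap.congr_fun hl m)

theorem isShortExact [IsScalarTower K R M''] (hβ : IsDualPair τ β) (hβ' : IsDualPair τ β')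
    (hβ'' : IsDualPair τ β'') (h : AreAdjoint β β' f g) (h' : AreAdjoint β' β'' f' g')
    (hf : IsShortExact f f') : IsShortExact g' g := by
  refine ⟨h'.injective hβ'' hf.surjective, fun n => ⟨fun hn => ?_, ?_⟩,
    h.surjective hβ hβ' hf.injective⟩
  · have hvanish : β'.flip n ∘ₗ f.restrictScalars K = 0 := LinearMap.ext fun m => by
      change β' (f m) n = 0
      rw [h, hn, map_zero]
    obtain ⟨φ, hφ⟩ := exists_desc_of_exact (g := f'.restrictScalars K) hf.exact hf.surjective
      (β'.flip n) hvanish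
    obtain ⟨x, hx⟩ := hβ''.exists_eq_apply φ
    refine ⟨x, hβ'.ext_right fun m => ?_⟩
    rw [← h', hx]
    exact LinearMap.congr_fun hφ m
  · rintro ⟨x, rfl⟩
    refine hβ.ext_right fun m => ?_
    rw [← h, ← h', hf.exact.apply_apply_eq_zero, map_zero, map_zero, LinearMap.zero_apply]

end AreAdjoint

namespace IsDualPair

theorem exists_adjoint [IsScalarTower K R M] [IsScalarTower K R M'] (hβ : IsDualPair τ β)
    (hβ' : IsDualPair τ β') (f : M →ₗ[R] M') : ∃ g : N' →ₗ[S] N, AreAdjoint β β' f g := by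
  choose g hg using fun n => hβ.exists_eq_apply (β'.flip n ∘ₗ f.restrictScalars K)
  have hg : ∀ n m, β m (g n) = β' (f m) n := hg
  refine ⟨⟨⟨g, fun x y => hβ.ext_right fun m => ?_⟩, fun s x => hβ.ext_right fun m => ?_⟩,
    fun m n => (hg n m).symm⟩
  · simp only [hg, map_add]
  · obtain ⟨r, rfl⟩ := (AlgEquiv.opComm τ).surjective s
    change β m (g ((τ r.unop).unop • x)) = β m ((τ r.unop).unop • g x)
    rw [hg, ← hβ'.smul_left, ← hβ.smul_left, hg, f.map_smul]

theorem exists_adjoint_left [IsScalarTower K S N] [IsScalarTower K S N'] (hβ : IsDualPair τ β)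
    (hβ' : IsDualPair τ β') (g : N' →ₗ[S] N) : ∃ f : M →ₗ[R] M', AreAdjoint β β' f g := by
  obtain ⟨f, hf⟩ := hβ'.symm.exists_adjoint hβ.symm g
  exact ⟨f, hf.symm⟩

theorem isIndecomposable [IsScalarTower K R M] (h : IsDualPair τ β) (hN : IsIndecomposable S N) :
    IsIndecomposable R M := by
  refine ⟨?_, fun e he => ?_⟩
  · have := hN.1
    by_contra hM
    rw [not_nontrivial_iff_subsingleton] at hM
    obtain ⟨n, hn⟩ := exists_ne (0 : N)
    exact hn (h.ext_right fun m => by rw [Subsingleton.elim m 0, map_zero]; rfl)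
  · obtain ⟨f, hf⟩ := h.exists_adjoint h e
    have hef : AreAdjoint β β (e ∘ₗ e) f := by rwa [show e ∘ₗ e = e from he]
    have hff : f ∘ₗ f = f := (hf.comp hf).unique_right h hef
    rcases hN.2 f hff with rfl | rfl
    · exact .inl (hf.unique_left h fun m n => by simp)
    · exact .inr (hf.unique_left h .id)

theorem nonempty_linearEquiv [IsScalarTower K R M] [IsScalarTower K R M'] (h : IsDualPair τ β)
    (h' : IsDualPair τ β') (e : M ≃ₗ[R] M') : Nonempty (N ≃ₗ[S] N') := by
  obtain ⟨f, hf⟩ := h.exists_adjoint h' e.toLinearMap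
  obtain ⟨g, hg⟩ := h'.exists_adjoint h e.symm.toLinearMap
  have hfg := hg.comp hf
  have hgf := hf.comp hg
  rw [LinearEquiv.comp_symm] at hfg
  rw [LinearEquiv.symm_comp] at hgf
  exact ⟨LinearEquiv.ofLinearMap g f (hfg.unique_right h' .id) (hgf.unique_right h .id)⟩

theorem exists_algEquiv_end [IsScalarTower K R M] [IsScalarTower K S N] (h : IsDualPair τ β) :
    Nonempty (Module.End R M ≃ₐ[K] (Module.End S N)ᵐᵒᵖ) := by
  choose t ht using h.exists_adjoint h
  let F : Module.End R M →ₐ[K] (Module.End S N)ᵐᵒᵖ := AlgHom.ofLinearMap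
    { toFun := fun f => MulOpposite.op (t f)
      map_add' := fun f g => congrArg MulOpposite.op <| (ht (f + g)).unique_right h
        fun m n => by simp [ht f m n, ht g m n]
      map_smul' := fun k f => congrArg MulOpposite.op <| (ht (k • f)).unique_right h
        fun m n => by simp [ht f m n] }
    (congrArg MulOpposite.op <| (ht 1).unique_right h .id)
    (fun f g => congrArg MulOpposite.op <| (ht (f * g)).unique_right h ((ht g).comp (ht f)))
  refine ⟨AlgEquiv.ofBijective F ⟨fun f g hfg => ?_, fun g => ?_⟩⟩
  · have hfg : t f = t g := MulOpposite.op_injective hfg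
    exact (ht f).unique_left h (hfg ▸ ht g)
  · obtain ⟨f, hf⟩ := h.exists_adjoint_left h g.unop
    exact ⟨f, MulOpposite.unop_injective ((ht f).unique_right h hf)⟩

section Finite

variable [IsScalarTower K R M] [IsScalarTower K S N]

theorem injective [Module.Finite K R] [Module.Projective S N] (h : IsDualPair τ β) :
    Module.Injective R M := by
  refine Module.Baer.injective fun I φ => ?_
  have hI := (TwistedDual.isDualPair (AlgEquiv.opComm τ).symm I).symm
  have hR := (TwistedDual.isDualPair (AlgEquiv.opComm τ).symm R).symm
  obtain ⟨ι, hι⟩ := hI.exists_adjoint hR I.subtype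
  obtain ⟨φ', hφ'⟩ := hI.exists_adjoint h φ
  obtain ⟨ψ', rfl⟩ := Module.projective_lifting_property ι φ'
    (hι.surjective hI hR Subtype.val_injective)
  obtain ⟨ψ, hψ⟩ := hR.exists_adjoint_left h ψ'
  exact ⟨ψ, fun x hx => LinearMap.congr_fun ((hι.comp hψ).unique_left h hφ') ⟨x, hx⟩⟩

theorem projective [Module.Finite K S] [Module.Finite S N] (h : IsDualPair τ β)
    (hM : Module.Injective R M) : Module.Projective S N := by
  obtain ⟨n, g, hg⟩ := Module.Finite.exists_fin' S N
  have hF := TwistedDual.isDualPair τ (Fin n → S)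
  obtain ⟨f, hf⟩ := h.exists_adjoint_left hF g
  obtain ⟨r, hr⟩ := hM.out f (hf.symm.injective h.symm hg) LinearMap.id
  obtain ⟨s, hs⟩ := hF.exists_adjoint h r
  have hrf : r ∘ₗ f = LinearMap.id := LinearMap.ext hr
  exact Module.Projective.of_split s g ((hrf ▸ hf.comp hs).unique_right h .id)

end Finite

end IsDualPair

theorem AreAdjoint.extZero_one_iff [IsScalarTower K R V] [IsScalarTower K S W]
    [IsScalarTower K R M'] [IsScalarTower K S N'] [IsScalarTower K R M''] [IsScalarTower K S N'']
    {A B : Type u} [AddCommGroup A] [Module R A] [AddCommGroup B] [Module S B]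
    {f : A →ₗ[R] M'} {f' : M' →ₗ[R] M''} {g' : N'' →ₗ[S] N'} {g : N' →ₗ[S] B}
    [Module.Projective S N'] (hM' : Module.Injective R M') (hγ : IsDualPair τ γ)
    (hβ' : IsDualPair τ β') (hβ'' : IsDualPair τ β'') (h : AreAdjoint β' β'' f' g')
    (hf : IsShortExact f f') (hg : IsShortExact g' g) : ExtZero R V A 1 ↔ ExtZero S B W 1 := by
  rw [hf.extZero_one_iff_lift hM', ← hg.extendsAlong_iff]
  constructor
  · intro H φ
    obtain ⟨φ', hφ⟩ := hγ.exists_adjoint_left hβ'' φ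
    obtain ⟨ψ', rfl⟩ := H φ'
    obtain ⟨ψ, hψ⟩ := hγ.exists_adjoint hβ' ψ'
    exact ⟨ψ, (hψ.comp h).unique_right hγ hφ⟩
  · intro H φ
    obtain ⟨φ', hφ⟩ := hγ.exists_adjoint hβ'' φ
    obtain ⟨ψ', rfl⟩ := H φ'
    obtain ⟨ψ, hψ⟩ := hγ.exists_adjoint_left hβ' ψ'
    exact ⟨ψ, (hψ.comp h).unique_left hβ'' hφ⟩

namespace IsDualPair

variable [Module.Finite K R] [Module.Finite K S] [IsScalarTower K R V] [IsScalarTower K S W]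

theorem exists_submodule_extZero_iff [IsScalarTower K S N] [Module.Finite S N]
    (hγ : IsDualPair τ γ) (h : IsDualPair τ β) :
    ∃ (n : ℕ) (L : Submodule S (Fin n → S)), (ExtZero R V M 1 ↔ ExtZero S N W 1) ∧
      ∀ i, (ExtZero R V M (i + 2) ↔ ExtZero R V (TwistedDual τ L) (i + 1)) ∧
        (ExtZero S N W (i + 2) ↔ ExtZero S L W (i + 1)) := by
  obtain ⟨n, g, hg⟩ := Module.Finite.exists_fin' S N
  have : Module.Finite K (LinearMap.ker g) :=
    inferInstanceAs (Module.Finite K ((LinearMap.ker g).restrictScalars K))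
  have hF := TwistedDual.isDualPair τ (Fin n → S)
  have hL := TwistedDual.isDualPair τ (LinearMap.ker g)
  have hker := isShortExact_ker hg
  obtain ⟨f, hf⟩ := h.exists_adjoint_left hF g
  obtain ⟨f', hf'⟩ := hF.exists_adjoint_left hL (LinearMap.ker g).subtype
  have hdual := hf'.symm.isShortExact hL.symm hF.symm h.symm hf.symm hker
  have hinj := hF.injective
  exact ⟨n, LinearMap.ker g, hf'.extZero_one_iff hinj hγ hF hL hdual hker,
    fun i => ⟨hdual.extZero_add_two_iff_right hinj i, hker.extZero_add_two_iff_left i⟩⟩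

theorem extZero_iff (hγ : IsDualPair τ γ) (i : ℕ) {M N : Type u} [AddCommGroup M]
    [Module R M] [Module K M] [AddCommGroup N] [Module S N] [Module K N] [IsScalarTower K S N]
    [Module.Finite S N] {β : M →ₗ[K] N →ₗ[K] K} (h : IsDualPair τ β) :
    ExtZero R V M (i + 1) ↔ ExtZero S N W (i + 1) := by
  obtain ⟨n, L, h₁, h₂⟩ := hγ.exists_submodule_extZero_iff h
  induction i generalizing M N n with
  | zero => exact h₁
  | succ i ih =>
    have : Module.Finite K L := inferInstanceAs (Module.Finite K (L.restrictScalars K))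
    have : Module.Finite S L := Module.Finite.of_restrictScalars_finite K S L
    have hL := TwistedDual.isDualPair τ L
    obtain ⟨n', L', h₁', h₂'⟩ := hγ.exists_submodule_extZero_iff hL
    rw [(h₂ i).1, (h₂ i).2]
    exact ih hL n' L' h₁' h₂'

theorem extPerp_iff [IsScalarTower K S N] [Module.Finite S N] (hγ : IsDualPair τ γ)
    (h : IsDualPair τ β) : ExtPerp R V M ↔ ExtPerp S N W := by
  rw [NearlyGor.extPerp_iff, NearlyGor.extPerp_iff]
  exact forall_congr' fun i => hγ.extZero_iff i h

end IsDualPair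

end DualPairs

section RepFiniteTransfer

variable {R S : Type u} [Ring R] [Ring S] {C : ModuleCat.{u} R → Prop}
  {C' : ModuleCat.{u} S → Prop}

theorem IsRepFiniteClass.of_rel (hC : IsRepFiniteClass C)
    (T : ModuleCat.{u} R → ModuleCat.{u} S → Prop)
    (hT : ∀ N, C' N → IsIndecomposable S N → ∃ M, C M ∧ IsIndecomposable R M ∧ T M N)
    (hiso : ∀ M M' N N', T M N → T M' N' → (M ≃ₗ[R] M') → Nonempty (N ≃ₗ[S] N')) :
    IsRepFiniteClass C' := by
  classical
  obtain ⟨n, X, hX⟩ := hC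
  let Q : Fin n → ModuleCat.{u} S → Prop := fun i N => ∃ M, T M N ∧ Nonempty (M ≅ X i)
  refine ⟨n, fun i => if h : ∃ N, Q i N then h.choose else ModuleCat.of S PUnit,
    fun N hN hI => ?_⟩
  obtain ⟨M, hM, hMI, hMN⟩ := hT N hN ((indecomposable_iff N).1 hI)
  obtain ⟨i, ⟨e⟩⟩ := hX M hM ((indecomposable_iff M).2 hMI)
  have hQ : ∃ N, Q i N := ⟨N, M, hMN, ⟨e⟩⟩
  obtain ⟨M', hM', ⟨e'⟩⟩ := hQ.choose_spec
  obtain ⟨ε⟩ := hiso M M' N hQ.choose hMN hM' (e ≪≫ e'.symm).toLinearEquiv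
  exact ⟨i, by simpa only [dif_pos hQ] using ⟨ε.toModuleIso⟩⟩

theorem IsRepFiniteClass.of_dual {K : Type u} [Field K] [Algebra K R] [Algebra K S]
    [Module.Finite K S] (τ : R ≃ₐ[K] Sᵐᵒᵖ) (hC : IsRepFiniteClass C)
    (hfin : ∀ N, C' N → Module.Finite S N)
    (hdual : ∀ (N : ModuleCat.{u} S) [Module.Finite K N], C' N →
      C (ModuleCat.of R (TwistedDual τ N))) : IsRepFiniteClass C' := by
  refine hC.of_rel (fun M N => Module.Finite K N ∧ Nonempty (M ≃ₗ[R] TwistedDual τ N))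
    (fun N hN hI => ?_) ?_
  · have := hfin N hN
    have : Module.Finite K N := Module.Finite.trans S N
    exact ⟨ModuleCat.of R (TwistedDual τ N), hdual N hN,
      (TwistedDual.isDualPair τ N).isIndecomposable hI, this, ⟨LinearEquiv.refl R _⟩⟩
  · rintro M M' N N' ⟨_, ⟨e⟩⟩ ⟨_, ⟨e'⟩⟩ ε
    exact (TwistedDual.isDualPair τ N).nonempty_linearEquiv (TwistedDual.isDualPair τ N')
      (e.symm ≪≫ₗ ε ≪≫ₗ e')

end RepFiniteTransfer

section FirstSyzygies

variable {R : Type u} [Ring R]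

theorem isFirstSyzygy_iff (M : ModuleCat.{u} R) :
    IsFirstSyzygy M ↔ Module.Finite R M ∧ ∃ (P : Type u) (_ : AddCommGroup P) (_ : Module R P)
      (f : M →ₗ[R] P), Module.Finite R P ∧ Module.Projective R P ∧ Function.Injective f := by
  constructor
  · rintro ⟨P, N, f, g, hM, hfin, hproj, hf, -, -⟩
    exact ⟨hM, P, _, _, f, hfin, hproj, hf⟩
  · rintro ⟨hM, P, _, _, f, hfin, hproj, hf⟩
    have h := isShortExact_range hf
    exact ⟨ModuleCat.of R P, ModuleCat.of R (P ⧸ LinearMap.range f), f, _, hM, hfin, hproj,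
      h.injective, h.exact, h.surjective⟩

theorem isSummandClosed_isFirstSyzygy : IsSummandClosed (IsFirstSyzygy (R := R)) := by
  intro M N hMN hN
  rw [isFirstSyzygy_iff] at hN ⊢
  obtain ⟨_, P, _, _, j, hfin, hproj, hj⟩ := hN
  have hM := hMN.finite
  obtain ⟨i, p, hpi⟩ := hMN
  exact ⟨hM, P, _, _, j ∘ₗ i, hfin, hproj, hj.comp (injective_of_comp_eq_id hpi)⟩

theorem IsSecondSyzygy.isFirstSyzygy {M : ModuleCat.{u} R} [Module.Finite R M]
    (h : IsSecondSyzygy M) : IsFirstSyzygy M := by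
  obtain ⟨P, _, f, _, hP, hP', -, -, hf, -⟩ := h
  exact (isFirstSyzygy_iff M).2 ⟨‹_›, P, _, _, f, hP, hP', hf⟩

end FirstSyzygies

theorem isRegularGenerator_one {A : Type u} [Ring A] :
    IsRegularGenerator Aᵐᵒᵖ A (1 : A) where
  left := by
    convert MulOpposite.unop_bijective (α := A) using 1
    exact funext fun r => one_mul _
  right := by
    convert Function.bijective_id (α := A) using 1
    exact funext fun a => mul_one a

section Duality

variable (K : Type u) {A : Type u} [Field K] [Ring A] [Algebra K A] [Module.Finite K A]

theorem exists_isDualPair_dualRL (M : ModuleCat.{u} Aᵐᵒᵖ) [Module.Finite Aᵐᵒᵖ M] :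
    ∃ β : M →ₗ[K] dualRL K M →ₗ[K] K, IsDualPair (AlgEquiv.refl : Aᵐᵒᵖ ≃ₐ[K] Aᵐᵒᵖ) β := by
  have : Module.Finite K M := Module.Finite.trans Aᵐᵒᵖ M
  let i : dualRL K M → Module.Dual K M := fun n => n
  have i_smul (k : K) (n : dualRL K M) (m : M) : i (k • n) m = k * i n m :=
    map_smul (i n) k m
  let β : M →ₗ[K] dualRL K M →ₗ[K] K := LinearMap.mk₂ K (fun m n => i n m)
    (fun m m' n => map_add (i n) m m') (fun k m n => map_smul (i n) k m)
    (fun _ _ _ => rfl) (fun k m n => i_smul k n m)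
  refine ⟨β, fun _ _ _ => rfl, LinearMap.IsPerfPair.of_injective ?_ ?_⟩
  · refine (injective_iff_map_eq_zero β).2 fun m hm => ?_
    exact (Module.forall_dual_apply_eq_zero_iff K m).1 fun φ => LinearMap.congr_fun hm φ
  · intro n n' h
    exact LinearMap.ext fun m => LinearMap.congr_fun h m

theorem exists_isDualPair_dualLR (N : ModuleCat.{u} A) [Module.Finite A N] :
    ∃ β : dualLR K N →ₗ[K] N →ₗ[K] K, IsDualPair (AlgEquiv.refl : Aᵐᵒᵖ ≃ₐ[K] Aᵐᵒᵖ) β := by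
  have : Module.Finite K N := Module.Finite.trans A N
  let i : dualLR K N → Module.Dual K N := fun n => n
  have i_smul (k : K) (φ : dualLR K N) (n : N) : i (k • φ) n = k * i φ n :=
    map_smul (i φ) k n
  let β : dualLR K N →ₗ[K] N →ₗ[K] K := LinearMap.mk₂ K (fun φ n => i φ n)
    (fun _ _ _ => rfl) i_smul (fun φ n n' => map_add (i φ) n n')
    (fun k φ n => map_smul (i φ) k n)
  refine ⟨β, fun _ _ _ => rfl, LinearMap.IsPerfPair.of_injective' ?_ ?_⟩
  · intro φ φ' h
    exact LinearMap.ext fun n => LinearMap.congr_fun h n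
  · refine (injective_iff_map_eq_zero β.flip).2 fun n hn => ?_
    exact (Module.forall_dual_apply_eq_zero_iff K n).1 fun φ => LinearMap.congr_fun hn φ

theorem extVanishes_dualLR_iff (L : ModuleCat.{u} A) [Module.Finite A L] {M N : Type u}
    [AddCommGroup M] [Module Aᵐᵒᵖ M] [Module K M] [AddCommGroup N] [Module A N] [Module K N]
    [IsScalarTower K A N] [Module.Finite A N]
    {β : M →ₗ[K] N →ₗ[K] K} (h : IsDualPair (AlgEquiv.refl : Aᵐᵒᵖ ≃ₐ[K] Aᵐᵒᵖ) β) :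
    ExtVanishes (dualLR K L) (ModuleCat.of Aᵐᵒᵖ M) ↔ ExtPerp A N L := by
  obtain ⟨γ, hγ⟩ := exists_isDualPair_dualLR K L
  exact hγ.extPerp_iff h

theorem inDAPerp_iff (M : ModuleCat.{u} Aᵐᵒᵖ) :
    InDAPerp K M ↔ Module.Finite Aᵐᵒᵖ M ∧ ExtPerp A (dualRL K M) A := by
  refine and_congr_right fun hM => ?_
  obtain ⟨β, hβ⟩ := exists_isDualPair_dualRL K M
  have := hβ.finite
  exact extVanishes_dualLR_iff K (leftReg A) hβ

end Duality

section NearlyGorenstein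

variable {A : Type u} [Ring A]

theorem isLeftNearlyGorenstein_of_torsionless [IsNoetherianRing A] [IsNoetherianRing Aᵐᵒᵖ]
    (ht : ∀ M : ModuleCat.{u} Aᵐᵒᵖ, InPerpA M → Torsionless Aᵐᵒᵖ A M) :
    IsLeftNearlyGorenstein A :=
  fun _ => ⟨fun h => ⟨h.1, h.2.1⟩,
    fun h => isRegularGenerator_one.isGPAux_of_torsionless (fun N hN h => ht N ⟨hN, h⟩) h.1 h.2⟩

variable (K : Type u) [Field K] [Algebra K A] [Module.Finite K A]

theorem isRightNearlyGorenstein_of_torsionless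
    (ht : ∀ N : ModuleCat.{u} A, Module.Finite A N → ExtPerp A N A → Torsionless A A N) :
    IsRightNearlyGorenstein K A := by
  have := IsArtinianRing.of_finite K A
  have := IsArtinianRing.of_finite K Aᵐᵒᵖ
  intro M
  rw [inDAPerp_iff]
  refine and_congr_right fun hM => ⟨fun h => h.2.1, fun h => ?_⟩
  obtain ⟨β, hβ⟩ := exists_isDualPair_dualRL K M
  exact isRegularGenerator_one.symm.isGPAux_of_torsionless ht hβ.finite h

theorem isNearlyGorenstein_of_hasFinitelyManyNonprojective {C : ModuleCat.{u} Aᵐᵒᵖ → Prop}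
    (hC : IsSummandClosed C) (hfin : HasFinitelyManyNonprojective C)
    (hsub : ∀ X : ModuleCat.{u} Aᵐᵒᵖ, Module.Finite Aᵐᵒᵖ X → IsSecondSyzygy X → C X) :
    IsNearlyGorenstein K A := by
  have := IsArtinianRing.of_finite K A
  have := IsArtinianRing.of_finite K Aᵐᵒᵖ
  constructor
  · refine isLeftNearlyGorenstein_of_torsionless fun M ⟨_, hM⟩ => ?_
    exact isRegularGenerator_one.torsionless_of_finite hC hfin (fun X h _ h' => hsub X h h') hM
  · refine isRightNearlyGorenstein_of_torsionless K fun N _ hN => ?_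
    exact isRegularGenerator_one.symm.torsionless_of_finite_dual hC hfin hsub hN

theorem isNearlyGorenstein_of_isRepFiniteClass (h₁ : IsRepFiniteClass (InPerpA (A := A)))
    (h₂ : IsRepFiniteClass (InDAPerp K (A := A))) : IsNearlyGorenstein K A := by
  have := IsArtinianRing.of_finite K A
  have := IsArtinianRing.of_finite K Aᵐᵒᵖ
  let C : ModuleCat.{u} A → Prop := fun N => Module.Finite A N ∧ ExtPerp A N A
  have hrep : IsRepFiniteClass C :=
    h₂.of_dual (AlgEquiv.refl : Aᵐᵒᵖ ≃ₐ[K] Aᵐᵒᵖ) (fun _ hN => hN.1) fun N _ hN =>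
      have := hN.1
      ⟨inferInstanceAs (Module.Finite Aᵐᵒᵖ (TwistedDual _ N)),
        (extVanishes_dualLR_iff K (leftReg A) (TwistedDual.isDualPair _ N)).2 hN.2⟩
  have hsummand : IsSummandClosed C := fun _ _ h ⟨_, hN⟩ => ⟨h.finite, hN.of_isDirectSummand h⟩
  have hsummand' : IsSummandClosed (InPerpA (A := A)) :=
    fun _ _ h ⟨_, hN⟩ => ⟨h.finite, ExtPerp.of_isDirectSummand h hN⟩
  constructor
  · refine isLeftNearlyGorenstein_of_torsionless fun M ⟨_, hM⟩ => ?_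
    exact isRegularGenerator_one.torsionless_of_finite hsummand' (h₁.mono fun _ h => h.1)
      (fun X h h' _ => ⟨h, h'⟩) hM
  · refine isRightNearlyGorenstein_of_torsionless K fun N _ hN => ?_
    exact isRegularGenerator_one.symm.torsionless_of_finite hsummand (hrep.mono fun _ h => h.1)
      (fun X h h' _ => ⟨h, h'⟩) hN

theorem isNearlyGorenstein_of_isTorsionlessFinite (h : IsTorsionlessFinite A) :
    IsNearlyGorenstein K A :=
  isNearlyGorenstein_of_hasFinitelyManyNonprojective K isSummandClosed_isFirstSyzygy
    (h.mono fun _ hM => hM.1) fun _ _ h => h.isFirstSyzygy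

theorem isNearlyGorenstein_of_isRepFinite (h : IsRepFinite A) : IsNearlyGorenstein K A :=
  isNearlyGorenstein_of_isTorsionlessFinite K
    (h.mono fun M hM => ((isFirstSyzygy_iff M).1 hM).1)

end NearlyGorenstein

section Reflexive

variable {R S U : Type u} [Ring R] [Ring S] [AddCommGroup U] [Module R U] [Module S U]
  [SMulCommClass R S U] {M N : Type u} [AddCommGroup M] [Module R M] [AddCommGroup N] [Module R N]

theorem lcomp_injective_of_torsionless (hN : Torsionless R U N) {f g : M →ₗ[R] N}
    (h : LinearMap.lcomp S U f = LinearMap.lcomp S U g) : f = g :=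
  LinearMap.ext fun m => sub_eq_zero.1 <| hN _ fun φ => by
    rw [map_sub, sub_eq_zero]
    exact LinearMap.congr_fun (LinearMap.congr_fun h φ) m

variable [SMulCommClass S R U]

theorem isIndecomposable_dual (hM : Function.Bijective (ev R S U M))
    (hI : IsIndecomposable R M) : IsIndecomposable S (M →ₗ[R] U) := by
  have ht := ev_injective_iff.1 hM.1
  refine ⟨?_, fun e he => ?_⟩
  · have := hI.1
    obtain ⟨m, hm⟩ := exists_ne (0 : M)
    by_contra hn
    rw [not_nontrivial_iff_subsingleton] at hn
    exact hm (ht m fun φ => LinearMap.congr_fun (hn.elim φ 0) m)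
  · obtain ⟨f, rfl⟩ := exists_eq_lcomp hM e
    rcases hI.2 f (lcomp_injective_of_torsionless ht he) with rfl | rfl
    · exact .inl (LinearMap.ext fun φ => φ.comp_zero)
    · exact .inr rfl

theorem nonempty_linearEquiv_of_dual (hM : Function.Bijective (ev R S U M))
    (hN : Function.Bijective (ev R S U N)) (e : (M →ₗ[R] U) ≃ₗ[S] (N →ₗ[R] U)) :
    Nonempty (M ≃ₗ[R] N) := by
  obtain ⟨f, hf⟩ := exists_eq_lcomp hM e.toLinearMap
  obtain ⟨g, hg⟩ := exists_eq_lcomp hN e.symm.toLinearMap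
  refine ⟨LinearEquiv.ofLinearMap g f ?_ ?_⟩
  · refine lcomp_injective_of_torsionless (S := S) (ev_injective_iff.1 hN.1) ?_
    change LinearMap.lcomp S U f ∘ₗ LinearMap.lcomp S U g = LinearMap.id
    rw [← hf, ← hg, e.comp_symm]
  · refine lcomp_injective_of_torsionless (S := S) (ev_injective_iff.1 hM.1) ?_
    change LinearMap.lcomp S U g ∘ₗ LinearMap.lcomp S U f = LinearMap.id
    rw [← hf, ← hg, e.symm_comp]

theorem exists_algEquiv_end_dual (K : Type u) [Field K] [Algebra K R] [Algebra K S] [Module K U]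
    [IsScalarTower K R U] [IsScalarTower K S U] [Module K M] [IsScalarTower K R M]
    (hM : Function.Bijective (ev R S U M)) :
    Nonempty ((Module.End R M)ᵐᵒᵖ ≃ₐ[K] Module.End S (M →ₗ[R] U)) := by
  let F : (Module.End R M)ᵐᵒᵖ →ₐ[K] Module.End S (M →ₗ[R] U) := AlgHom.ofLinearMap
    { toFun := fun f => LinearMap.lcomp S U f.unop
      map_add' := fun f g => LinearMap.ext fun φ => LinearMap.comp_add f.unop g.unop φ
      map_smul' := fun k f => LinearMap.ext fun φ => LinearMap.comp_smul φ k f.unop }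
    rfl (fun _ _ => rfl)
  refine ⟨AlgEquiv.ofBijective F ⟨fun f g hfg => MulOpposite.unop_injective ?_, fun e => ?_⟩⟩
  · exact lcomp_injective_of_torsionless (ev_injective_iff.1 hM.1) hfg
  · obtain ⟨f, rfl⟩ := exists_eq_lcomp hM e
    exact ⟨MulOpposite.op f, rfl⟩

end Reflexive

section Copresented

variable {R E : Type u} [Ring R] [AddCommGroup E] [Module R E]
  {X Z Z' : Type u} [AddCommGroup X] [Module R X] [AddCommGroup Z'] [Module R Z']
  [AddCommGroup Z] [Module R Z]

/-- `X` is the kernel of a linear map from a finite power of `E` to a possibly infinite power of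
`E`; the latter is encoded by the family of its coordinates. For `E` injective and projective
these modules have dominant dimension at least two. -/
def IsCopresented (R E : Type u) [Ring R] [AddCommGroup E] [Module R E] (X : Type u)
    [AddCommGroup X] [Module R X] : Prop :=
  ∃ (ι : Type) (_ : Finite ι) (f : X →ₗ[R] (ι → E)), Function.Injective f ∧
    ∀ y, (∀ g : (ι → E) →ₗ[R] E, g ∘ₗ f = 0 → g y = 0) → y ∈ LinearMap.range f

theorem torsionless_pi (ι : Type) : Torsionless R E (ι → E) :=
  fun _ hy => funext fun i => hy (LinearMap.proj i)

theorem finite_end_linearMap_pi (ι : Type) [Finite ι] :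
    Module.Finite (Module.End R E) ((ι → E) →ₗ[R] E) := by
  classical
  have := Fintype.ofFinite ι
  exact Module.Finite.equiv (LinearMap.lsum R (fun _ : ι => E) (Module.End R E))

theorem exists_eq_eval_of_linearMap_pi {ι : Type} [Finite ι]
    (F : ((ι → E) →ₗ[R] E) →ₗ[Module.End R E] E) : ∃ y, ∀ g, F g = g y := by
  classical
  have := Fintype.ofFinite ι
  refine ⟨fun i => F (LinearMap.proj i), fun g => ?_⟩
  let c (i : ι) : Module.End R E := g ∘ₗ LinearMap.single R (fun _ => E) i
  have hg (y : ι → E) : g y = ∑ i, c i (y i) := by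
    conv_lhs => rw [← Finset.univ_sum_single y, map_sum]
    rfl
  have hsum : g = ∑ i, c i • LinearMap.proj i := LinearMap.ext fun y => by
    rw [hg, LinearMap.sum_apply]
    rfl
  rw [hg]
  conv_lhs => rw [hsum, map_sum]
  exact Finset.sum_congr rfl fun i _ => map_smul F (c i) _

namespace IsCopresented

theorem torsionless (h : IsCopresented R E X) : Torsionless R E X := by
  obtain ⟨ι, _, f, hf, -⟩ := h
  exact (torsionless_pi ι).of_injective hf

theorem pi_self (ι : Type) [Finite ι] : IsCopresented R E (ι → E) :=
  ⟨ι, ‹_›, LinearMap.id, Function.injective_id, fun y _ => ⟨y, rfl⟩⟩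

theorem pi (h : IsCopresented R E X) (n : ℕ) : IsCopresented R E (Fin n → X) := by
  obtain ⟨ι, _, f, hf, hr⟩ := h
  refine ⟨Fin n × ι, inferInstance, LinearMap.pi fun p => LinearMap.proj p.2 ∘ₗ f ∘ₗ
    LinearMap.proj p.1, fun x y hxy => ?_, fun y hy => ?_⟩
  · exact funext fun i => hf (funext fun k => congrFun hxy (i, k))
  · have hcoord (i : Fin n) : ∃ x, f x = fun k => y (i, k) := hr _ fun g hg =>
      hy (g ∘ₗ LinearMap.pi fun k => LinearMap.proj (i, k))
        (LinearMap.ext fun z => LinearMap.congr_fun hg (z i))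
    choose x hx using hcoord
    exact ⟨x, funext fun p => congrFun (hx p.1) p.2⟩

variable [Module.Injective R E]

theorem bijective_ev (h : IsCopresented R E X) :
    Function.Bijective (ev R (Module.End R E) E X) := by
  refine ⟨ev_injective_iff.2 h.torsionless, fun F => ?_⟩
  obtain ⟨ι, _, f, hf, hr⟩ := h
  obtain ⟨y, hy⟩ := exists_eq_eval_of_linearMap_pi (F ∘ₗ LinearMap.lcomp (Module.End R E) E f)
  have hy (g : (ι → E) →ₗ[R] E) : F (g ∘ₗ f) = g y := hy g
  obtain ⟨x, rfl⟩ := hr y fun g hg => by rw [← hy, hg, map_zero]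
  refine ⟨x, LinearMap.ext fun φ => ?_⟩
  obtain ⟨g, hg⟩ := Module.Injective.out f hf φ
  obtain rfl : g ∘ₗ f = φ := LinearMap.ext hg
  exact (hy g).symm

theorem finite_dual (h : IsCopresented R E X) : Module.Finite (Module.End R E) (X →ₗ[R] E) := by
  obtain ⟨ι, _, f, hf, -⟩ := h
  have := finite_end_linearMap_pi (R := R) (E := E) ι
  refine Module.Finite.of_surjective (LinearMap.lcomp (Module.End R E) E f) fun φ => ?_
  obtain ⟨g, hg⟩ := Module.Injective.out f hf φ
  exact ⟨g, LinearMap.ext hg⟩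

theorem of_exact (hZ : IsCopresented R E Z) (hZ' : Torsionless R E Z') {a : X →ₗ[R] Z}
    {b : Z →ₗ[R] Z'} (ha : Function.Injective a) (hab : Function.Exact a b) :
    IsCopresented R E X := by
  obtain ⟨ι, hι, f, hf, hr⟩ := hZ
  refine ⟨ι, hι, f ∘ₗ a, hf.comp ha, fun y hy => ?_⟩
  obtain ⟨z, rfl⟩ := hr y fun g hg => hy g (by rw [← LinearMap.comp_assoc, hg, LinearMap.zero_comp])
  have hbz : b z = 0 := hZ' _ fun φ => by
    obtain ⟨ψ, hψ⟩ := Module.Injective.out f hf (φ ∘ₗ b)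
    refine (hψ z).symm.trans (hy ψ (LinearMap.ext fun x => (hψ (a x)).trans ?_))
    rw [LinearMap.comp_apply, hab.apply_apply_eq_zero, map_zero, LinearMap.zero_apply]
  obtain ⟨x, rfl⟩ := (hab z).1 hbz
  exact ⟨x, rfl⟩

theorem of_isDirectSummand (hZ : IsCopresented R E Z) (h : IsDirectSummand R X Z) :
    IsCopresented R E X := by
  obtain ⟨f, g, hgf⟩ := h
  have hgf' (x : X) : g (f x) = x := LinearMap.congr_fun hgf x
  refine hZ.of_exact hZ.torsionless (b := LinearMap.id - f ∘ₗ g) (injective_of_comp_eq_id hgf)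
    fun z => ⟨fun hz => ⟨g z, (sub_eq_zero.1 hz).symm⟩, ?_⟩
  rintro ⟨x, rfl⟩
  simp [hgf']

theorem of_projective (hR : IsCopresented R E R) [Module.Finite R X] [Module.Projective R X] :
    IsCopresented R E X := by
  obtain ⟨n, π, hπ⟩ := Module.Finite.exists_fin' R X
  obtain ⟨s, hs⟩ := Module.projective_lifting_property π LinearMap.id hπ
  exact (hR.pi n).of_isDirectSummand ⟨s, π, hs⟩

theorem of_isSecondSyzygy (hR : IsCopresented R E R) {X : ModuleCat.{u} R}
    (h : IsSecondSyzygy X) : IsCopresented R E X := by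
  obtain ⟨P, Q, f, g, _, _, _, _, hf, hfg⟩ := h
  exact (hR.of_projective (X := P)).of_exact (hR.of_projective (X := Q)).torsionless hf hfg

end IsCopresented

theorem isRepFiniteClass_isCopresented [Module.Injective R E]
    (h : IsRepFiniteClass fun N : ModuleCat.{u} (Module.End R E) =>
      Module.Finite (Module.End R E) N) :
    IsRepFiniteClass fun X : ModuleCat.{u} R => IsCopresented R E X := by
  refine h.of_rel (fun N X => IsCopresented R E X ∧ Nonempty (N ≃ₗ[Module.End R E] (X →ₗ[R] E)))
    (fun X hX hI => ⟨ModuleCat.of (Module.End R E) (X →ₗ[R] E), hX.finite_dual,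
      isIndecomposable_dual hX.bijective_ev hI, hX, ⟨LinearEquiv.refl _ _⟩⟩) ?_
  rintro N N' X X' ⟨hX, ⟨e⟩⟩ ⟨hX', ⟨e'⟩⟩ ε
  exact nonempty_linearEquiv_of_dual hX.bijective_ev hX'.bijective_ev (e.symm ≪≫ₗ ε ≪≫ₗ e')

end Copresented

section DominantDimension

theorem exists_firstTermsProjective_of_two_le_domdim {R : Type u} [Ring R] {X : ModuleCat.{u} R}
    (h : 2 ≤ domdim X) : ∃ n, FirstTermsProjective (n + 2) X := by
  by_contra! hcon
  have hle : domdim X ≤ 1 := iSup₂_le fun n hn => by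
    match n with
    | 0 => simp
    | 1 => simp
    | n + 2 => exact absurd hn (hcon n)
  exact absurd (h.trans hle) (by decide)

theorem IsInjectiveHull.injective_of_injective_comp {R : Type u} [Ring R] {X I : ModuleCat.{u} R}
    {j : X →ₗ[R] I} (hj : IsInjectiveHull j) {Y : Type u} [AddCommGroup Y] [Module R Y]
    {c : I →ₗ[R] Y} (hc : Function.Injective (c ∘ₗ j)) : Function.Injective c := by
  refine LinearMap.ker_eq_bot.1 (hj.essential _ ((Submodule.eq_bot_iff _).2 ?_))
  rintro _ ⟨hx, x, rfl⟩
  rw [(map_eq_zero_iff _ hc).1 hx, map_zero]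

theorem isCopresented_of_firstTermsProjective {R E : Type u} [Ring R] [AddCommGroup E]
    [Module R E] [Module.Injective R E] [FaithfulSMul R E] {X : ModuleCat.{u} R} {ι : Type}
    [Finite ι] {c : X →ₗ[R] (ι → E)} (hc : Function.Injective c) {n : ℕ}
    (h : FirstTermsProjective (n + 2) X) : IsCopresented R E X := by
  obtain ⟨I₀, j, hj, -, I₁, j₁, hj₁, hI₁, -⟩ := h
  have : Module.Injective R I₀ := hj.injective_module
  obtain ⟨c', hc'⟩ := Module.Injective.out j hj.injective_map c
  obtain rfl : c' ∘ₗ j = c := LinearMap.ext hc'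
  obtain ⟨r, hr⟩ := Module.Injective.out c' (hj.injective_of_injective_comp hc) LinearMap.id
  have hI₀ : IsCopresented R E I₀ :=
    (IsCopresented.pi_self ι).of_isDirectSummand ⟨c', r, LinearMap.ext hr⟩
  exact hI₀.of_exact (Torsionless.of_projective.of_injective hj₁.injective_map)
    hj.injective_map (isShortExact_range hj.injective_map).exact

theorem exists_injective_pi_of_faithfulSMul (K : Type u) {R E : Type u} [Field K] [Ring R]
    [Algebra K R] [AddCommGroup E] [Module R E] [Module K E] [IsScalarTower K R E]
    [Module.Finite K E] [FaithfulSMul R E] :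
    ∃ (n : ℕ) (c : R →ₗ[R] (Fin n → E)), Function.Injective c := by
  let b := Module.finBasis K E
  refine ⟨_, LinearMap.pi fun i => LinearMap.toSpanSingleton R E (b i), fun r s hrs => ?_⟩
  have hlsmul : Algebra.lsmul K K E r = Algebra.lsmul K K E s := b.ext fun i => congrFun hrs i
  exact FaithfulSMul.eq_of_smul_eq_smul fun y : E => LinearMap.congr_fun hlsmul y

theorem finite_end (K R E : Type u) [Field K] [Ring R] [Algebra K R] [AddCommGroup E] [Module R E]
    [Module K E] [IsScalarTower K R E] [Module.Finite K E] : Module.Finite K (Module.End R E) :=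
  Module.Finite.of_injective (LinearMap.restrictScalarsₗ K R E E K)
    (LinearMap.restrictScalars_injective K)

instance {A : Type u} [Ring A] (e : A) : Module.Finite Aᵐᵒᵖ (rightIdeal e) :=
  inferInstanceAs (Module.Finite Aᵐᵒᵖ (Submodule.span Aᵐᵒᵖ ({e} : Set A)))

theorem isCopresented_regular (K : Type u) {A : Type u} [Field K] [Ring A] [Algebra K A]
    [Module.Finite K A] {e : A} (he : IsMinimalFaithfulIdempotent e)
    (hd : 2 ≤ domdim (rightReg A)) :
    IsCopresented Aᵐᵒᵖ (rightIdeal e) Aᵐᵒᵖ := by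
  have : Module.Finite K (rightIdeal e) := Module.Finite.trans Aᵐᵒᵖ _
  obtain ⟨-, -, _, _, -⟩ := he
  obtain ⟨n, hn⟩ := exists_firstTermsProjective_of_two_le_domdim hd
  obtain ⟨d, c, hc⟩ := exists_injective_pi_of_faithfulSMul K (R := Aᵐᵒᵖ) (E := rightIdeal e)
  let ε : Aᵐᵒᵖ ≃ₗ[Aᵐᵒᵖ] A := isRegularGenerator_one.equiv
  have hA := isCopresented_of_firstTermsProjective (X := rightReg A)
    (c := c ∘ₗ ε.symm.toLinearMap) (hc.comp ε.symm.injective) hn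
  exact hA.of_isDirectSummand (.of_linearEquiv ε)

variable {K A : Type u} [Field K] [Ring A] [Algebra K A] [Module.Finite K A] {e : A}

theorem exists_algEquiv_end_rightIdeal (he : Module.Injective Aᵐᵒᵖ (rightIdeal e)) :
    Nonempty (Module.End Aᵐᵒᵖ (rightIdeal e) ≃ₐ[K]
      Module.End Aᵐᵒᵖ (dualRL K (rightIdeal e) →ₗ[A] A)) := by
  obtain ⟨β, hβ⟩ := exists_isDualPair_dualRL K (rightIdeal e)
  have := hβ.finite
  have := hβ.projective he
  obtain ⟨σ⟩ := hβ.exists_algEquiv_end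
  obtain ⟨σ'⟩ := exists_algEquiv_end_dual K
    ((isRegularGenerator_one (A := A)).symm.bijective_ev (P := dualRL K (rightIdeal e)))
  exact ⟨σ.trans σ'⟩

theorem isRepFiniteClass_isCopresented_rightIdeal (he : Module.Injective Aᵐᵒᵖ (rightIdeal e))
    (h : IsRepFinite (algebraB₂ K e)) :
    IsRepFiniteClass fun X : ModuleCat.{u} Aᵐᵒᵖ => IsCopresented Aᵐᵒᵖ (rightIdeal e) X := by
  have : Module.Finite K (rightIdeal e) := Module.Finite.trans Aᵐᵒᵖ _
  have := finite_end K Aᵐᵒᵖ (rightIdeal e)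
  obtain ⟨σ⟩ := exists_algEquiv_end_rightIdeal (K := K) he
  have hB : IsRepFinite (Module.End Aᵐᵒᵖ (dualRL K (rightIdeal e) →ₗ[A] A)) := h
  exact isRepFiniteClass_isCopresented <|
    IsRepFiniteClass.of_dual (AlgEquiv.op σ.symm) hB (fun _ hN => hN) fun N _ _ =>
      inferInstanceAs (Module.Finite _ (TwistedDual _ N))

theorem isCMFinite_and_isNearlyGorenstein (he : IsMinimalFaithfulIdempotent e)
    (hd : 2 ≤ domdim (rightReg A)) (h : IsRepFinite (algebraB₂ K e)) :
    IsCMFinite A ∧ IsNearlyGorenstein K A := by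
  have hA := isCopresented_regular K he hd
  obtain ⟨-, -, hE, -⟩ := he
  have hrep := isRepFiniteClass_isCopresented_rightIdeal hE h
  have := IsArtinianRing.of_finite K A
  exact ⟨hrep.mono fun _ hM => hA.of_isSecondSyzygy
      (isRegularGenerator_one.isSecondSyzygy_of_isGPAux hM),
    isNearlyGorenstein_of_hasFinitelyManyNonprojective K (fun _ _ h hN => hN.of_isDirectSummand h)
      (hrep.mono fun _ hM => hM.1) fun _ _ hX => hA.of_isSecondSyzygy hX⟩

end DominantDimension

section Semiprimary

variable {R : Type u} [Ring R]

theorem exists_isIdempotentElem_mem [IsSemiprimaryRing R] (L : Ideal R) :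
    ∃ g ∈ L, IsIdempotentElem g ∧ ∀ l ∈ L, l * (1 - g) ∈ Ring.jacobson R := by
  let q := Ideal.Quotient.mk (Ring.jacobson R)
  have hq : Function.Surjective q := Ideal.Quotient.mk_surjective
  have hnil : ∀ x ∈ RingHom.ker q, IsNilpotent x := fun x hx => by
    obtain ⟨n, hn⟩ := IsSemiprimaryRing.isNilpotent (R := R)
    exact ⟨n, by simpa [hn] using Ideal.pow_mem_pow (Ideal.Quotient.eq_zero_iff_mem.1 hx) n⟩
  obtain ⟨e, he, hspan⟩ := IsSemisimpleRing.ideal_eq_span_idempotent (L.map q)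
  obtain ⟨x, hx, rfl⟩ := (Ideal.mem_map_iff_of_surjective q hq).1
    (hspan ▸ Ideal.mem_span_singleton_self e)
  obtain ⟨g, hg, hgx⟩ := exists_isIdempotentElem_eq_of_ker_isNilpotent q hnil (q x) ⟨x, rfl⟩ he
  -- Conjugating the lift `g` by the unit `v = 1 - (g - x)` moves it into `L`, as `g * v = g * x`.
  obtain ⟨v, hv⟩ := (hnil (g - x) (by simp [RingHom.mem_ker, hgx])).isUnit_one_sub
  have hgv : g * v = g * x := by rw [hv, mul_sub, mul_sub, hg.eq, mul_one, sub_sub_cancel]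
  have hqv : q v = 1 := by simp [hv, hgx]
  have hconj : q (↑v⁻¹ * (g * x)) = q x := calc
    _ = q (v * (↑v⁻¹ * (g * x))) := by rw [map_mul q (v : R), hqv, one_mul]
    _ = q x := by rw [Units.mul_inv_cancel_left, map_mul, hgx, he.eq]
  refine ⟨↑v⁻¹ * (g * x), L.mul_mem_left _ (L.mul_mem_left _ hx), ?_, fun l hl => ?_⟩
  · rw [IsIdempotentElem, ← hgv, mul_assoc, mul_assoc, Units.mul_inv_cancel_left,
      ← mul_assoc g g, hg.eq]
  · obtain ⟨c, hc⟩ := Ideal.mem_span_singleton'.1 (hspan ▸ Ideal.mem_map_of_mem q hl)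
    rw [← Ideal.Quotient.eq_zero_iff_mem]
    change q _ = 0
    rw [map_mul, map_sub, map_one, hconj, ← hc, mul_assoc, mul_sub, he.eq, mul_one, sub_self,
      mul_zero]

theorem exists_isIdempotentElem_mul [IsSemiprimaryRing R] {a : R} (ha : a ∉ Ring.jacobson R) :
    ∃ b : R, b * a ≠ 0 ∧ IsIdempotentElem (b * a) := by
  obtain ⟨g, hg, hid, hl⟩ := exists_isIdempotentElem_mem (Ideal.span {a})
  obtain ⟨b, rfl⟩ := Ideal.mem_span_singleton'.1 hg
  refine ⟨b, fun h0 => ha ?_, hid⟩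
  simpa [h0] using hl a (Ideal.mem_span_singleton_self a)

variable {M T : Type u} [AddCommGroup M] [Module R M] [AddCommGroup T] [Module R T]

theorem IsIndecomposable.apply_mem_jacobson [IsSemiprimaryRing R] (h : IsIndecomposable R M)
    (hP : ¬ Module.Projective R M) (φ : M →ₗ[R] R) (m : M) : φ m ∈ Ring.jacobson R := by
  by_contra hm
  obtain ⟨b, h0, hid⟩ := exists_isIdempotentElem_mul hm
  let θ : R →ₗ[R] M := LinearMap.toSpanSingleton R M ((b * φ m) • b • m)
  have hφθ : ∀ r, φ (θ r) = r * (b * φ m) := fun r => by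
    simp only [θ, LinearMap.toSpanSingleton_apply, map_smul, smul_eq_mul, hid.eq]
  have hθ : ∀ r, θ (φ (θ r)) = θ r := fun r => by
    rw [hφθ]
    change (r * (b * φ m)) • (b * φ m) • b • m = r • (b * φ m) • b • m
    rw [mul_smul, ← mul_smul (b * φ m) (b * φ m), hid.eq]
  rcases h.2 (θ ∘ₗ φ) (LinearMap.ext fun x => hθ (φ x)) with hzero | hone
  · refine h0 ?_
    have h1 : θ 1 = 0 := by rw [← hθ, ← LinearMap.comp_apply, hzero, LinearMap.zero_apply]
    rw [← one_mul (b * φ m), ← hφθ, h1, map_zero]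
  · exact hP (Module.Projective.of_split φ θ hone)

theorem smul_eq_zero_of_mem_jacobson [IsSemisimpleModule R M] {j : R} (hj : j ∈ Ring.jacobson R)
    (m : M) : j • m = 0 :=
  Module.mem_annihilator.1 (IsSemisimpleModule.jacobson_le_annihilator R M hj) m

theorem isSemisimpleModule_of_smul_eq_zero [IsSemisimpleRing (R ⧸ Ring.jacobson R)]
    (h : ∀ j ∈ Ring.jacobson R, ∀ m : M, j • m = 0) : IsSemisimpleModule R M := by
  have hM : Module.IsTorsionBySet R M (Ring.jacobson R) := fun m j => h j j.2 m
  let := hM.module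
  exact hM.isSemisimpleModule_iff.1 inferInstance

theorem exists_injective_quotient_of_isSimpleModule [IsSimpleModule R T] {L : Ideal R}
    [IsSemisimpleModule R (R ⧸ L)] (hL : ∀ a ∈ L, ∀ t : T, a • t = 0) :
    ∃ s : T →ₗ[R] R ⧸ L, Function.Injective s := by
  have := IsSimpleModule.nontrivial R T
  obtain ⟨t, ht⟩ := exists_ne (0 : T)
  let p : (R ⧸ L) →ₗ[R] T := L.liftQ (LinearMap.toSpanSingleton R T t) fun a ha => hL a ha t
  have hp : Function.Surjective p := fun x => by
    obtain ⟨r, rfl⟩ := IsSimpleModule.toSpanSingleton_surjective R ht x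
    exact ⟨L.mkQ r, rfl⟩
  obtain ⟨s, hs⟩ := IsSemisimpleModule.lifting_property p hp (LinearMap.id : T →ₗ[R] T)
  exact ⟨s, injective_of_comp_eq_id hs⟩

theorem IsIndecomposable.isSimpleModule [IsSemisimpleModule R M] (h : IsIndecomposable R M) :
    IsSimpleModule R M := by
  have := h.1
  refine { eq_bot_or_eq_top := fun N => ?_ }
  obtain ⟨N', hN'⟩ := exists_isCompl N
  rw [← Submodule.range_projection hN']
  rcases h.2 _ (Submodule.isIdempotentElem_projection hN') with h0 | h1
  · exact Or.inl (by rw [h0, LinearMap.range_zero])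
  · exact Or.inr (by rw [h1, Module.End.one_eq_id, LinearMap.range_id])

theorem isIndecomposable_of_isSimpleModule [IsSimpleModule R T] : IsIndecomposable R T := by
  refine ⟨IsSimpleModule.nontrivial R T, fun e he => ?_⟩
  rcases e.injective_or_eq_zero with hinj | h0
  · exact Or.inr (LinearMap.ext fun x => hinj (LinearMap.congr_fun he x))
  · exact Or.inl h0

/-- Every simple module embeds into the semisimple module `R ⧸ Ring.jacobson R`, which has finitely
many isotypic components. -/
theorem isRepFiniteClass_isSimpleModule [IsSemisimpleRing (R ⧸ Ring.jacobson R)] :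
    IsRepFiniteClass fun M : ModuleCat.{u} R => IsSimpleModule R M := by
  classical
  let V := R ⧸ Ring.jacobson R
  have : IsSemisimpleModule R V := isSemisimpleModule_of_smul_eq_zero fun j hj v => by
    obtain ⟨r, rfl⟩ := Submodule.mkQ_surjective _ v
    exact (Submodule.Quotient.mk_eq_zero _).2 (Ideal.mul_mem_right r _ hj)
  have : IsNoetherian R V := inferInstance
  obtain ⟨n, ⟨ε⟩⟩ := Finite.exists_equiv_fin (isotypicComponents R V)
  choose S hS hcS using fun c : isotypicComponents R V => c.2
  refine ⟨n, fun i => ModuleCat.of R (S (ε.symm i)), fun M hM _ => ?_⟩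
  obtain ⟨s, hs⟩ := exists_injective_quotient_of_isSimpleModule (T := M) (L := Ring.jacobson R)
    fun j hj => smul_eq_zero_of_mem_jacobson hj
  let e : M ≃ₗ[R] LinearMap.range s := LinearEquiv.ofInjective s hs
  have hsimple : IsSimpleModule R (LinearMap.range s) := IsSimpleModule.congr e.symm
  let c : isotypicComponents R V := ⟨isotypicComponent R V (LinearMap.range s), _, hsimple, rfl⟩
  have hle : LinearMap.range s ≤ isotypicComponent R V (S c) :=
    (Submodule.le_isotypicComponent _).trans (hcS c).le
  have := hS c
  obtain ⟨e'⟩ := isIsotypicOfType_submodule_iff.1 (.isotypicComponent R V (S c)) _ hle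
  refine ⟨ε c, ⟨LinearEquiv.toModuleIso ?_⟩⟩
  rw [ε.symm_apply_apply]
  exact e.trans e'

end Semiprimary

section RadSquareZero

variable {R : Type u} [Ring R]

theorem mul_eq_zero_of_jacobson_sq_eq_bot (hJ : Ring.jacobson R ^ 2 = ⊥) {x y : R}
    (hx : x ∈ Ring.jacobson R) (hy : y ∈ Ring.jacobson R) : x * y = 0 := by
  have h : x * y ∈ Ring.jacobson R ^ 2 := by
    rw [Ideal.IsTwoSided.pow_succ, Submodule.pow_one]
    exact Ideal.mul_mem_mul hx hy
  rwa [hJ] at h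

variable {M : Type u} [AddCommGroup M] [Module R M]

theorem IsIndecomposable.isSimpleModule_of_torsionless [IsSemiprimaryRing R]
    (hJ : Ring.jacobson R ^ 2 = ⊥) (h : IsIndecomposable R M) (hP : ¬ Module.Projective R M)
    (ht : Torsionless R R M) : IsSimpleModule R M :=
  have : IsSemisimpleModule R M := isSemisimpleModule_of_smul_eq_zero fun j hj m =>
    ht _ fun φ => by
      rw [map_smul]
      exact mul_eq_zero_of_jacobson_sq_eq_bot hJ hj (h.apply_mem_jacobson hP φ m)
  h.isSimpleModule

theorem hasFinitelyManyNonprojective_isFirstSyzygy [IsSemiprimaryRing R]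
    (hJ : Ring.jacobson R ^ 2 = ⊥) : HasFinitelyManyNonprojective (IsFirstSyzygy (R := R)) := by
  obtain ⟨n, X, hX⟩ := isRepFiniteClass_isSimpleModule (R := R)
  refine ⟨n, X, fun M ⟨hM, hP⟩ hind => hX M ?_ hind⟩
  obtain ⟨-, P, _, _, f, _, _, hf⟩ := (isFirstSyzygy_iff M).1 hM
  exact ((indecomposable_iff M).1 hind).isSimpleModule_of_torsionless hJ hP
    (Torsionless.of_projective.of_injective hf)

end RadSquareZero

section PerpSimple

variable {R U : Type u} [Ring R] [AddCommGroup U] [Module R U]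
variable {M T : Type u} [AddCommGroup M] [Module R M] [AddCommGroup T] [Module R T]

theorem IsStableSummand.isDirectSummand [IsSimpleModule R T] (hT : ¬ Module.Projective R T)
    (h : IsStableSummand R T M) : IsDirectSummand R T M := by
  obtain ⟨i, p, hpi⟩ := h
  refine ⟨i, p, sub_eq_zero.1 (by_contra fun hne => hT ?_)⟩
  let e := LinearEquiv.ofBijective _ (LinearMap.bijective_of_ne_zero hne)
  have hid : e.symm.toLinearMap ∘ₗ (p ∘ₗ i - LinearMap.id) = LinearMap.id :=
    LinearMap.ext e.symm_apply_apply
  exact (id_mem_projectiveMaps_iff.1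
    (hid ▸ comp_mem_projectiveMaps_right hpi e.symm.toLinearMap)).2

theorem smul_eq_zero_of_forall_isSimpleModule [IsSemisimpleModule R M] {a : R}
    (h : ∀ X : Submodule R M, IsSimpleModule R X → ∀ x : X, a • x = 0) (m : M) : a • m = 0 := by
  have hm : m ∈ sSup {X : Submodule R M | IsSimpleModule R X} := by
    rw [IsSemisimpleModule.sSup_simples_eq_top]
    exact Submodule.mem_top
  rw [sSup_eq_iSup'] at hm
  induction hm using Submodule.iSup_induction' with
  | mem X x hx => exact congrArg Subtype.val (h X X.2 ⟨x, hx⟩)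
  | zero => exact smul_zero a
  | add x y _ _ hx hy => rw [smul_add, hx, hy, add_zero]

theorem extPerp_of_isFiniteLength {L : Ideal R}
    (hL : ∀ (T : Type u) [AddCommGroup T] [Module R T] [IsSimpleModule R T],
      (∀ a ∈ L, ∀ t : T, a • t = 0) → ExtPerp R T U)
    (hM : IsFiniteLength R M) (h : ∀ a ∈ L, ∀ m : M, a • m = 0) : ExtPerp R M U := by
  induction hM with
  | of_subsingleton => exact ExtPerp.of_projective
  | @of_simple_quotient M _ _ N _ _ ih =>
    have hN := extPerp_iff.1 (ih fun a ha n => Subtype.ext (h a ha n))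
    have hQ := extPerp_iff.1 (hL (M ⧸ N) fun a ha q => by
      obtain ⟨m, rfl⟩ := N.mkQ_surjective q
      rw [← map_smul, h a ha, map_zero])
    have hexact : IsShortExact N.subtype N.mkQ :=
      ⟨N.subtype_injective, LinearMap.exact_subtype_mkQ N, N.mkQ_surjective⟩
    exact extPerp_iff.2 fun i => hexact.extZero_middle (hN i) (hQ i)

theorem injective_of_forall_extPerp_quotient (h : ∀ I : Ideal R, ExtPerp R (R ⧸ I) U) :
    Module.Injective R U := by
  refine Module.Baer.injective fun I g => ?_
  have hI : IsShortExact I.subtype I.mkQ :=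
    ⟨I.subtype_injective, LinearMap.exact_subtype_mkQ I, I.mkQ_surjective⟩
  obtain ⟨ψ, hψ⟩ := (hI.extPerp_iff.1 (h I)).1 g
  exact ⟨ψ, fun x hx => LinearMap.congr_fun hψ ⟨x, hx⟩⟩

/-- The simple nonprojective modules in `⊥U`. -/
structure IsPerpSimple (R U T : Type u) [Ring R] [AddCommGroup U] [Module R U] [AddCommGroup T]
    [Module R T] : Prop where
  isSimpleModule : IsSimpleModule R T
  not_projective : ¬ Module.Projective R T
  extPerp : ExtPerp R T U

theorem IsPerpSimple.of_linearEquiv (h : IsPerpSimple R U T) (e : M ≃ₗ[R] T) :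
    IsPerpSimple R U M where
  isSimpleModule :=
    have := h.isSimpleModule
    IsSimpleModule.congr e
  not_projective := fun _ => h.not_projective (Module.Projective.of_equiv e)
  extPerp := h.extPerp.of_isDirectSummand (IsDirectSummand.of_linearEquiv e)

variable (R U) in
/-- The common annihilator of the simple nonprojective modules in `⊥U`. -/
def perpAnnihilator : Ideal R :=
  ⨅ (T : ModuleCat.{u} R) (_ : IsPerpSimple R U T), Module.annihilator R T

theorem mem_perpAnnihilator {a : R} : a ∈ perpAnnihilator R U ↔
    ∀ T : ModuleCat.{u} R, IsPerpSimple R U T → ∀ t : T, a • t = 0 := by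
  simp only [perpAnnihilator, Submodule.mem_iInf, Module.mem_annihilator]

theorem IsPerpSimple.smul_eq_zero (h : IsPerpSimple R U T) {a : R}
    (ha : a ∈ perpAnnihilator R U) (t : T) : a • t = 0 :=
  mem_perpAnnihilator.1 ha (ModuleCat.of R T) h t

instance : (perpAnnihilator R U).IsTwoSided where
  mul_mem_of_left b ha := mem_perpAnnihilator.2 fun T hT t => by
    rw [mul_smul]
    exact hT.smul_eq_zero ha (b • t)

theorem jacobson_le_perpAnnihilator : Ring.jacobson R ≤ perpAnnihilator R U := fun _ hj =>
  mem_perpAnnihilator.2 fun _ hT t =>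
    have := hT.isSimpleModule
    smul_eq_zero_of_mem_jacobson hj t

theorem isPerpSimple_of_smul_eq_zero [IsSemisimpleRing (R ⧸ Ring.jacobson R)] [IsSimpleModule R T]
    (h : ∀ a ∈ perpAnnihilator R U, ∀ t : T, a • t = 0) : IsPerpSimple R U T := by
  let L := perpAnnihilator R U
  have : IsSemisimpleModule R (R ⧸ L) := isSemisimpleModule_of_smul_eq_zero fun j hj x => by
    obtain ⟨r, rfl⟩ := L.mkQ_surjective x
    exact (Submodule.Quotient.mk_eq_zero L).2
      (L.mul_mem_right r (jacobson_le_perpAnnihilator hj))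
  obtain ⟨s, hs⟩ := exists_injective_quotient_of_isSimpleModule h
  have := IsSimpleModule.nontrivial R T
  obtain ⟨t, ht⟩ := exists_ne (0 : T)
  obtain ⟨r, hr⟩ := L.mkQ_surjective (s t)
  have hrL : r ∉ L := fun hmem => ht <| (map_eq_zero_iff s hs).1 <|
    hr ▸ (Submodule.Quotient.mk_eq_zero L).2 hmem
  obtain ⟨X, hX, x, hx⟩ : ∃ X : ModuleCat.{u} R, IsPerpSimple R U X ∧ ∃ x : X, r • x ≠ 0 := by
    contrapose! hrL
    exact mem_perpAnnihilator.2 hrL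
  have := hX.isSimpleModule
  let q : (R ⧸ L) →ₗ[R] X :=
    L.liftQ (LinearMap.toSpanSingleton R X x) fun a ha => hX.smul_eq_zero ha x
  have hqs : q ∘ₗ s ≠ 0 := fun h0 => hx <| calc
    r • x = q (L.mkQ r) := rfl
    _ = 0 := by rw [hr, ← LinearMap.comp_apply, h0, LinearMap.zero_apply]
  exact hX.of_linearEquiv (LinearEquiv.ofBijective _ (LinearMap.bijective_of_ne_zero hqs))

theorem exists_isPerpSimple_submodule [IsSemisimpleRing (R ⧸ Ring.jacobson R)] [Nontrivial M]
    (h : ∀ a ∈ perpAnnihilator R U, ∀ m : M, a • m = 0) :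
    ∃ T : Submodule R M, IsPerpSimple R U T := by
  have : IsSemisimpleModule R M :=
    isSemisimpleModule_of_smul_eq_zero fun j hj => h j (jacobson_le_perpAnnihilator hj)
  obtain ⟨T, hT⟩ := IsSemisimpleModule.exists_simple_submodule R M
  exact ⟨T, isPerpSimple_of_smul_eq_zero fun a ha t => Subtype.ext (h a ha t)⟩

end PerpSimple

section Idempotent

variable {R : Type u} [Ring R] {e f : R}

theorem mul_eq_self_of_mem_span_singleton (he : IsIdempotentElem e) {x : R}
    (hx : x ∈ Ideal.span {e}) : x * e = x := by
  obtain ⟨r, rfl⟩ := Ideal.mem_span_singleton'.1 hx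
  rw [mul_assoc, he.eq]

theorem projective_span_singleton (he : IsIdempotentElem e) :
    Module.Projective R (Ideal.span {e}) :=
  Module.Projective.of_split (Ideal.span {e}).subtype
    ((LinearMap.toSpanSingleton R R e).codRestrict (Ideal.span {e})
      fun r => Ideal.mul_mem_left _ r (Ideal.mem_span_singleton_self e))
    (LinearMap.ext fun x => Subtype.ext (mul_eq_self_of_mem_span_singleton he x.2))

theorem mem_jacobson_smul_top_of_coe_mem (he : IsIdempotentElem e) {x : Ideal.span {e}}
    (hx : (x : R) ∈ Ring.jacobson R) :
    x ∈ (Ring.jacobson R • ⊤ : Submodule R (Ideal.span {e})) := by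
  have hmul : (x : R) • (⟨e, Ideal.mem_span_singleton_self e⟩ : Ideal.span {e}) = x :=
    Subtype.ext (mul_eq_self_of_mem_span_singleton he x.2)
  exact hmul ▸ Submodule.smul_mem_smul hx Submodule.mem_top

theorem mul_mul_mem_jacobson_of_forall_mul_mul_eq_zero [IsSemiprimaryRing R]
    (h : ∀ r, f * r * e = 0) (r : R) : e * r * f ∈ Ring.jacobson R := by
  by_contra hr
  obtain ⟨b, hne, hid⟩ := exists_isIdempotentElem_mul hr
  refine hne (hid.eq ▸ ?_)
  calc b * (e * r * f) * (b * (e * r * f)) = b * e * r * (f * b * e) * r * f := by noncomm_ring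
    _ = 0 := by rw [h, mul_zero, zero_mul, zero_mul]

variable {K T : Type u} [AddCommGroup K] [Module R K] [AddCommGroup T] [Module R T]

theorem exists_surjective_span_one_sub [IsSimpleModule R T] (h : ∀ t : T, f • t = 0) :
    ∃ p : Ideal.span {1 - f} →ₗ[R] T, Function.Surjective p := by
  have := IsSimpleModule.nontrivial R T
  obtain ⟨t, ht⟩ := exists_ne (0 : T)
  refine ⟨LinearMap.toSpanSingleton R T t ∘ₗ (Ideal.span {1 - f}).subtype, fun x => ?_⟩
  obtain ⟨r, rfl⟩ := IsSimpleModule.toSpanSingleton_surjective R ht x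
  refine ⟨⟨r * (1 - f), Ideal.mul_mem_left _ r (Ideal.mem_span_singleton_self _)⟩, ?_⟩
  change (r * (1 - f)) • t = r • t
  rw [mul_smul, sub_smul, one_smul, h, sub_zero]

theorem exists_eq_mul_of_isDirectSummand (he : IsIdempotentElem e) {i : K →ₗ[R] Ideal.span {e}}
    (hi : ExtendsAlong i R) (hT : IsDirectSummand R T K) (φ : T →ₗ[R] R) :
    ∃ (ψ : T →ₗ[R] R) (w : R), ∀ t, φ t = ψ t * (e * w) := by
  obtain ⟨a, b, hba⟩ := hT
  obtain ⟨h, hh⟩ := hi (φ ∘ₗ b)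
  let e' : Ideal.span {e} := ⟨e, Ideal.mem_span_singleton_self e⟩
  have hmul : ∀ x : Ideal.span {e}, h x = x * (e * h e') := fun x => by
    rw [← mul_assoc, mul_eq_self_of_mem_span_singleton he x.2, ← smul_eq_mul, ← map_smul]
    exact congrArg h (Subtype.ext (mul_eq_self_of_mem_span_singleton he x.2).symm)
  refine ⟨(Ideal.span {e}).subtype ∘ₗ i ∘ₗ a, h e', fun t => ?_⟩
  calc φ t = (φ ∘ₗ b) (a t) := congrArg φ (LinearMap.congr_fun hba t).symm
    _ = h (i (a t)) := (LinearMap.congr_fun hh (a t)).symm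
    _ = i (a t) * (e * h e') := hmul _

end Idempotent

section RadSquareZeroPerp

variable {R : Type u} [Ring R]
variable {P T : Type u} [AddCommGroup P] [Module R P] [AddCommGroup T] [Module R T]

theorem isSemisimpleModule_jacobson_smul_top [IsSemisimpleRing (R ⧸ Ring.jacobson R)]
    (hJ : Ring.jacobson R ^ 2 = ⊥) :
    IsSemisimpleModule R (Ring.jacobson R • ⊤ : Submodule R P) :=
  isSemisimpleModule_of_smul_eq_zero fun j hj x => Subtype.ext <| by
    refine Submodule.smul_induction_on x.2 (p := fun x => j • x = 0) (fun k hk p _ => ?_)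
      fun x y hx hy => by rw [smul_add, hx, hy, add_zero]
    rw [← mul_smul, mul_eq_zero_of_jacobson_sq_eq_bot hJ hj hk, zero_smul]

theorem map_eq_zero_of_mem_jacobson_smul_top [IsSemisimpleModule R T] (φ : P →ₗ[R] T) {x : P}
    (hx : x ∈ (Ring.jacobson R • ⊤ : Submodule R P)) : φ x = 0 :=
  Submodule.smul_induction_on hx
    (fun j hj p _ => by rw [map_smul, smul_eq_zero_of_mem_jacobson hj])
    fun x y hx hy => by rw [map_add, hx, hy, add_zero]

/-- A retraction of `J P` onto a projective simple summand would extend to a map from `P`, which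
kills `J P`. -/
theorem not_projective_of_isSimpleModule_jacobson_smul_top
    (hext : ExtendsAlongProjectives (Ring.jacobson R • ⊤ : Submodule R P).subtype)
    {X : Submodule R (Ring.jacobson R • ⊤ : Submodule R P)} [IsSimpleModule R X]
    (hX : IsDirectSummand R X (Ring.jacobson R • ⊤ : Submodule R P)) :
    ¬ Module.Projective R X := by
  intro _
  obtain ⟨i, p, hpi⟩ := hX
  obtain ⟨φ, hφ⟩ := hext X p
  have := IsSimpleModule.nontrivial R X
  obtain ⟨x, hx⟩ := exists_ne (0 : X)
  refine hx ?_
  calc x = p (i x) := (LinearMap.congr_fun hpi x).symm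
    _ = φ (i x) := by rw [← hφ]; rfl
    _ = 0 := map_eq_zero_of_mem_jacobson_smul_top φ (i x).2

variable {S U : Type u} [Ring S] [AddCommGroup U] [Module R U] [Module S U] {u : U}
variable {M : Type u} [AddCommGroup M] [Module R M]

theorem perpAnnihilator_smul_eq_zero [IsArtinianRing R] (hJ : Ring.jacobson R ^ 2 = ⊥)
    (hu : IsRegularGenerator R S u) [Module.Finite R P] [Module.Projective R P]
    (hP : ∀ a ∈ perpAnnihilator R U, ∀ p : P, a • p ∈ (Ring.jacobson R • ⊤ : Submodule R P))
    {a : R} (ha : a ∈ perpAnnihilator R U) {x : P}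
    (hx : x ∈ (Ring.jacobson R • ⊤ : Submodule R P)) : a • x = 0 := by
  let JP : Submodule R P := Ring.jacobson R • ⊤
  have hJP : IsShortExact JP.subtype JP.mkQ :=
    ⟨JP.subtype_injective, LinearMap.exact_subtype_mkQ JP, JP.mkQ_surjective⟩
  have hquot : ExtPerp R (P ⧸ JP) U := by
    refine extPerp_of_isFiniteLength (L := perpAnnihilator R U)
      (fun T _ _ _ hT => (isPerpSimple_of_smul_eq_zero hT).extPerp)
      (isFiniteLength_iff_isNoetherian_isArtinian.2 ⟨inferInstance, inferInstance⟩) fun b hb q => ?_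
    obtain ⟨p, rfl⟩ := JP.mkQ_surjective q
    exact (Submodule.Quotient.mk_eq_zero JP).2 (hP b hb p)
  obtain ⟨hext, hperp⟩ := hJP.extPerp_iff.1 hquot
  have : IsSemisimpleModule R JP := isSemisimpleModule_jacobson_smul_top hJ
  suffices h : ∀ y : JP, a • y = 0 from congrArg Subtype.val (h ⟨x, hx⟩)
  refine smul_eq_zero_of_forall_isSimpleModule fun X hX => ?_
  obtain ⟨X', hX'⟩ := exists_isCompl X
  have hsummand : IsDirectSummand R X JP := ⟨X.subtype, X.projectionOnto X' hX',
    LinearMap.ext fun y => Submodule.projectionOnto_apply_left hX' y⟩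
  have hXperp : IsPerpSimple R U X := ⟨hX,
    not_projective_of_isSimpleModule_jacobson_smul_top (hu.extendsAlongProjectives hext) hsummand,
    hperp.of_isDirectSummand hsummand⟩
  exact hXperp.smul_eq_zero ha

theorem IsIndecomposable.isPerpSimple [IsArtinianRing R] (hJ : Ring.jacobson R ^ 2 = ⊥)
    (hu : IsRegularGenerator R S u) [Module.Finite R M] (hind : IsIndecomposable R M)
    (hP : ¬ Module.Projective R M) (hM : ExtPerp R M U) : IsPerpSimple R U M := by
  have htors : Torsionless R U M := hu.torsionless_of_finite isSummandClosed_isFirstSyzygy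
    (hasFinitelyManyNonprojective_isFirstSyzygy hJ) (fun _ _ _ hX => hX.isFirstSyzygy) hM
  have htors' : Torsionless R R M := fun m hm => htors m fun φ =>
    (map_eq_zero_iff _ hu.equiv.symm.injective).1 (hm (hu.equiv.symm.toLinearMap ∘ₗ φ))
  exact ⟨hind.isSimpleModule_of_torsionless hJ hP htors', hP, hM⟩

theorem exists_isPerpSimple [IsArtinianRing R] (hJ : Ring.jacobson R ^ 2 = ⊥)
    (hu : IsRegularGenerator R S u) [Module.Finite R M] (hP : ¬ Module.Projective R M)
    (hM : ExtPerp R M U) : ∃ T : ModuleCat.{u} R, IsPerpSimple R U T := by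
  obtain ⟨e, he, hne, hind⟩ := exists_isIndecomposable_range
    (p := fun e : Module.End R M => e ∉ projectiveMaps R M M) (not_not.2 (zero_mem _))
    (fun h => hP (id_mem_projectiveMaps_iff.1 h).2) fun e e₁ hne _ => by
      by_contra! hcon
      exact hne ((add_sub_cancel e₁ e) ▸ add_mem hcon.1 hcon.2)
  have hproj : ¬ Module.Projective R (LinearMap.range e) := fun _ =>
    hne (comp_mem_projectiveMaps_right (mem_projectiveMaps_of_projective e.rangeRestrict)
      (LinearMap.range e).subtype)
  exact ⟨ModuleCat.of R (LinearMap.range e),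
    hind.isPerpSimple hJ hu hproj (hM.of_isDirectSummand (IsDirectSummand.range he))⟩

/-- Among the syzygies of `T` one is stably a summand of a later one, so `T` is stably a summand of
a syzygy of one of them. -/
theorem IsPerpSimple.exists_isDirectSummand_ker [IsArtinianRing R] (hJ : Ring.jacobson R ^ 2 = ⊥)
    (hu : IsRegularGenerator R S u) (hT : IsPerpSimple R U T) :
    ∃ Z : ModuleCat.{u} R, IsPerpSimple R U Z ∧ ∀ (P : Type u) [AddCommGroup P] [Module R P]
      [Module.Finite R P] [Module.Projective R P] (g : P →ₗ[R] Z), Function.Surjective g →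
        IsDirectSummand R T (LinearMap.ker g) := by
  have := hT.isSimpleModule
  obtain ⟨Y, hY₀, hY⟩ := hu.exists_isSyzygySeq (ModuleCat.of R T) hT.extPerp
    isIndecomposable_of_isSimpleModule.isStablyIndecomposable hT.not_projective
  have hfin := hY.finite
  obtain ⟨k, l, hkl, hst⟩ := exists_lt_isStableSummand isSummandClosed_isFirstSyzygy
    (hasFinitelyManyNonprojective_isFirstSyzygy hJ) (fun k => hfin (k + 2))
    (fun k => hY.isStablyIndecomposable (k + 2)) (fun k => hY.not_projective (k + 2))
    fun k => (hY.isSecondSyzygy k).isFirstSyzygy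
  obtain ⟨c, hc⟩ := hu.exists_isStableSummand_succ hY (Nat.add_lt_add_right hkl 2) hst
  rw [hY₀] at hc
  obtain ⟨Z, hZ, hZind, hZY, hYZ⟩ :=
    (hY.isStablyIndecomposable c).exists_stable_iso (hY.not_projective c)
  have := hZY.finite
  obtain ⟨Q, f, q, _, _, hfq⟩ := hY.syzygy c
  refine ⟨Z, hZind.isPerpSimple hJ hu hZ ((hY.extPerp c).of_isDirectSummand hZY),
    fun P _ _ _ _ g hg => ?_⟩
  exact (hc.trans (hYZ.syzygy hfq (isShortExact_ker hg))).isDirectSummand hT.not_projective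

end RadSquareZeroPerp

section CentralIdempotent

variable {R S U : Type u} [Ring R] [Ring S] [AddCommGroup U] [Module R U] [Module S U] {u : U}
  [IsArtinianRing R] (hJ : Ring.jacobson R ^ 2 = ⊥) (hu : IsRegularGenerator R S u) {f : R}
  (hf : IsIdempotentElem f) (hfL : f ∈ perpAnnihilator R U)
  (hLf : ∀ l ∈ perpAnnihilator R U, l * (1 - f) ∈ Ring.jacobson R)
include hJ hu hf hfL hLf

theorem mul_mul_one_sub_eq_zero (r : R) : f * r * (1 - f) = 0 := by
  have := projective_span_singleton hf.one_sub
  have hJP : ∀ a ∈ perpAnnihilator R U, ∀ p : Ideal.span {1 - f},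
      a • p ∈ (Ring.jacobson R • ⊤ : Submodule R (Ideal.span {1 - f})) := fun a ha p => by
    refine mem_jacobson_smul_top_of_coe_mem hf.one_sub ?_
    rw [← mul_eq_self_of_mem_span_singleton hf.one_sub (a • p).2]
    exact hLf _ (Ideal.mul_mem_right _ _ ha)
  let x : Ideal.span {1 - f} :=
    ⟨f * r * (1 - f), Ideal.mul_mem_left _ _ (Ideal.mem_span_singleton_self _)⟩
  have hx := mem_jacobson_smul_top_of_coe_mem hf.one_sub (x := x)
    (hLf _ (Ideal.mul_mem_right r _ hfL))
  have hfr : f * (f * r * (1 - f)) = 0 :=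
    congrArg Subtype.val (perpAnnihilator_smul_eq_zero hJ hu hJP hfL hx)
  rwa [← mul_assoc, ← mul_assoc, hf.eq] at hfr

/-- By the previous lemma such a map factors through `Rad R` times `(1 - f) * R * f ⊆ Rad R`. -/
theorem IsPerpSimple.eq_zero_of_apply_mul_eq_apply {T : Type u} [AddCommGroup T] [Module R T]
    (hT : IsPerpSimple R U T) (φ : T →ₗ[R] R) (hφ : ∀ t, φ t * f = φ t) : φ = 0 := by
  have := hT.isSimpleModule
  obtain ⟨Z, hZ, hker⟩ := hT.exists_isDirectSummand_ker hJ hu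
  have := hZ.isSimpleModule
  have := projective_span_singleton hf.one_sub
  obtain ⟨p, hp⟩ := exists_surjective_span_one_sub (T := Z) (hZ.smul_eq_zero hfL)
  obtain ⟨hext, -⟩ := (isShortExact_ker hp).extPerp_iff.1 hZ.extPerp
  obtain ⟨ψ, w, hψ⟩ := exists_eq_mul_of_isDirectSummand hf.one_sub
    (hu.extendsAlongProjectives hext R) (hker _ p hp) φ
  refine LinearMap.ext fun t => ?_
  have hψJ : ψ t ∈ Ring.jacobson R :=
    isIndecomposable_of_isSimpleModule.apply_mem_jacobson hT.not_projective ψ t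
  have hwJ : (1 - f) * w * f ∈ Ring.jacobson R := mul_mul_mem_jacobson_of_forall_mul_mul_eq_zero
    (mul_mul_one_sub_eq_zero hJ hu hf hfL hLf) w
  calc φ t = ψ t * ((1 - f) * w * f) := by rw [← hφ, hψ, mul_assoc]
    _ = 0 := mul_eq_zero_of_jacobson_sq_eq_bot hJ hψJ hwJ

theorem one_sub_mul_mul_eq_zero (r : R) : (1 - f) * r * f = 0 := by
  by_contra hne
  let x : R := (1 - f) * r * f
  have hxJ : x ∈ Ring.jacobson R := mul_mul_mem_jacobson_of_forall_mul_mul_eq_zero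
    (mul_mul_one_sub_eq_zero hJ hu hf hfL hLf) r
  have hLx : ∀ a ∈ perpAnnihilator R U, a * x = 0 := fun a ha => calc
    a * x = a * (1 - f) * x := by simp only [x, mul_assoc, hf.one_sub.mul_self_mul]
    _ = 0 := mul_eq_zero_of_jacobson_sq_eq_bot hJ (hLf a ha) hxJ
  have : Nontrivial (Ideal.span {x}) :=
    ⟨⟨x, Ideal.mem_span_singleton_self x⟩, 0, fun h => hne (congrArg Subtype.val h)⟩
  obtain ⟨T, hT⟩ := exists_isPerpSimple_submodule (R := R) (U := U) (M := Ideal.span {x})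
      fun a ha y => by
    obtain ⟨b, hb⟩ := Ideal.mem_span_singleton'.1 y.2
    refine Subtype.ext ?_
    change a * (y : R) = 0
    rw [← hb, ← mul_assoc, hLx _ (Ideal.mul_mem_right b _ ha)]
  have hzero := hT.eq_zero_of_apply_mul_eq_apply hJ hu hf hfL hLf
    ((Ideal.span {x}).subtype ∘ₗ T.subtype) fun t => by
      obtain ⟨b, hb⟩ := Ideal.mem_span_singleton'.1 (t : Ideal.span {x}).2
      change ((t : Ideal.span {x}) : R) * f = (t : Ideal.span {x})
      simp only [← hb, x, mul_assoc, hf.eq]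
  have := hT.isSimpleModule
  have := IsSimpleModule.nontrivial R T
  obtain ⟨t, ht⟩ := exists_ne (0 : T)
  exact ht (Subtype.ext (Subtype.ext (LinearMap.congr_fun hzero t)))

theorem mul_comm_of_perpAnnihilator (r : R) : f * r = r * f := by
  have hleft := mul_mul_one_sub_eq_zero hJ hu hf hfL hLf r
  have hright := one_sub_mul_mul_eq_zero hJ hu hf hfL hLf r
  rw [mul_sub, mul_one, sub_eq_zero] at hleft
  rw [sub_mul, sub_mul, one_mul, sub_eq_zero] at hright
  rw [hleft, hright]

end CentralIdempotent

theorem projective_of_extPerp_of_jacobson_sq_eq_bot {R S U : Type u} [Ring R] [Ring S]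
    [AddCommGroup U] [Module R U] [Module S U] {u : U} [IsArtinianRing R]
    (hJ : Ring.jacobson R ^ 2 = ⊥) (hu : IsRegularGenerator R S u)
    (hconn : ∀ e : R, (∀ r, e * r = r * e) → IsIdempotentElem e → e = 0 ∨ e = 1)
    (hU : ¬ Module.Injective R U) {M : Type u} [AddCommGroup M] [Module R M] [Module.Finite R M]
    (hM : ExtPerp R M U) : Module.Projective R M := by
  by_contra hP
  obtain ⟨T, hT⟩ := exists_isPerpSimple hJ hu hP hM
  obtain ⟨f, hfL, hf, hLf⟩ := exists_isIdempotentElem_mem (perpAnnihilator R U)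
  rcases hconn f (mul_comm_of_perpAnnihilator hJ hu hf hfL hLf) hf with rfl | rfl
  · refine hU (injective_of_forall_extPerp_quotient fun I => ?_)
    refine extPerp_of_isFiniteLength (L := ⊥) (fun T _ _ _ _ => ?_)
      (isFiniteLength_iff_isNoetherian_isArtinian.2 ⟨inferInstance, inferInstance⟩) fun a ha m => by
        rw [(Submodule.mem_bot R).1 ha, zero_smul]
    refine (isPerpSimple_of_smul_eq_zero fun a ha => smul_eq_zero_of_mem_jacobson ?_).extPerp
    simpa only [sub_zero, mul_one] using hLf a ha
  · have := hT.isSimpleModule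
    have := IsSimpleModule.nontrivial R T
    obtain ⟨t, ht⟩ := exists_ne (0 : T)
    exact ht (by simpa only [one_smul] using hT.smul_eq_zero hfL t)

section GlobalDimension

variable {R U : Type u} [Ring R] [AddCommGroup U] [Module R U]

theorem extZero_of_hasInjectiveDimensionLE {n : ℕ}
    (hU : HasInjectiveDimensionLE (ModuleCat.of R U) n)
    {Y : ℕ → ModuleCat.{u} R} (hY : ∀ k, IsSyzygyOf (Y (k + 1)) (Y k)) (k : ℕ) {i : ℕ}
    (hi : n < i + k + 1) : ExtZero R (Y k) U (i + 1) := by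
  induction k generalizing i with
  | zero =>
    exact ⟨fun a b => (a.eq_zero_of_hasInjectiveDimensionLT (n + 1) (by lia)).trans
      (b.eq_zero_of_hasInjectiveDimensionLT (n + 1) (by lia)).symm⟩
  | succ k ih =>
    obtain ⟨P, f, g, _, _, hfg⟩ := hY k
    exact (hfg.extZero_add_two_iff_left i).1 (ih (by lia))

theorem IsSyzygyOf.hasProjectiveDimensionLE {N M : ModuleCat.{u} R} (h : IsSyzygyOf N M) {n : ℕ}
    (hN : HasProjectiveDimensionLE N n) : HasProjectiveDimensionLE M (n + 1) := by
  obtain ⟨P, f, g, _, hP, hfg⟩ := h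
  have hP' : Projective (ModuleCat.of R P) := (IsProjective.iff_projective (R := R) P).1 hP
  exact (hfg.shortExact.hasProjectiveDimensionLT_X₃_iff n hP').2 hN

theorem hasProjectiveDimensionLE_of_extPerp_projective [IsNoetherianRing R] {n : ℕ}
    (hU : HasInjectiveDimensionLE (ModuleCat.of R U) n)
    (h : ∀ M : ModuleCat.{u} R, Module.Finite R M → ExtPerp R M U → Module.Projective R M)
    (M : ModuleCat.{u} R) [Module.Finite R M] : HasProjectiveDimensionLE M n := by
  obtain ⟨Y, rfl, hfin, hY⟩ := exists_resolution M
  suffices hpd : ∀ k l, k + l = n → HasProjectiveDimensionLE (Y l) k from hpd n 0 rfl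
  intro k
  induction k with
  | zero =>
    intro l hl
    have hproj := h (Y l) (hfin l) (extPerp_iff.2 fun i =>
      extZero_of_hasInjectiveDimensionLE hU hY l (by lia))
    exact (projective_iff_hasProjectiveDimensionLE_zero (Y l)).1
      ((IsProjective.iff_projective (R := R) (Y l)).1 hproj)
  | succ k ih =>
    intro l hl
    exact (hY l).hasProjectiveDimensionLE (ih (l + 1) (by lia))

end GlobalDimension

section RadSquareZeroAlgebra

variable {A : Type u} [Ring A]

theorem unop_mem_jacobson [IsSemisimpleRing (A ⧸ Ring.jacobson A)] {x : Aᵐᵒᵖ}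
    (hx : x ∈ Ring.jacobson Aᵐᵒᵖ) : x.unop ∈ Ring.jacobson A := by
  let q : Aᵐᵒᵖ →+* (A ⧸ Ring.jacobson A)ᵐᵒᵖ := (Ideal.Quotient.mk (Ring.jacobson A)).op
  have : RingHomSurjective q := ⟨fun y => by
    obtain ⟨a, ha⟩ := Ideal.Quotient.mk_surjective y.unop
    exact ⟨MulOpposite.op a, MulOpposite.unop_injective ha⟩⟩
  have hq : q x = 0 := (IsSemisimpleRing.jacobson_eq_bot (A ⧸ Ring.jacobson A)ᵐᵒᵖ).le
    (Ring.le_comap_jacobson q hx)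
  exact Ideal.Quotient.eq_zero_iff_mem.1 (congrArg MulOpposite.unop hq)

theorem jacobson_mulOpposite_sq_eq_bot [IsSemisimpleRing (A ⧸ Ring.jacobson A)]
    (h : Ring.jacobson A ^ 2 = ⊥) : Ring.jacobson Aᵐᵒᵖ ^ 2 = ⊥ := by
  rw [Ideal.IsTwoSided.pow_succ, Submodule.pow_one, eq_bot_iff, Ideal.mul_le]
  exact fun x hx y hy => MulOpposite.unop_injective
    (mul_eq_zero_of_jacobson_sq_eq_bot h (unop_mem_jacobson hy) (unop_mem_jacobson hx))

theorem isNearlyGorenstein_of_radSqZero (K : Type u) [Field K] [Algebra K A] [Module.Finite K A]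
    (h : Ring.jacobson A ^ 2 = ⊥) : IsNearlyGorenstein K A :=
  have := IsArtinianRing.of_finite K A
  have := IsArtinianRing.of_finite K Aᵐᵒᵖ
  isNearlyGorenstein_of_hasFinitelyManyNonprojective K isSummandClosed_isFirstSyzygy
    (hasFinitelyManyNonprojective_isFirstSyzygy (jacobson_mulOpposite_sq_eq_bot h))
    fun _ _ hM => hM.isFirstSyzygy

theorem IsConnectedAlgebra.eq_zero_or_eq_one_of_mulOpposite (h : IsConnectedAlgebra A) {e : Aᵐᵒᵖ}
    (hcomm : ∀ r, e * r = r * e) (he : IsIdempotentElem e) : e = 0 ∨ e = 1 := by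
  have hcenter : e.unop ∈ Subring.center A := Subring.mem_center_iff.2 fun r =>
    congrArg MulOpposite.unop (hcomm (MulOpposite.op r))
  exact (h.2 e.unop hcenter (congrArg MulOpposite.unop he)).imp
    (fun h₀ => MulOpposite.unop_injective h₀) fun h₁ => MulOpposite.unop_injective h₁

theorem inPerpA_iff_of_radSqZero [IsArtinianRing A] [IsArtinianRing Aᵐᵒᵖ]
    (h : Ring.jacobson A ^ 2 = ⊥) (hconn : IsConnectedAlgebra A) (hself : ¬ IsSelfinjective A)
    (M : ModuleCat.{u} Aᵐᵒᵖ) :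
    InPerpA M ↔ Module.Finite Aᵐᵒᵖ M ∧ Module.Projective Aᵐᵒᵖ M :=
  and_congr_right fun _ =>
    ⟨fun hM => projective_of_extPerp_of_jacobson_sq_eq_bot (jacobson_mulOpposite_sq_eq_bot h)
      isRegularGenerator_one (fun _ => hconn.eq_zero_or_eq_one_of_mulOpposite) hself hM,
    fun _ => ExtPerp.of_projective⟩

theorem not_isGorenstein_or_hasFiniteGlobalDimension [IsNoetherianRing Aᵐᵒᵖ]
    (h : ∀ M : ModuleCat.{u} Aᵐᵒᵖ, InPerpA M ↔ Module.Finite Aᵐᵒᵖ M ∧ Module.Projective Aᵐᵒᵖ M) :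
    ¬ IsGorenstein A ∨ HasFiniteGlobalDimension A :=
  or_iff_not_imp_left.2 fun hG => by
    obtain ⟨g, hg, -⟩ := not_not.1 hG
    have hU := (injectiveDimension_le_iff _ g).1 hg.le
    exact ⟨g, fun M _ => hasProjectiveDimensionLE_of_extPerp_projective hU
      (fun N hN hE => ((h N).1 ⟨hN, hE⟩).2) M⟩

end RadSquareZeroAlgebra

end NearlyGor

end

theorem mainTheorem5 {K A : Type u} [Field K] [Ring A] [Algebra K A] [Module.Finite K A] :
    ((NearlyGor.IsRepFiniteClass (NearlyGor.InPerpA (A := A)) ∧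
        NearlyGor.IsRepFiniteClass (NearlyGor.InDAPerp K (A := A)) →
          NearlyGor.IsNearlyGorenstein K A) ∧
      (NearlyGor.IsRepFinite A → NearlyGor.IsNearlyGorenstein K A)) ∧
    (∀ e : A, 2 ≤ NearlyGor.domdim (NearlyGor.rightReg A) →
      NearlyGor.IsMinimalFaithfulIdempotent e →
      NearlyGor.IsRepFinite (NearlyGor.algebraB₂ K e) →
        NearlyGor.IsCMFinite A ∧ NearlyGor.IsNearlyGorenstein K A) ∧
    (NearlyGor.IsTorsionlessFinite A → NearlyGor.IsNearlyGorenstein K A) ∧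
    (Ring.jacobson A ^ 2 = ⊥ →
      NearlyGor.IsNearlyGorenstein K A ∧
      (NearlyGor.IsConnectedAlgebra A → ¬ NearlyGor.IsSelfinjective A →
        (∀ M : ModuleCat.{u} Aᵐᵒᵖ, NearlyGor.InPerpA M ↔
          Module.Finite Aᵐᵒᵖ M ∧ Module.Projective Aᵐᵒᵖ M) ∧
        (¬ NearlyGor.IsGorenstein A ∨ NearlyGor.HasFiniteGlobalDimension A))) := by
  have := IsArtinianRing.of_finite K A
  have := IsArtinianRing.of_finite K Aᵐᵒᵖ
  refine ⟨⟨fun h => NearlyGor.isNearlyGorenstein_of_isRepFiniteClass K h.1 h.2,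
    NearlyGor.isNearlyGorenstein_of_isRepFinite K⟩,
    fun e hd he h => NearlyGor.isCMFinite_and_isNearlyGorenstein he hd h,
    NearlyGor.isNearlyGorenstein_of_isTorsionlessFinite K,
    fun h => ⟨NearlyGor.isNearlyGorenstein_of_radSqZero K h, fun hconn hself => ?_⟩⟩
  have hperp := NearlyGor.inPerpA_iff_of_radSqZero h hconn hself
  exact ⟨hperp, NearlyGor.not_isGorenstein_or_hasFiniteGlobalDimension hperp⟩
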